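/- For $n\ge 1$ let $\Pi^{\rm even}_{2n}$ be the poset of partitions of $\{1,\dots,2n\}$ all of whose blocks have even size, ordered by refinement; its top element $\hat 1$ is the one-block partition. Let $\bar\Pi^{\rm even}_{2n}=\Pi^{\rm even}_{2n}\setminus\{\hat 1\}$ be its proper part, and let $\Pi^{\rm even}_{2n}\cup\{\hat 0\}$ be obtained by adjoining a new bottom element. Associate with each partition the word obtained by listing the elements of each block in increasing order and then listing the blocks in lexicographic order. Let $E_m$ be the Euler number, i.e. the number of permutations $\sigma\in\mathfrak S_m$ with $\sigma(1)<\sigma(2)>\sigma(3)<\cdots$. A recursive atom ordering of a bounded poset $P$ of length at least $1$ is an ordering $a_1,\dots,a_t$ of its atoms such that, if the length of $P$ is greater than $1$: (i) for each $j$ the interval $[a_j,\hat 1]$ admits a recursive atom ordering in which the atoms of $[a_j,\hat 1]$ lying above some $a_i$ with $i<j$ come first; (ii) whenever $i<j$ and $a_i,a_j<y$, there are $k<j$ and an atom $z$ of $[a_j,\hat 1]$ with $a_k<z\le y$. Then for every $n\ge 1$: 1. The lexicographic order of the associated words is a recursive atom ordering of $\Pi^{\rm even}_{2n}\cup\{\hat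 0\}$. 2. The order complex of $\bar\Pi^{\rm even}_{2n}$ is pure of dimension $n-2$ and shellable, i.e. its facets can be ordered $F_1,\dots,F_t$ so that for $2\le k\le t$ the complex $\left(\bigcup_{i<k}\langle F_i\rangle\right)\cap\langle F_k\rangle$ is pure of dimension $\dim F_k-1$. 3. The order complex of $\bar\Pi^{\rm even}_{2n}$ has the homotopy type of a wedge of $E_{2n-1}$ spheres of dimension $n-2$ (for $n=1$ it is the empty space, viewed as the sphere $S^{-1}$). 4. Over every integral domain $\mathbf k$ (e.g. $\mathbb Z$ or a field), the reduced Betti numbers, that is, the ranks of the reduced homology of the order complex with coefficients in $\mathbf k$, are $\tilde\beta_{n-2}(\bar\Pi^{\rm even}_{2n})=E_{2n-1}$ and $\tilde\beta_i(\bar\Pi^{\rm even}_{2n})=0$ for $i\ne n-2$. Moreover, with $\beta_{2n}=\tilde\beta_{n-2}(\bar\Pi^{\rm even}_{2n})$, one has the identities of formal power series over $\mathbb Q$ $$\sum_{n\ge1}\beta_{2n}\frac{u^{2n}}{(2n)!}=-\ln(\cos u),\qquad \sum_{n\ge1}\beta_{2n}\frac{u^{2n-1}}{(2n-1)!}=\tan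 u .$$ -/

import Mathlib

open scoped Nat ContinuousMap

noncomputable section

/-! ### The even block size partition poset -/

/-- `EvenPartition n` is the poset of set partitions of a `2n`-element set all of whose blocks have
even size, ordered by refinement (`π ≤ ρ` when every block of `π` lies in a block of `ρ`). -/
abbrev EvenPartition (n : ℕ) : Type :=
  {π : Finpartition (Finset.univ : Finset (Fin (2 * n))) // ∀ B ∈ π.parts, Even B.card}

/-- The top element is the partition with a single block. -/
instance EvenPartition.instOrderTop (n : ℕ) : OrderTop (EvenPartition n) where
  top := ⟨⊤, fun B hB => by
    have h := Finpartition.parts_top_subset (Finset.univ : Finset (Fin (2 * n))) hB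
    rw [Finset.mem_singleton] at h
    subst h
    simp⟩
  le_top π := by
    show π.1 ≤ ⊤
    exact le_top

/-- The proper part of the even block size partition poset: the poset with its top element removed. -/
abbrev EvenPartitionProper (n : ℕ) : Type :=
  {π : EvenPartition n // π ≠ ⊤}

/-- The word of a partition: the elements of each block are listed in increasing order, and the
blocks are then listed in lexicographic order. -/
def EvenPartition.word {n : ℕ} (π : EvenPartition n) : List (Fin (2 * n)) :=
  ((π.1.parts.image fun B => B.sort (· ≤ ·)).sort (· ≤ ·)).flatten

/-! ### Recursive atom orderings -/

/-- `IsRecursiveAtomOrdering x l` says that the list `l` is a recursive atom ordering of the bounded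
poset `[x, ⊤]`; its atoms are the elements covering `x`.  Either `[x, ⊤]` has length one, or its
length is greater than one, `l` lists the atoms without repetition, and conditions (i), (ii) hold:

(i) for every atom `aⱼ` the list `L j` is a recursive atom ordering of `[aⱼ, ⊤]` in which the atoms
  that lie above some earlier `aᵢ` come first;

(ii) if `i < j` and `aᵢ, aⱼ < y`, then there are `k < j` and an atom `z` of `[aⱼ, ⊤]` with
  `aₖ < z ≤ y`. -/
inductive IsRecursiveAtomOrdering {P : Type*} [PartialOrder P] [OrderTop P] : P → List P → Prop
  | length_one (x : P) (hx : x ⋖ ⊤) : IsRecursiveAtomOrdering x [⊤]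
  | step (x : P) (l : List P) (hx : x < ⊤) (hx' : ¬ x ⋖ ⊤)
      (nodup : l.Nodup) (mem_iff : ∀ a, a ∈ l ↔ x ⋖ a)
      (L : Fin l.length → List P)
      (rec_ordering : ∀ j, IsRecursiveAtomOrdering (l.get j) (L j))
      (come_first : ∀ j, (L j).Pairwise fun z w =>
        (∃ i < j, l.get i ≤ w) → ∃ i < j, l.get i ≤ z)
      (exchange : ∀ i j, i < j → ∀ y, l.get i < y → l.get j < y →
        ∃ k < j, ∃ z, l.get j ⋖ z ∧ l.get k < z ∧ z ≤ y) :
      IsRecursiveAtomOrdering x l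

/-! ### Simplicial complexes -/

/-- The order complex of a poset: its faces are the nonempty finite chains. -/
def orderComplex (P : Type*) [PartialOrder P] : AbstractSimplicialComplex P where
  faces := {s | s.Nonempty ∧ IsChain (· ≤ ·) (s : Set P)}
  isRelLowerSet_faces := fun {_} hs =>
    ⟨hs.1, fun _ ht hne => ⟨hne, hs.2.mono (Finset.coe_subset.2 ht)⟩⟩
  singleton_mem v := ⟨Finset.singleton_nonempty v, by simp⟩

namespace AbstractSimplicialComplex

/-- The facets are the maximal faces. -/
def IsFacet {V : Type*} (K : AbstractSimplicialComplex V) (F : Finset V) : Prop :=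
  Maximal (· ∈ K) F

/-- The complex is pure of dimension `d`: every facet has `d + 1` vertices. -/
def IsPureOfDim {V : Type*} (K : AbstractSimplicialComplex V) (d : ℤ) : Prop :=
  ∀ F, K.IsFacet F → (F.card : ℤ) = d + 1

/-- A shelling is an ordering `F₁, …, Fₜ` of the facets such that for `k ≥ 2` the complex
`(⟨F₁⟩ ∪ ⋯ ∪ ⟨Fₖ₋₁⟩) ∩ ⟨Fₖ⟩` is pure of dimension `dim Fₖ - 1`.  Here the intersection is taken with
its empty face, so that two facets may meet in the complex `{∅}` of dimension `-1`. -/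
def IsShelling {V : Type*} (K : AbstractSimplicialComplex V) (l : List (Finset V)) : Prop :=
  l.Nodup ∧ (∀ F, F ∈ l ↔ K.IsFacet F) ∧
    ∀ k : Fin l.length, 0 < k.val →
      ∀ G, Maximal (fun G : Finset V => G ⊆ l.get k ∧ ∃ i < k, G ⊆ l.get i) G →
        G.card + 1 = (l.get k).card

/-- A (finite) simplicial complex is shellable if it has a shelling. -/
def Shellable {V : Type*} (K : AbstractSimplicialComplex V) : Prop :=
  ∃ l, K.IsShelling l

/-- The geometric realization of a simplicial complex on a finite vertex set `V`: the points of
`ℝ^V` with nonnegative coordinates of sum `1` that are supported on a face. -/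
def realization {V : Type*} [Finite V] (K : AbstractSimplicialComplex V) : Set (V → ℝ) :=
  {w | (∀ v, 0 ≤ w v) ∧ ∃ s ∈ K, (∀ v ∉ s, w v = 0) ∧ ∑ v ∈ s, w v = 1}

end AbstractSimplicialComplex

/-! ### Reduced homology of a poset -/

/-- The chains `x₀ < ⋯ < x_{m-1}` with `m` elements of `P`, i.e. the `(m-1)`-dimensional faces of the
order complex (for `m = 0` the empty chain), generate the module of `(m-1)`-chains. -/
abbrev OrderChain (k : Type*) [CommRing k] (P : Type*) [PartialOrder P] (m : ℕ) : Type _ :=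
  (Fin m ↪o P) →₀ k

/-- The boundary `∂(x₀ < ⋯ < xₘ) = ∑ᵢ (-1)ⁱ (x₀ < ⋯ < x̂ᵢ < ⋯ < xₘ)`. -/
def orderBoundary (k : Type*) [CommRing k] (P : Type*) [PartialOrder P] (m : ℕ) :
    OrderChain k P (m + 1) →ₗ[k] OrderChain k P m :=
  Finsupp.linearCombination k fun c : Fin (m + 1) ↪o P =>
    ∑ i : Fin (m + 1), Finsupp.single ((Fin.succAboveOrderEmb i).trans c) ((-1 : k) ^ i.val)

/-- The cycles of dimension `m - 1`. -/
def orderCycles (k : Type*) [CommRing k] (P : Type*) [PartialOrder P] :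
    (m : ℕ) → Submodule k (OrderChain k P m)
  | 0 => ⊤
  | m + 1 => LinearMap.ker (orderBoundary k P m)

/-- The quotient `Z / (B ∩ Z)` of two submodules of a module; for `B ≤ Z` this is `Z / B`. -/
abbrev Subquotient {k M : Type*} [CommRing k] [AddCommGroup M] [Module k M]
    (Z B : Submodule k M) : Type _ :=
  Z ⧸ B.submoduleOf Z

/-- The rank of `Z / B`. -/
def subquotientRank {k M : Type*} [CommRing k] [AddCommGroup M] [Module k M]
    (Z B : Submodule k M) : ℕ :=
  Module.finrank k (Subquotient Z B)

/-- The reduced Betti number of (the order complex of) `P` in dimension `i`: the rank of the reduced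
homology, i.e. of the cycles modulo the boundaries.  It is zero for `i < -1`. -/
def reducedBetti (k : Type*) [CommRing k] (P : Type*) [PartialOrder P] (i : ℤ) : ℕ :=
  if i < -1 then 0
  else subquotientRank (orderCycles k P (i + 1).toNat)
    (LinearMap.range (orderBoundary k P (i + 1).toNat))

/-! ### Wedges of spheres -/

/-- The first unit vector of `ℝ^m`, used as base point of the unit sphere `S^{m-1}` if `m ≥ 1`. -/
def sphereBase (m : ℕ) : EuclideanSpace ℝ (Fin m) :=
  WithLp.toLp 2 fun i => if i.val = 0 then 1 else 0

/-- Identify the base points of the `r` copies of `S^{m-1}`. -/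
def wedgeSetoid (r m : ℕ) :
    Setoid (Fin r × Metric.sphere (0 : EuclideanSpace ℝ (Fin m)) 1) where
  r x y := x = y ∨ (x.2.1 = sphereBase m ∧ y.2.1 = sphereBase m)
  iseqv :=
    { refl := fun _ => Or.inl rfl
      symm := by
        rintro x y (h | h)
        · exact Or.inl h.symm
        · exact Or.inr ⟨h.2, h.1⟩
      trans := by
        rintro x y z (rfl | h) (rfl | h')
        · exact Or.inl rfl
        · exact Or.inr h'
        · exact Or.inr h
        · exact Or.inr ⟨h.1, h'.2⟩ }

/-- The wedge of `r ≥ 1` copies of the unit sphere `S^{m-1}` of `ℝ^m`, with the quotient topology.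
For `m = 0` the sphere `S^{-1}` is empty, and so is the wedge. -/
abbrev SphereWedge (r m : ℕ) : Type := Quotient (wedgeSetoid r m)

/-! ### Euler numbers -/

/-- A permutation `σ(1) … σ(m)` is alternating if it has ascents at all odd and descents at all even
positions: `σ(1) < σ(2) > σ(3) < ⋯`.  In the code the positions are counted from zero. -/
def IsAlternating {m : ℕ} (σ : Equiv.Perm (Fin m)) : Prop :=
  ∀ (i : ℕ) (h : i + 1 < m),
    (Even i → σ ⟨i, by omega⟩ < σ ⟨i + 1, h⟩) ∧ (Odd i → σ ⟨i + 1, h⟩ < σ ⟨i, by omega⟩)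

/-- The Euler number `E_m`: the number of alternating permutations of `m` letters. -/
def eulerNumber (m : ℕ) : ℕ := Nat.card {σ : Equiv.Perm (Fin m) // IsAlternating σ}

/-- The Betti number `β_{2n}` in dimension `n - 2` of the proper part of the even block size
partition poset. -/
def evenBetti (k : Type*) [CommRing k] (n : ℕ) : ℕ :=
  reducedBetti k (EvenPartitionProper n) ((n : ℤ) - 2)

end

/-!
Above an even partition the poset is a partition lattice, hence semimodular, so that only the
atoms of the whole poset, the partitions into pairs, need care. If two of them lie below `y` and the
second has the larger word, exchanging partners in the second at the first place where the words
differ yields an atom with a smaller word. The join of the two is still below `y`, and it covers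
the second.

A recursive atom ordering ranks the maximal chains by the positions of their elements in the
successive atom orderings, and increasing rank is a shelling. When a facet `F` is attached in a
shelling, its new faces are those containing a certain face `R`, its restriction. If `R ≠ F`, then
`F` is pushed onto its old part away from a vertex outside `R`, which changes neither homotopy type
nor homology. If `R = F`, then only the interior of `F` is new. Hence the complex is contractible up
to the facets of the second kind. As every one of them contributes a sphere, the reduced Euler
characteristic is their number, up to sign.

By Möbius inversion the Euler characteristic equals `(-1)ⁿ⁻¹ E₂ₙ₋₁` as soon as, for every `ρ`, the
products over the blocks of `(-1)ʲ⁻¹ E₂ⱼ₋₁`, `2j` the block size, sum up to `1` over the `π ≤ ρ`.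
Splitting off the block of a fixed element reduces this to the identity
`∑ⱼ (-1)ʲ (2n+1).choose (2j+1) E₂ⱼ₊₁ = 1`, which is also the one behind `tan u`.
-/

/-! ### Euler numbers -/

section EulerNumber

variable {m p q : ℕ}

theorem strictAnti_fin_iff {α : Type*} [Preorder α] (f : Fin m → α) :
    StrictAnti f ↔ ∀ (i : ℕ) (h : i + 1 < m), f ⟨i + 1, h⟩ < f ⟨i, by omega⟩ := by
  refine ⟨fun hf i h => hf (Fin.mk_lt_mk.2 i.lt_succ_self), fun hf => ?_⟩
  cases m with
  | zero => exact fun i => i.elim0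
  | succ m => exact Fin.strictAnti_iff_succ_lt.2 fun i => hf i (by omega)

theorem perm_lt_or_succ_lt (σ : Equiv.Perm (Fin m)) (i : ℕ) (h : i + 1 < m) :
    σ ⟨i, by omega⟩ < σ ⟨i + 1, h⟩ ∨ σ ⟨i + 1, h⟩ < σ ⟨i, by omega⟩ :=
  lt_or_gt_of_ne (σ.injective.ne (by simp))

theorem strictAnti_perm_iff (σ : Equiv.Perm (Fin m)) : StrictAnti σ ↔ σ = Fin.revPerm := by
  refine ⟨fun hσ => ?_, by rintro rfl; exact Fin.rev_strictAnti⟩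
  have hid : (fun i => σ (Fin.rev i)) = id :=
    StrictMono.range_inj (hσ.comp Fin.rev_strictAnti) strictMono_id |>.1 <| by
      rw [Set.range_id]
      exact (σ.surjective.comp Fin.rev_surjective).range_eq
  ext1 i
  simpa using congrFun hid (Fin.rev i)

theorem isAlternating_iff (σ : Equiv.Perm (Fin m)) :
    IsAlternating σ ↔ ∀ (i : ℕ) (h : i + 1 < m),
      (Even i ↔ σ ⟨i, by omega⟩ < σ ⟨i + 1, h⟩) := by
  refine forall₂_congr fun i h => ?_
  have hdesc : σ ⟨i + 1, h⟩ < σ ⟨i, by omega⟩ ↔ ¬ σ ⟨i, by omega⟩ < σ ⟨i + 1, h⟩ :=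
    ⟨fun hgt => hgt.asymm, (perm_lt_or_succ_lt σ i h).resolve_left⟩
  rw [hdesc, ← Nat.not_even_iff_odd]
  tauto

theorem exists_isAlternating (m : ℕ) : ∃ σ : Equiv.Perm (Fin m), IsAlternating σ := by
  let zigzag : Fin m → Fin m := fun i =>
    if h : Even i.val then ⟨i / 2, by omega⟩ else ⟨(m + 1) / 2 + i / 2, by
      rw [Nat.even_iff] at h
      omega⟩
  have zigzag_injective : Function.Injective zigzag := by
    intro i j h
    simp only [zigzag] at h
    split_ifs at h <;> simp only [Fin.mk.injEq] at h <;> ext <;> grind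
  refine ⟨Equiv.ofBijective zigzag (Finite.injective_iff_bijective.1 zigzag_injective),
    fun i h => ⟨fun hi => ?_, fun hi => ?_⟩⟩
  · have hi' : ¬ Even (i + 1) := by simpa [parity_simps] using hi
    simp only [Equiv.ofBijective_apply, zigzag, hi, hi', dif_pos, dif_neg, not_false_iff,
      Fin.mk_lt_mk]
    omega
  · have hi' : ¬ Even i := by simpa [parity_simps] using hi
    simp only [Equiv.ofBijective_apply, zigzag, hi.add_one, hi', dif_pos, dif_neg, not_false_iff,
      Fin.mk_lt_mk]
    omega

theorem eulerNumber_pos (m : ℕ) : 0 < eulerNumber m :=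
  have : Nonempty {σ : Equiv.Perm (Fin m) // IsAlternating σ} :=
    nonempty_subtype.2 (exists_isAlternating m)
  Nat.card_pos

/-- The permutation alternates on the first `p` positions and has descents at all steps from
position `c` on.  For `c = p` the step between the two parts is unconstrained. -/
def IsAlternatingThenAnti (p c : ℕ) (σ : Equiv.Perm (Fin m)) : Prop :=
  ∀ (i : ℕ) (h : i + 1 < m),
    (i + 1 < p → (Even i ↔ σ ⟨i, by omega⟩ < σ ⟨i + 1, h⟩)) ∧
      (c ≤ i → σ ⟨i + 1, h⟩ < σ ⟨i, by omega⟩)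

/-- The number of permutations of `m` letters which alternate on the first `p` positions and
descend from position `c` on; these numbers interpolate between `1` and the Euler number. -/
noncomputable def altAntiNumber (m p c : ℕ) : ℕ :=
  Nat.card {σ : Equiv.Perm (Fin m) // IsAlternatingThenAnti p c σ}

theorem altAntiNumber_self (m : ℕ) : altAntiNumber m m (m - 1) = eulerNumber m := by
  refine Nat.card_congr (Equiv.subtypeEquivRight fun σ => ?_)
  rw [isAlternating_iff]
  exact forall₂_congr fun i h => ⟨fun hσ => hσ.1 h, fun hσ => ⟨fun _ => hσ, fun _ => by omega⟩⟩

theorem altAntiNumber_one_zero (m : ℕ) : altAntiNumber m 1 0 = 1 := by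
  have hanti (σ : Equiv.Perm (Fin m)) : IsAlternatingThenAnti 1 0 σ ↔ σ = Fin.revPerm := by
    rw [← strictAnti_perm_iff, strictAnti_fin_iff]
    exact forall₂_congr fun i h => ⟨fun hσ => hσ.2 i.zero_le, fun hσ => ⟨by omega, fun _ => hσ⟩⟩
  simp [altAntiNumber, hanti]

theorem isAlternatingThenAnti_self_iff {r : ℕ} (hr : 2 * r + 3 ≤ m) (σ : Equiv.Perm (Fin m)) :
    IsAlternatingThenAnti (2 * r + 1) (2 * r + 1) σ ↔
      IsAlternatingThenAnti (2 * r + 1) (2 * r) σ ∨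
        IsAlternatingThenAnti (2 * r + 3) (2 * r + 2) σ := by
  constructor
  · intro hσ
    rcases perm_lt_or_succ_lt σ (2 * r) (by omega) with hlt | hgt
    · refine Or.inr fun i h => ⟨fun hi => ?_, fun hi => (hσ i h).2 (by omega)⟩
      obtain hi' | rfl | rfl : i < 2 * r ∨ i = 2 * r ∨ i = 2 * r + 1 := by omega
      · exact (hσ i h).1 (by omega)
      · simpa using hlt
      · simpa using ((hσ (2 * r + 1) h).2 le_rfl).le
    · refine Or.inl fun i h => ⟨(hσ i h).1, fun hi => ?_⟩
      obtain rfl | hi' := hi.eq_or_lt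
      · exact hgt
      · exact (hσ i h).2 hi'
  · rintro (hσ | hσ) i h
    · exact ⟨(hσ i h).1, fun hi => (hσ i h).2 (by omega)⟩
    · refine ⟨fun hi => (hσ i h).1 (by omega), fun hi => ?_⟩
      obtain rfl | hi' := hi.eq_or_lt
      · refine (perm_lt_or_succ_lt σ _ h).resolve_left fun hlt => ?_
        simpa using ((hσ _ h).1 (by omega)).2 hlt
      · exact (hσ i h).2 hi'

theorem altAntiNumber_eq_add {r : ℕ} (hr : 2 * r + 3 ≤ m) :
    altAntiNumber m (2 * r + 1) (2 * r + 1) =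
      altAntiNumber m (2 * r + 1) (2 * r) + altAntiNumber m (2 * r + 3) (2 * r + 2) := by
  classical
  have hdisj : Disjoint (IsAlternatingThenAnti (m := m) (2 * r + 1) (2 * r))
      (IsAlternatingThenAnti (2 * r + 3) (2 * r + 2)) := by
    refine Pi.disjoint_iff.2 fun σ => Prop.disjoint_iff.2 ?_
    rintro ⟨hdesc, hasc⟩
    exact ((hdesc (2 * r) (by omega)).2 le_rfl).asymm
      (((hasc (2 * r) (by omega)).1 (by omega)).1 (by simp))
  simp only [altAntiNumber, isAlternatingThenAnti_self_iff hr]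
  simp only [Nat.card_eq_fintype_card]
  exact Fintype.card_subtype_or_disjoint _ _ hdisj

/-- The permutation of `p + q` letters whose first `p` values form the set `S` in the relative order
`τ`, and whose last `q` values form the complement of `S` in the relative order `ρ`. -/
def shuffle (S : {S : Finset (Fin (p + q)) // S.card = p}) (τ : Equiv.Perm (Fin p))
    (ρ : Equiv.Perm (Fin q)) : Equiv.Perm (Fin (p + q)) :=
  finSumFinEquiv.symm.trans <| (Equiv.sumCongr τ ρ).trans <|
    finSumEquivOfFinset S.2 (by rw [Finset.card_compl, S.2, Fintype.card_fin]; omega)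

section Shuffle

variable (S : {S : Finset (Fin (p + q)) // S.card = p}) (τ : Equiv.Perm (Fin p))
  (ρ : Equiv.Perm (Fin q))

theorem shuffle_castAdd (i : Fin p) :
    shuffle S τ ρ (Fin.castAdd q i) = S.1.orderEmbOfFin S.2 (τ i) := by
  simp [shuffle]

theorem shuffle_natAdd_lt_iff (i j : Fin q) :
    shuffle S τ ρ (Fin.natAdd p i) < shuffle S τ ρ (Fin.natAdd p j) ↔ ρ i < ρ j := by
  simp [shuffle]

theorem image_shuffle_castAdd :
    Finset.univ.image (fun i => shuffle S τ ρ (Fin.castAdd q i)) = S.1 := by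
  ext x
  constructor
  · simp only [Finset.mem_image, Finset.mem_univ, true_and, shuffle_castAdd]
    rintro ⟨i, rfl⟩
    exact Finset.orderEmbOfFin_mem _ _ _
  · intro hx
    obtain ⟨i, hi⟩ : x ∈ Set.range (S.1.orderEmbOfFin S.2) := by simpa using hx
    exact Finset.mem_image.2 ⟨τ.symm i, Finset.mem_univ _, by simp [shuffle_castAdd, hi]⟩

theorem shuffle_bijective : Function.Bijective
    fun x : {S : Finset (Fin (p + q)) // S.card = p} × Equiv.Perm (Fin p) × Equiv.Perm (Fin q) =>
      shuffle x.1 x.2.1 x.2.2 := by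
  refine (Fintype.bijective_iff_injective_and_card _).2 ⟨?_, ?_⟩
  · rintro ⟨S, τ, ρ⟩ ⟨S', τ', ρ'⟩ (h : shuffle S τ ρ = shuffle S' τ' ρ')
    obtain rfl : S = S' := Subtype.ext <| by
      rw [← image_shuffle_castAdd S τ ρ, h, image_shuffle_castAdd]
    have hsum : Equiv.sumCongr τ ρ = Equiv.sumCongr τ' ρ' := by
      ext1 x
      simpa [shuffle] using DFunLike.congr_fun h (finSumFinEquiv x)
    have hpair := Equiv.Perm.sumCongrHom_injective (a₁ := (τ, ρ)) (a₂ := (τ', ρ')) hsum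
    simp_all
  · simp [Fintype.card_perm, ← mul_assoc, ← Nat.choose_mul_factorial_mul_factorial
      (Nat.le_add_right p q)]

theorem isAlternatingThenAnti_shuffle_iff :
    IsAlternatingThenAnti p p (shuffle S τ ρ) ↔ IsAlternating τ ∧ ρ = Fin.revPerm := by
  have hleft (i : ℕ) (h : i + 1 < p) :
      shuffle S τ ρ ⟨i, by omega⟩ < shuffle S τ ρ ⟨i + 1, by omega⟩ ↔
        τ ⟨i, by omega⟩ < τ ⟨i + 1, h⟩ := by
    have := shuffle_castAdd S τ ρ ⟨i, by omega⟩
    have := shuffle_castAdd S τ ρ ⟨i + 1, h⟩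
    simp_all
  rw [isAlternating_iff, ← strictAnti_perm_iff, strictAnti_fin_iff]
  constructor
  · refine fun hσ => ⟨fun i h => ((hσ i (by omega)).1 h).trans (hleft i h), fun i h => ?_⟩
    exact (shuffle_natAdd_lt_iff S τ ρ ⟨i + 1, h⟩ ⟨i, by omega⟩).1
      ((hσ (p + i) (by omega)).2 (by omega))
  · refine fun ⟨hτ, hρ⟩ i h => ⟨fun hi => (hτ i hi).trans (hleft i hi).symm, fun hi => ?_⟩
    obtain ⟨j, rfl⟩ := Nat.exists_eq_add_of_le hi
    exact (shuffle_natAdd_lt_iff S τ ρ ⟨j + 1, by omega⟩ ⟨j, by omega⟩).2 (hρ j (by omega))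

end Shuffle

theorem altAntiNumber_add_self (p q : ℕ) :
    altAntiNumber (p + q) p p = (p + q).choose p * eulerNumber p := by
  let e : {S : Finset (Fin (p + q)) // S.card = p} × {τ : Equiv.Perm (Fin p) // IsAlternating τ} ≃
      {x : {S : Finset (Fin (p + q)) // S.card = p} × Equiv.Perm (Fin p) × Equiv.Perm (Fin q) //
        IsAlternating x.2.1 ∧ x.2.2 = Fin.revPerm} :=
    { toFun x := ⟨(x.1, x.2.1, Fin.revPerm), x.2.2, rfl⟩
      invFun x := (x.1.1, ⟨x.1.2.1, x.2.1⟩)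
      left_inv _ := rfl
      right_inv x := Subtype.ext (Prod.ext rfl (Prod.ext rfl x.2.2.symm)) }
  have hcard := Nat.card_congr <| e.trans <|
    (Equiv.ofBijective _ shuffle_bijective).subtypeEquiv (q := IsAlternatingThenAnti p p)
      fun x => (isAlternatingThenAnti_shuffle_iff x.1 x.2.1 x.2.2).symm
  rw [altAntiNumber, ← hcard, Nat.card_prod, Nat.card_eq_fintype_card, Fintype.card_finset_len,
    Fintype.card_fin, eulerNumber]

/-- Decreasing the last `m - p` values of a permutation leaves the step after position `p` free, so
the numbers `m.choose p * eulerNumber p` for odd `p` telescope. -/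
theorem sum_choose_mul_eulerNumber (n : ℕ) :
    ∑ j ∈ Finset.range (n + 1),
      (-1 : ℤ) ^ j * ((2 * n + 1).choose (2 * j + 1) * eulerNumber (2 * j + 1) : ℕ) = 1 := by
  have partial_sum : ∀ r ≤ n, ∑ j ∈ Finset.range r,
      (-1 : ℤ) ^ j * ((2 * n + 1).choose (2 * j + 1) * eulerNumber (2 * j + 1) : ℕ) =
        1 - (-1 : ℤ) ^ r * altAntiNumber (2 * n + 1) (2 * r + 1) (2 * r) := by
    intro r
    induction r with
    | zero => simp [altAntiNumber_one_zero]
    | succ r ih =>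
      intro hr
      have hadd := altAntiNumber_add_self (2 * r + 1) (2 * n + 1 - (2 * r + 1))
      rw [show 2 * r + 1 + (2 * n + 1 - (2 * r + 1)) = 2 * n + 1 by omega] at hadd
      rw [Finset.sum_range_succ, ih (by omega), ← hadd, altAntiNumber_eq_add (by omega)]
      push_cast
      ring_nf
  have hself := altAntiNumber_self (2 * n + 1)
  rw [Nat.add_sub_cancel] at hself
  rw [Finset.sum_range_succ, partial_sum n le_rfl, hself]
  simp

end EulerNumber

section GeneratingFunction

open PowerSeries

theorem sum_range_two_mul {M : Type*} [AddCommMonoid M] (f : ℕ → M) (N : ℕ) :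
    ∑ i ∈ Finset.range (2 * N), f i = ∑ a ∈ Finset.range N, (f (2 * a) + f (2 * a + 1)) := by
  induction N with
  | zero => simp
  | succ N ih =>
    rw [Nat.mul_succ, Finset.sum_range_succ, Finset.sum_range_succ, ih, Finset.sum_range_succ,
      add_assoc]

theorem sum_eulerNumber_div_factorial (n : ℕ) :
    ∑ j ∈ Finset.range (n + 1), (eulerNumber (2 * j + 1) : ℚ) / (2 * j + 1)! *
      ((-1) ^ (n - j) / (2 * (n - j))!) = (-1) ^ n / (2 * n + 1)! := by
  have hsum := congrArg (Int.cast (R := ℚ)) (sum_choose_mul_eulerNumber n)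
  push_cast at hsum
  rw [eq_div_iff (by positivity), ← mul_one (_ ^ n), ← congrArg ((-1 : ℚ) ^ n * ·) hsum,
    Finset.sum_mul, Finset.mul_sum]
  refine Finset.sum_congr rfl fun j hj => ?_
  have hjn := Finset.mem_range_succ_iff.1 hj
  have hsign : (-1 : ℚ) ^ n * (-1) ^ j = (-1) ^ (n - j) := by
    rw [← pow_add, show n + j = n - j + 2 * j by omega, pow_add, pow_mul _ 2]
    simp
  rw [Nat.cast_choose ℚ (show 2 * j + 1 ≤ 2 * n + 1 by omega),
    show 2 * n + 1 - (2 * j + 1) = 2 * (n - j) by omega, ← mul_assoc, hsign]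
  field_simp

theorem mk_eulerNumber_mul_cos :
    (mk fun m => if Odd m then (eulerNumber m : ℚ) / (m ! : ℚ) else 0) * cos ℚ = sin ℚ := by
  ext m
  rw [coeff_mul, Finset.Nat.sum_antidiagonal_eq_sum_range_succ_mk]
  simp only [cos, sin, coeff_mk, eq_ratCast, Rat.cast_id]
  obtain ⟨n, rfl | rfl⟩ := m.even_or_odd'
  · rw [if_pos (by simp)]
    refine Finset.sum_eq_zero fun i hi => ?_
    rcases i.even_or_odd with hi' | hi'
    · simp [Nat.not_odd_iff_even.2 hi']
    · have : ¬ Even (2 * n - i) := Nat.not_even_iff_odd.2 <|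
        Nat.Even.sub_odd (Finset.mem_range_succ_iff.1 hi) (even_two_mul n) hi'
      simp [this]
  · rw [Nat.succ_eq_add_one, show 2 * n + 1 + 1 = 2 * (n + 1) by omega, sum_range_two_mul,
      if_neg (by simp), show (2 * n + 1) / 2 = n by omega, ← sum_eulerNumber_div_factorial]
    refine Finset.sum_congr rfl fun j _ => ?_
    simp [show 2 * n + 1 - (2 * j + 1) = 2 * (n - j) by omega]

variable {A : Type*} [CommRing A] [Algebra ℚ A]

theorem constantCoeff_cos : constantCoeff (cos A) = 1 := by
  simp [← coeff_zero_eq_constantCoeff_apply, cos]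

theorem derivative_cos : derivative A (cos A) = -sin A := by
  ext m
  simp only [coeff_derivative, cos, sin, coeff_mk, map_neg]
  obtain ⟨n, rfl | rfl⟩ := m.even_or_odd'
  · simp
  · rw [if_pos (by simp [parity_simps]), if_neg (by simp),
      show (2 * n + 1 + 1) / 2 = n + 1 by omega, show (2 * n + 1) / 2 = n by omega,
      Nat.factorial_succ (2 * n + 1), ← map_natCast (algebraMap ℚ A), ← map_one (algebraMap ℚ A),
      ← map_add, ← map_mul, ← map_neg]
    congr 1
    push_cast
    field_simp
    ring

theorem derivative_logOf_mul {f : A⟦X⟧} (hf : constantCoeff f = 1) :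
    derivative A (logOf f) * f = derivative A f := by
  have hs : HasSubst (f - 1) := HasSubst.of_constantCoeff_zero' (by simp [hf])
  have hlog : derivative A (log A) * (1 + X) = 1 := by
    rw [deriv_log]
    ext n
    cases n with
    | zero => simp
    | succ n => simp [mul_add, coeff_succ_mul_X, pow_succ, coeff_one]
  have hsubst := congrArg (subst (f - 1)) hlog
  rw [subst_mul hs, subst_add hs, subst_X hs, ← coe_substAlgHom (R := A) hs, map_one,
    add_sub_cancel] at hsubst
  rw [logOf_eq, derivative_subst hs, ← coe_substAlgHom (R := A) hs, map_sub,
    Derivation.map_one_eq_zero, sub_zero]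
  linear_combination derivative A f * hsubst

theorem mk_eulerNumber_pred :
    (mk fun m => if Even m ∧ m ≠ 0 then (eulerNumber (m - 1) : ℚ) / (m ! : ℚ) else 0) =
      -logOf (cos ℚ) := by
  apply derivative.ext
  · have hcos : cos ℚ ≠ 0 := fun h => by simpa [h] using constantCoeff_cos (A := ℚ)
    refine mul_right_cancel₀ hcos ?_
    rw [map_neg, neg_mul, derivative_logOf_mul constantCoeff_cos, derivative_cos, neg_neg,
      ← mk_eulerNumber_mul_cos]
    congr 1
    ext m
    simp only [coeff_derivative, coeff_mk, show Even (m + 1) ∧ m + 1 ≠ 0 ↔ Odd m by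
      simp [parity_simps]]
    split_ifs
    · rw [Nat.factorial_succ, Nat.add_sub_cancel]
      push_cast
      field_simp
    · simp
  · rw [map_neg, constantCoeff_logOf constantCoeff_cos, ← coeff_zero_eq_constantCoeff_apply]
    simp

end GeneratingFunction

/-! ### Recursive atom orderings of semimodular posets -/

theorem eq_singleton_of_nodup {α : Type*} {l : List α} {a : α} (hl : l.Nodup) (ha : a ∈ l)
    (h : ∀ b ∈ l, b = a) : l = [a] := by
  refine List.perm_singleton.1 ((List.perm_ext_iff_of_nodup hl (List.nodup_singleton a)).2 ?_)
  intro b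
  rw [List.mem_singleton]
  exact ⟨h b, fun e => e ▸ ha⟩

theorem exists_list_pairwise_early {α : Type*} {s : Set α} (hs : s.Finite) (early : α → Prop) :
    ∃ l : List α, l.Nodup ∧ (∀ a, a ∈ l ↔ a ∈ s) ∧ l.Pairwise fun a b => early b → early a := by
  classical
  let l := hs.toFinset.toList
  have hl : l.Nodup := Finset.nodup_toList _
  have hmem : ∀ a, a ∈ l ↔ a ∈ s := fun a => by simp [l]
  refine ⟨l.filter (early ·) ++ l.filter (¬ early ·), ?_, fun a => ?_, ?_⟩
  · exact (hl.filter _).append (hl.filter _) fun a ha ha' => by simp_all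
  · simp only [List.mem_append, List.mem_filter, decide_eq_true_eq, hmem]
    tauto
  · rw [List.pairwise_append]
    refine ⟨List.pairwise_of_forall_mem_list fun a ha _ _ _ => ?_,
      List.pairwise_of_forall_mem_list fun _ _ b hb hb' => ?_, fun a ha _ _ _ => ?_⟩
    · exact of_decide_eq_true (List.mem_filter.1 ha).2
    · exact absurd hb' (of_decide_eq_true (List.mem_filter.1 hb).2)
    · exact of_decide_eq_true (List.mem_filter.1 ha).2

namespace IsRecursiveAtomOrdering

variable {P : Type*} [PartialOrder P] [OrderTop P] [Finite P]

theorem of_forall {x : P} {l : List P} (hx : x < ⊤) (nodup : l.Nodup)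
    (mem_iff : ∀ a, a ∈ l ↔ x ⋖ a)
    (hrec : ∀ a ∈ l, a < ⊤ → ∀ L : List P, L.Nodup → (∀ b, b ∈ L ↔ a ⋖ b) →
      IsRecursiveAtomOrdering a L)
    (exchange : ∀ i j : Fin l.length, i < j → ∀ y, l.get i < y → l.get j < y →
      ∃ k < j, ∃ z, l.get j ⋖ z ∧ l.get k < z ∧ z ≤ y) :
    IsRecursiveAtomOrdering x l := by
  by_cases hx' : x ⋖ ⊤
  · have htop : ∀ a ∈ l, a = ⊤ := fun a ha =>
      le_top.eq_or_lt.resolve_right (hx'.2 ((mem_iff a).1 ha).lt)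
    rw [eq_singleton_of_nodup nodup ((mem_iff ⊤).2 hx') htop]
    exact .length_one x hx'
  choose L hL hmem hearly using fun j : Fin l.length =>
    exists_list_pairwise_early (Set.toFinite {b | l.get j ⋖ b}) fun w => ∃ i < j, l.get i ≤ w
  refine .step x l hx hx' nodup mem_iff L (fun j => ?_) hearly exchange
  have hj : x ⋖ l.get j := (mem_iff _).1 (l.get_mem j)
  exact hrec _ (l.get_mem j) (lt_top_iff_ne_top.2 fun h => hx' (h ▸ hj)) _ (hL j) (hmem j)

theorem of_pairwise {r : P → P → Prop} [Std.Asymm r] {x : P} {l : List P} (hx : x < ⊤)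
    (hl : l.Pairwise r) (mem_iff : ∀ a, a ∈ l ↔ x ⋖ a)
    (hrec : ∀ a ∈ l, a < ⊤ → ∀ L : List P, L.Nodup → (∀ b, b ∈ L ↔ a ⋖ b) →
      IsRecursiveAtomOrdering a L)
    (exchange : ∀ a b y, x ⋖ a → x ⋖ b → r a b → a < y → b < y →
      ∃ c, x ⋖ c ∧ r c b ∧ ∃ z, b ⋖ z ∧ c < z ∧ z ≤ y) :
    IsRecursiveAtomOrdering x l := by
  have hget : ∀ i j : Fin l.length, i < j → r (l.get i) (l.get j) := List.pairwise_iff_get.1 hl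
  have hirrefl : ∀ a, ¬ r a a := fun a h => Std.Asymm.asymm _ _ h h
  have hnodup : l.Nodup := hl.imp fun h => by
    rintro rfl
    exact hirrefl _ h
  refine .of_forall hx hnodup mem_iff hrec fun i j hij y hi hj => ?_
  obtain ⟨c, hxc, hcj, hz⟩ := exchange _ _ y ((mem_iff _).1 (l.get_mem i))
    ((mem_iff _).1 (l.get_mem j)) (hget i j hij) hi hj
  obtain ⟨k, rfl⟩ := List.mem_iff_get.1 ((mem_iff c).2 hxc)
  refine ⟨k, lt_of_not_ge fun hjk => ?_, hz⟩
  rcases hjk.eq_or_lt with rfl | hjk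
  · exact hirrefl _ hcj
  · exact Std.Asymm.asymm _ _ hcj (hget _ _ hjk)

theorem of_semimodular {x₀ : P} (h : ∀ x a b y : P, x₀ ≤ x → x ⋖ a → x ⋖ b → a ≠ b → a ≤ y →
      b ≤ y → ∃ z, b ⋖ z ∧ a < z ∧ z ≤ y) {x : P} (hx₀ : x₀ ≤ x) (hx : x < ⊤) {l : List P}
    (hl : l.Nodup) (hmem : ∀ a, a ∈ l ↔ x ⋖ a) : IsRecursiveAtomOrdering x l := by
  induction x using (Finite.wellFounded_of_trans_of_irrefl (α := P) (· > ·)).induction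
    generalizing l with
  | _ x ih =>
    refine .of_forall hx hl hmem (fun a ha hat L hL hLm => ?_) fun i j hij y hiy hjy => ?_
    · have hxa := ((hmem a).1 ha).lt
      exact ih a hxa (hx₀.trans hxa.le) hat hL hLm
    · have hne : l.get i ≠ l.get j := fun e => hij.ne (hl.injective_get e)
      exact ⟨i, hij, h x _ _ y hx₀ ((hmem _).1 (l.get_mem i)) ((hmem _).1 (l.get_mem j)) hne
        hiy.le hjy.le⟩

end IsRecursiveAtomOrdering

/-! ### Isolating and merging blocks of a partition -/

section Finpartition

variable {α : Type*} [Fintype α] [DecidableEq α] {P Q : Finpartition (Finset.univ : Finset α)}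
  {T : Finset α} {a b c p q : α}

theorem mem_part_comm : a ∈ P.part b ↔ b ∈ P.part a := by
  rw [P.mem_part_iff_part_eq_part (by simp) (by simp),
    P.mem_part_iff_part_eq_part (by simp) (by simp), eq_comm]

theorem part_eq_part (h : a ∈ P.part b) : P.part a = P.part b :=
  (P.mem_part_iff_part_eq_part (by simp) (by simp)).1 h

theorem mem_part_trans (h : a ∈ P.part b) (h' : b ∈ P.part c) : a ∈ P.part c :=
  part_eq_part h' ▸ h

theorem le_iff_forall_mem_part : P ≤ Q ↔ ∀ a b, a ∈ P.part b → a ∈ Q.part b := by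
  constructor
  · intro h a b hab
    obtain ⟨c, hc, hPc⟩ := h (P.part_mem.2 (Finset.mem_univ b))
    rw [Q.part_eq_of_mem hc (hPc (by simp))]
    exact hPc hab
  · intro h B hB
    obtain ⟨b, hb⟩ := P.nonempty_of_mem_parts hB
    refine ⟨Q.part b, Q.part_mem.2 (Finset.mem_univ b), fun a ha => h a b ?_⟩
    rwa [P.part_eq_of_mem hB hb]

/-- Make the nonempty set `T` a block, removing its elements from the other blocks. -/
def isolate (P : Finpartition (Finset.univ : Finset α)) (T : Finset α) (hT : T.Nonempty) :
    Finpartition (Finset.univ : Finset α) :=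
  (P.avoid T).extend hT.ne_empty Finset.sdiff_disjoint
    (Finset.sdiff_union_of_subset (Finset.subset_univ T))

theorem mem_parts_isolate {hT : T.Nonempty} {B : Finset α} :
    B ∈ (isolate P T hT).parts ↔ B = T ∨ ∃ d ∈ P.parts, ¬ d ⊆ T ∧ d \ T = B := by
  simp only [isolate, Finpartition.extend_parts, Finset.mem_insert, Finpartition.mem_avoid]

theorem part_isolate_of_mem {hT : T.Nonempty} (ha : a ∈ T) : (isolate P T hT).part a = T :=
  Finpartition.part_eq_of_mem _ (mem_parts_isolate.2 (.inl rfl)) ha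

theorem part_isolate_of_notMem {hT : T.Nonempty} (ha : a ∉ T) :
    (isolate P T hT).part a = P.part a \ T := by
  refine Finpartition.part_eq_of_mem _ (mem_parts_isolate.2 (.inr ⟨P.part a, by simp, ?_, rfl⟩))
    (by simp [ha])
  exact fun h => ha (h (by simp))

/-- Join the blocks of `p` and `q`. -/
def mergeBlocks (P : Finpartition (Finset.univ : Finset α)) (p q : α) :
    Finpartition (Finset.univ : Finset α) :=
  isolate P (P.part p ∪ P.part q) (.inl (P.nonempty_of_mem_parts (by simp)))

theorem part_mergeBlocks_of_mem (ha : a ∈ P.part p ∪ P.part q) :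
    (mergeBlocks P p q).part a = P.part p ∪ P.part q :=
  part_isolate_of_mem ha

theorem part_mergeBlocks_of_notMem (ha : a ∉ P.part p ∪ P.part q) :
    (mergeBlocks P p q).part a = P.part a := by
  rw [mergeBlocks, part_isolate_of_notMem ha, Finset.sdiff_eq_self_iff_disjoint,
    Finset.disjoint_left]
  intro b hb hb'
  refine ha ?_
  simp only [Finset.mem_union] at hb' ⊢
  exact hb'.imp (mem_part_trans (mem_part_comm.1 hb)) (mem_part_trans (mem_part_comm.1 hb))

theorem mergeBlocks_le_iff : mergeBlocks P p q ≤ Q ↔ P ≤ Q ∧ p ∈ Q.part q := by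
  simp only [le_iff_forall_mem_part]
  constructor
  · refine fun h => ⟨fun a b hab => h a b ?_, h p q ?_⟩
    · by_cases hb : b ∈ P.part p ∪ P.part q
      · rw [part_mergeBlocks_of_mem hb]
        exact Finset.mem_union.2 ((Finset.mem_union.1 hb).imp (mem_part_trans hab)
          (mem_part_trans hab))
      · rwa [part_mergeBlocks_of_notMem hb]
    · rw [part_mergeBlocks_of_mem (by simp)]
      simp
  · rintro ⟨h, hpq⟩ a b hab
    by_cases hb : b ∈ P.part p ∪ P.part q
    · rw [part_mergeBlocks_of_mem hb] at hab
      have toQ : ∀ c ∈ P.part p ∪ P.part q, c ∈ Q.part q := fun c hc =>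
        (Finset.mem_union.1 hc).elim (fun hc => mem_part_trans (h c p hc) hpq) (h c q)
      exact mem_part_trans (toQ a hab) (mem_part_comm.1 (toQ b hb))
    · rw [part_mergeBlocks_of_notMem hb] at hab
      exact h a b hab

theorem parts_mergeBlocks :
    (mergeBlocks P p q).parts =
      insert (P.part p ∪ P.part q) ((P.parts.erase (P.part p)).erase (P.part q)) := by
  ext B
  rw [Finset.mem_insert, Finset.mem_erase, Finset.mem_erase]
  constructor
  · intro hB
    obtain ⟨b, hb⟩ := Finpartition.nonempty_of_mem_parts _ hB
    rw [← Finpartition.part_eq_of_mem _ hB hb]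
    by_cases hU : b ∈ P.part p ∪ P.part q
    · exact .inl (part_mergeBlocks_of_mem hU)
    · rw [part_mergeBlocks_of_notMem hU]
      rw [Finset.mem_union, not_or] at hU
      exact .inr ⟨fun e => hU.2 (by simp [← e]), fun e => hU.1 (by simp [← e]), by simp⟩
  · rintro (rfl | ⟨hq, hp, hB⟩)
    · exact mem_parts_isolate.2 (.inl rfl)
    · obtain ⟨b, hb⟩ := P.nonempty_of_mem_parts hB
      rw [← P.part_eq_of_mem hB hb] at hp hq ⊢
      rw [← part_mergeBlocks_of_notMem (p := p) (q := q)]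
      · simp
      · exact fun h => (Finset.mem_union.1 h).elim (hp ∘ part_eq_part) (hq ∘ part_eq_part)

theorem card_parts_mergeBlocks (h : p ∉ P.part q) :
    (mergeBlocks P p q).parts.card + 1 = P.parts.card := by
  have hne : P.part q ≠ P.part p := fun e => h (by simp [e])
  have hq : P.part q ∈ P.parts.erase (P.part p) := Finset.mem_erase.2 ⟨hne, by simp⟩
  have hunion : P.part p ∪ P.part q ∉ (P.parts.erase (P.part p)).erase (P.part q) := by
    simp only [Finset.mem_erase, not_and]
    exact fun _ hp hU => hp (P.part_eq_of_mem hU (by simp)).symm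
  rw [parts_mergeBlocks, Finset.card_insert_of_notMem hunion, Finset.card_erase_add_one hq,
    Finset.card_erase_add_one (by simp)]

end Finpartition

namespace EvenPartition

variable {n : ℕ} {π ρ : EvenPartition n} {a b p q r : Fin (2 * n)}

/-! ### Covering relations between even partitions -/

theorem le_iff_mem_part : π ≤ ρ ↔ ∀ a b, a ∈ π.1.part b → a ∈ ρ.1.part b :=
  le_iff_forall_mem_part

theorem eq_of_part_eq (h : ∀ a, π.1.part a = ρ.1.part a) : π = ρ :=
  le_antisymm (le_iff_mem_part.2 fun a b => by simp [h]) (le_iff_mem_part.2 fun a b => by simp [h])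

theorem even_card_part (π : EvenPartition n) (a : Fin (2 * n)) : Even (π.1.part a).card :=
  π.2 _ (by simp)

theorem two_le_card_part (π : EvenPartition n) (a : Fin (2 * n)) : 2 ≤ (π.1.part a).card := by
  have hpos : 0 < (π.1.part a).card := Finset.card_pos.2 ⟨a, by simp⟩
  obtain ⟨k, hk⟩ := π.even_card_part a
  omega

theorem card_union_part (h : p ∉ π.1.part q) :
    (π.1.part p ∪ π.1.part q).card = (π.1.part p).card + (π.1.part q).card := by
  have hne : π.1.part p ≠ π.1.part q := fun e => h (by simp [← e])
  exact Finset.card_union_of_disjoint (π.1.disjoint (π.1.part_mem.2 (Finset.mem_univ p))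
    (π.1.part_mem.2 (Finset.mem_univ q)) hne)

/-- Join the blocks of `p` and `q`. -/
def merge (π : EvenPartition n) (p q : Fin (2 * n)) : EvenPartition n :=
  ⟨mergeBlocks π.1 p q, by
    intro B hB
    rw [parts_mergeBlocks, Finset.mem_insert, Finset.mem_erase, Finset.mem_erase] at hB
    rcases hB with rfl | hB
    · by_cases h : p ∈ π.1.part q
      · rw [part_eq_part h, Finset.union_self]
        exact π.even_card_part q
      · rw [card_union_part h]
        exact (π.even_card_part p).add (π.even_card_part q)
    · exact π.2 B hB.2.2⟩

theorem merge_le_iff : π.merge p q ≤ ρ ↔ π ≤ ρ ∧ p ∈ ρ.1.part q := mergeBlocks_le_iff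

theorem le_merge (π : EvenPartition n) (p q : Fin (2 * n)) : π ≤ π.merge p q :=
  (merge_le_iff.1 le_rfl).1

theorem mem_part_merge (π : EvenPartition n) (p q : Fin (2 * n)) : p ∈ (π.merge p q).1.part q :=
  (merge_le_iff.1 le_rfl).2

theorem card_parts_merge (h : p ∉ π.1.part q) :
    (π.merge p q).1.parts.card + 1 = π.1.parts.card := card_parts_mergeBlocks h

theorem lt_merge (h : p ∉ π.1.part q) : π < π.merge p q :=
  (π.le_merge p q).lt_of_ne fun e => h (e ▸ π.mem_part_merge p q)

theorem exists_merge_le (h : π < ρ) : ∃ p q, p ∉ π.1.part q ∧ π.merge p q ≤ ρ := by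
  have hnot := h.not_ge
  rw [le_iff_mem_part] at hnot
  push Not at hnot
  obtain ⟨p, q, hρ, hπ⟩ := hnot
  exact ⟨p, q, hπ, merge_le_iff.2 ⟨h.le, hρ⟩⟩

theorem card_parts_lt (h : π < ρ) : ρ.1.parts.card < π.1.parts.card := by
  obtain ⟨p, q, hpq, hle⟩ := exists_merge_le h
  have hmono := Finpartition.card_mono (show (π.merge p q).1 ≤ ρ.1 from hle)
  have hmerge := card_parts_merge hpq
  omega

theorem covBy_merge (h : p ∉ π.1.part q) : π ⋖ π.merge p q := by
  refine ⟨lt_merge h, fun c hπc hcm => ?_⟩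
  have hcard := card_parts_merge h
  have hlt := card_parts_lt hπc
  have hlt' := card_parts_lt hcm
  omega

theorem exists_eq_merge (h : π ⋖ ρ) : ∃ p q, p ∉ π.1.part q ∧ ρ = π.merge p q := by
  obtain ⟨p, q, hpq, hle⟩ := exists_merge_le h.lt
  exact ⟨p, q, hpq, (hle.eq_or_lt.resolve_right (h.2 (lt_merge hpq))).symm⟩

theorem card_parts_covBy (h : π ⋖ ρ) : ρ.1.parts.card + 1 = π.1.parts.card := by
  obtain ⟨p, q, hpq, rfl⟩ := exists_eq_merge h
  exact card_parts_merge hpq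

theorem semimodular {x a b y : EvenPartition n} (ha : x ⋖ a) (hb : x ⋖ b) (hab : a ≠ b)
    (hay : a ≤ y) (hby : b ≤ y) : ∃ z, b ⋖ z ∧ a < z ∧ z ≤ y := by
  obtain ⟨p, q, -, rfl⟩ := exists_eq_merge ha
  have hpq : p ∉ b.1.part q := fun h =>
    hb.2 ha.lt ((merge_le_iff.2 ⟨hb.le, h⟩ : x.merge p q ≤ b).lt_of_ne hab)
  have hle : x.merge p q ≤ b.merge p q :=
    merge_le_iff.2 ⟨hb.le.trans (b.le_merge p q), b.mem_part_merge p q⟩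
  refine ⟨b.merge p q, covBy_merge hpq, hle.lt_of_ne fun e => ?_,
    merge_le_iff.2 ⟨hby, (merge_le_iff.1 hay).2⟩⟩
  have hxa := card_parts_covBy ha
  have hxb := card_parts_covBy hb
  have hbz := card_parts_merge hpq
  rw [e] at hxa
  omega

/-! ### Words of partitions -/

end EvenPartition

theorem sort_eq_append_filter_lt {α : Type*} [LinearOrder α] (s : Finset α) (x : α) :
    s.sort (· ≤ ·) = (s.filter (· < x)).sort (· ≤ ·) ++ (s.filter (x ≤ ·)).sort (· ≤ ·) := by
  have hlt : ∀ a ∈ (s.filter (· < x)).sort (· ≤ ·), ∀ b ∈ (s.filter (x ≤ ·)).sort (· ≤ ·),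
      a < b := fun a ha b hb => by
    simp only [Finset.mem_sort, Finset.mem_filter] at ha hb
    exact ha.2.trans_le hb.2
  have hnodup := (Finset.sort_nodup (s.filter (· < x)) (· ≤ ·)).append
    (Finset.sort_nodup (s.filter (x ≤ ·)) (· ≤ ·)) fun a ha hb => (hlt a ha a hb).false
  rw [← (List.toFinset_sort (· ≤ ·) hnodup).2 (List.pairwise_append.2
    ⟨Finset.pairwise_sort _ _, Finset.pairwise_sort _ _, fun a ha b hb => (hlt a ha b hb).le⟩)]
  congr 1
  ext a
  simp only [List.toFinset_append, Finset.sort_toFinset, Finset.mem_union, Finset.mem_filter,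
    ← and_or_left, lt_or_ge, and_true]

theorem exists_sort_eq_cons {α : Type*} [LinearOrder α] {s : Finset α} {m : α} (hm : m ∈ s)
    (h : ∀ x ∈ s, m ≤ x) : ∃ t, s.sort (· ≤ ·) = m :: t := by
  refine ⟨(s.erase m).sort (· ≤ ·), ?_⟩
  conv_lhs => rw [← Finset.insert_erase hm]
  exact Finset.sort_insert _ (fun b hb => h b (Finset.mem_of_mem_erase hb)) (by simp)

theorem sort_pair {α : Type*} [LinearOrder α] {p q : α} (h : p < q) :
    ({p, q} : Finset α).sort (· ≤ ·) = [p, q] := by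
  rw [Finset.sort_insert _ (by simp [h.le]) (by simp [h.ne]), Finset.sort_singleton]

theorem cons_lt_singleton_iff {α : Type*} [LinearOrder α] {a p : α} {l : List α} :
    a :: l < [p] ↔ a < p := by
  simp [List.cons_lt_cons_iff]

namespace EvenPartition

variable {n : ℕ} {π ρ : EvenPartition n} {a b p q q' r s : Fin (2 * n)}

/-- The sorted blocks of a partition; the word of the partition is their sorted concatenation. -/
def sortedBlocks (π : EvenPartition n) : Finset (List (Fin (2 * n))) :=
  π.1.parts.image fun B => B.sort (· ≤ ·)

theorem exists_cons_of_mem_sortedBlocks {l : List (Fin (2 * n))} (hl : l ∈ π.sortedBlocks) :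
    ∃ r t, l = r :: t ∧ l = (π.1.part r).sort (· ≤ ·) := by
  obtain ⟨B, hB, rfl⟩ := Finset.mem_image.1 hl
  have hne : B.sort (· ≤ ·) ≠ [] := fun h => by
    obtain ⟨x, hx⟩ := π.1.nonempty_of_mem_parts hB
    rw [← Finset.mem_sort (· ≤ ·), h] at hx
    exact List.not_mem_nil hx
  obtain ⟨r, t, h⟩ := List.exists_cons_of_ne_nil hne
  have hr : r ∈ B := by
    rw [← Finset.mem_sort (· ≤ ·), h]
    exact List.mem_cons_self
  exact ⟨r, t, h, by rw [π.1.part_eq_of_mem hB hr]⟩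

theorem sort_part_mem_sortedBlocks (π : EvenPartition n) (r : Fin (2 * n)) :
    (π.1.part r).sort (· ≤ ·) ∈ π.sortedBlocks :=
  Finset.mem_image_of_mem _ (by simp)

theorem sortedBlocks_filter_subset (h : ∀ r < p, π.1.part r = ρ.1.part r) :
    π.sortedBlocks.filter (· < [p]) ⊆ ρ.sortedBlocks.filter (· < [p]) := by
  intro l hl
  rw [Finset.mem_filter] at hl ⊢
  obtain ⟨hl, hlp⟩ := hl
  obtain ⟨r, t, hcons, hsort⟩ := exists_cons_of_mem_sortedBlocks hl
  have hr : r < p := cons_lt_singleton_iff.1 (hcons ▸ hlp)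
  refine ⟨?_, hlp⟩
  rw [hsort, h r hr]
  exact ρ.sort_part_mem_sortedBlocks r

theorem exists_word_eq (hp : π.1.part p = {p, q}) (hpq : p < q) :
    ∃ t, π.word = ((π.sortedBlocks.filter (· < [p])).sort (· ≤ ·)).flatten ++ p :: q :: t := by
  have hmem : [p, q] ∈ π.sortedBlocks.filter ([p] ≤ ·) := by
    rw [Finset.mem_filter, ← not_lt, cons_lt_singleton_iff, ← sort_pair hpq, ← hp]
    exact ⟨π.sort_part_mem_sortedBlocks p, lt_irrefl p⟩
  have hle : ∀ l ∈ π.sortedBlocks.filter ([p] ≤ ·), [p, q] ≤ l := fun l hl => by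
    obtain ⟨hl, hpl⟩ := Finset.mem_filter.1 hl
    obtain ⟨r, t, hcons, hsort⟩ := exists_cons_of_mem_sortedBlocks hl
    have hr : p ≤ r := by rwa [hcons, ← not_lt, cons_lt_singleton_iff, not_lt] at hpl
    rcases hr.eq_or_lt with rfl | hr
    · rw [hsort, hp, sort_pair hpq]
    · rw [hcons]
      exact (List.cons_lt_cons_iff.2 (.inl hr)).le
  obtain ⟨t, ht⟩ := exists_sort_eq_cons hmem hle
  refine ⟨t.flatten, ?_⟩
  change (π.sortedBlocks.sort (· ≤ ·)).flatten = _
  rw [sort_eq_append_filter_lt π.sortedBlocks [p], ht, List.flatten_append]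
  congr!

theorem word_lt_word (h : ∀ r < p, π.1.part r = ρ.1.part r) (hπ : π.1.part p = {p, q})
    (hρ : ρ.1.part p = {p, q'}) (hpq : p < q) (hq : q < q') : π.word < ρ.word := by
  obtain ⟨t, ht⟩ := exists_word_eq hπ hpq
  obtain ⟨t', ht'⟩ := exists_word_eq hρ (hpq.trans hq)
  rw [ht, ht', (sortedBlocks_filter_subset h).antisymm
    (sortedBlocks_filter_subset fun r hr => (h r hr).symm)]
  apply List.append_left_lt
  rw [List.cons_lt_cons_iff, List.cons_lt_cons_iff]
  exact .inr ⟨rfl, .inl hq⟩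

/-! ### The minimal even partitions -/

/-- Split the pair `{p, q}` off the block containing it. -/
def splitPair (π : EvenPartition n) (p q : Fin (2 * n)) (hne : p ≠ q) (h : p ∈ π.1.part q) :
    EvenPartition n :=
  ⟨isolate π.1 {p, q} (by simp), by
    intro B hB
    rcases mem_parts_isolate.1 hB with rfl | ⟨d, hd, -, rfl⟩
    · rw [Finset.card_pair hne]
      exact even_two
    · by_cases hqd : q ∈ d
      · have hpd : p ∈ d := π.1.part_eq_of_mem hd hqd ▸ h
        rw [Finset.card_sdiff_of_subset (by simp [Finset.insert_subset_iff, hpd, hqd]),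
          Finset.card_pair hne]
        exact (π.2 d hd).tsub even_two
      · have hpd : p ∉ d := fun hpd => hqd (π.1.part_eq_of_mem hd hpd ▸ mem_part_comm.1 h)
        rw [Finset.sdiff_eq_self_of_disjoint (by simp [hpd, hqd])]
        exact π.2 d hd⟩

theorem part_splitPair_of_mem {hne : p ≠ q} {h : p ∈ π.1.part q} (ha : a ∈ ({p, q} : Finset _)) :
    (π.splitPair p q hne h).1.part a = {p, q} :=
  part_isolate_of_mem (hT := by simp) ha

theorem part_splitPair_of_notMem {hne : p ≠ q} {h : p ∈ π.1.part q}
    (ha : a ∉ ({p, q} : Finset _)) :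
    (π.splitPair p q hne h).1.part a = π.1.part a \ {p, q} :=
  part_isolate_of_notMem (hT := by simp) ha

theorem splitPair_le {hne : p ≠ q} {h : p ∈ π.1.part q} : π.splitPair p q hne h ≤ π := by
  refine le_iff_mem_part.2 fun a b hab => ?_
  by_cases hb : b ∈ ({p, q} : Finset _)
  · rw [part_splitPair_of_mem hb] at hab
    have toq : ∀ c ∈ ({p, q} : Finset _), c ∈ π.1.part q := by simp [h]
    exact mem_part_trans (toq a hab) (mem_part_comm.1 (toq b hb))
  · rw [part_splitPair_of_notMem hb] at hab
    exact (Finset.mem_sdiff.1 hab).1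

theorem isMin_iff_card_part : IsMin π ↔ ∀ a, (π.1.part a).card = 2 := by
  constructor
  · intro h a
    obtain ⟨b, hb, hba⟩ := Finset.exists_mem_ne (π.two_le_card_part a) a
    have hmin := h.eq_of_le (splitPair_le (hne := hba) (h := hb))
    rw [← hmin, part_splitPair_of_mem (by simp), Finset.card_pair hba]
  · intro h ρ hρ
    refine le_iff_mem_part.2 fun a b hab => ?_
    have hsub : ρ.1.part b ⊆ π.1.part b := fun c => le_iff_mem_part.1 hρ c b
    rwa [Finset.eq_of_subset_of_card_le hsub (by rw [h]; exact ρ.two_le_card_part b)]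

theorem exists_part_eq_pair (h : IsMin π) (a : Fin (2 * n)) :
    ∃ b ≠ a, π.1.part a = {a, b} := by
  obtain ⟨x, y, hxy, hB⟩ := Finset.card_eq_two.1 (isMin_iff_card_part.1 h a)
  have ha : a ∈ π.1.part a := by simp
  rw [hB, Finset.mem_insert, Finset.mem_singleton] at ha
  rcases ha with rfl | rfl
  · exact ⟨y, hxy.symm, hB⟩
  · exact ⟨x, hxy, hB.trans (Finset.pair_comm _ _)⟩

theorem lt_partner_of_first_difference (hne : π.1.part p ≠ ρ.1.part p)
    (h : ∀ r < p, π.1.part r = ρ.1.part r) (hπ : π.1.part p = {p, q}) (hqp : q ≠ p) : p < q := by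
  refine lt_of_le_of_ne (not_lt.1 fun hlt => hne ?_) hqp.symm
  have hq : q ∈ π.1.part p := by simp [hπ]
  have hp : p ∈ ρ.1.part q := h q hlt ▸ mem_part_comm.1 hq
  rw [← part_eq_part hq, h q hlt, part_eq_part hp]

theorem exists_first_difference (hπ : IsMin π) (hρ : IsMin ρ) (h : π ≠ ρ) :
    ∃ p q q', (∀ r < p, π.1.part r = ρ.1.part r) ∧ π.1.part p = {p, q} ∧
      ρ.1.part p = {p, q'} ∧ p < q ∧ p < q' ∧ q ≠ q' := by
  have hex : ∃ p, π.1.part p ≠ ρ.1.part p := by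
    contrapose! h
    exact eq_of_part_eq h
  obtain ⟨p, hp, hmin⟩ := WellFounded.has_min (wellFounded_lt (α := Fin (2 * n))) {p | _} hex
  have hfirst : ∀ r < p, π.1.part r = ρ.1.part r := fun r hr => by
    by_contra hne
    exact hmin r hne hr
  obtain ⟨q, hq, hπq⟩ := exists_part_eq_pair hπ p
  obtain ⟨q', hq', hρq⟩ := exists_part_eq_pair hρ p
  refine ⟨p, q, q', hfirst, hπq, hρq, lt_partner_of_first_difference hp hfirst hπq hq,
    lt_partner_of_first_difference (Ne.symm hp) (fun r hr => (hfirst r hr).symm) hρq hq', ?_⟩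
  rintro rfl
  exact hp (hπq.trans hρq.symm)

theorem word_injOn_isMin : Set.InjOn (word (n := n)) {π | IsMin π} := by
  intro π hπ ρ hρ h
  by_contra hne
  obtain ⟨p, q, q', hfirst, hπq, hρq', hpq, hpq', hqq'⟩ := exists_first_difference hπ hρ hne
  rcases hqq'.lt_or_gt with hlt | hlt
  · exact (word_lt_word hfirst hπq hρq' hpq hlt).ne h
  · exact (word_lt_word (fun r hr => (hfirst r hr).symm) hρq' hπq hpq' hlt).ne h.symm

/-! ### The exchange property of minimal even partitions -/

/-- Trade partners in a minimal partition: the pairs of `p` and `r` are joined, and `{p, r}` and the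
pair of their former partners are separated again. -/
def exchangePartners (π : EvenPartition n) (p r : Fin (2 * n)) (hne : p ≠ r) : EvenPartition n :=
  (π.merge p r).splitPair p r hne (π.mem_part_merge p r)

theorem part_exchangePartners_of_notMem {hne : p ≠ r} (ha : a ∉ π.1.part p ∪ π.1.part r) :
    (π.exchangePartners p r hne).1.part a = π.1.part a := by
  rw [Finset.mem_union, not_or] at ha
  rw [exchangePartners, part_splitPair_of_notMem, merge, part_mergeBlocks_of_notMem,
    Finset.sdiff_eq_self_of_disjoint]
  · simp [mem_part_comm (a := p) (b := a), mem_part_comm (a := r) (b := a), ha]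
  · simp [ha]
  · rw [Finset.mem_insert, Finset.mem_singleton]
    rintro (rfl | rfl) <;> simp at ha

theorem part_exchangePartners_left {hne : p ≠ r} :
    (π.exchangePartners p r hne).1.part p = {p, r} :=
  part_splitPair_of_mem (by simp)

theorem isMin_exchangePartners (hπ : IsMin π) {hne : p ≠ r} (h : p ∉ π.1.part r) :
    IsMin (π.exchangePartners p r hne) := by
  rw [isMin_iff_card_part] at hπ ⊢
  intro a
  by_cases haU : a ∈ π.1.part p ∪ π.1.part r
  · by_cases ha : a ∈ ({p, r} : Finset _)
    · rw [exchangePartners, part_splitPair_of_mem ha, Finset.card_pair hne]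
    · have hsub : {p, r} ⊆ π.1.part p ∪ π.1.part r := by simp [Finset.insert_subset_iff]
      rw [exchangePartners, part_splitPair_of_notMem ha, merge, part_mergeBlocks_of_mem haU,
        Finset.card_sdiff_of_subset hsub, card_union_part h, hπ, hπ, Finset.card_pair hne]
  · rw [part_exchangePartners_of_notMem haU, hπ]

theorem exists_isMin_word_lt_of_lt_partner {y : EvenPartition n} (hπ : IsMin π) (hπy : π ≤ y)
    (hq : π.1.part p = {p, q}) (hs : π.1.part r = {r, s}) (hpr : p < r)
    (hrq : r < q) (hps : p < s) (hr : r ∈ y.1.part p) :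
    ∃ ρ z, IsMin ρ ∧ ρ.word < π.word ∧ π ⋖ z ∧ ρ < z ∧ z ≤ y := by
  have hp : p ∉ π.1.part r := by simp [hs, hpr.ne, hps.ne]
  have hmin := isMin_exchangePartners hπ (hne := hpr.ne) hp
  have hcov := covBy_merge hp
  refine ⟨π.exchangePartners p r hpr.ne, π.merge p r, hmin, ?_, hcov,
    splitPair_le.lt_of_ne fun e => ?_, merge_le_iff.2 ⟨hπy, mem_part_comm.1 hr⟩⟩
  · refine word_lt_word (fun t ht => part_exchangePartners_of_notMem ?_)
      part_exchangePartners_left hq hpr hrq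
    simp [hq, hs, ht.ne, (ht.trans hpr).ne, (ht.trans hps).ne, (ht.trans (hpr.trans hrq)).ne]
  · change π.exchangePartners p r hpr.ne = _ at e
    exact hmin.not_lt (e ▸ hcov.lt)

theorem exists_isMin_word_lt {y : EvenPartition n} (hπ : IsMin π) (hπy : π ≤ y)
    (hq : π.1.part p = {p, q}) (hpr : p < r) (hrq : r < q) (hr : r ∈ y.1.part p) :
    ∃ ρ z, IsMin ρ ∧ ρ.word < π.word ∧ π ⋖ z ∧ ρ < z ∧ z ≤ y := by
  obtain ⟨s, hsr, hs⟩ := exists_part_eq_pair hπ r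
  rcases lt_trichotomy p s with h | rfl | h
  · exact exists_isMin_word_lt_of_lt_partner hπ hπy hq hs hpr hrq h hr
  · have hrp : r ∈ π.1.part p := mem_part_comm.1 (by simp [hs])
    simp [hq, hpr.ne', hrq.ne] at hrp
  · have hs' : π.1.part s = {s, r} := by
      rw [part_eq_part (show s ∈ π.1.part r by simp [hs]), hs, Finset.pair_comm]
    have hsr' : r ∈ y.1.part s := le_iff_mem_part.1 hπy _ _ (by simp [hs'])
    exact exists_isMin_word_lt_of_lt_partner hπ hπy hs' hq h hpr (h.trans (hpr.trans hrq))
      (mem_part_trans (mem_part_comm.1 hr) hsr')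

theorem exists_isMin_word_lt_of_word_lt {y : EvenPartition n} (hπ : IsMin π) (hρ : IsMin ρ)
    (h : ρ.word < π.word) (hπy : π ≤ y) (hρy : ρ ≤ y) :
    ∃ ρ z, IsMin ρ ∧ ρ.word < π.word ∧ π ⋖ z ∧ ρ < z ∧ z ≤ y := by
  obtain ⟨p, q, q', hfirst, hρq, hπq', hpq, hpq', hqq'⟩ :=
    exists_first_difference hρ hπ fun e => h.ne (by rw [e])
  rcases hqq'.lt_or_gt with hlt | hlt
  · exact exists_isMin_word_lt hπ hπy hπq' hpq hlt (le_iff_mem_part.1 hρy _ _ (by simp [hρq]))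
  · exact absurd h (word_lt_word (fun r hr => (hfirst r hr).symm) hπq' hρq hpq' hlt).asymm

end EvenPartition

theorem exists_list_pairwise_lt {α β : Type*} [LinearOrder β] {s : Set α} (hs : s.Finite)
    {f : α → β} (hf : s.InjOn f) :
    ∃ l : List α, l.Pairwise (fun a b => f a < f b) ∧ ∀ a, a ∈ l ↔ a ∈ s := by
  have := hs.fintype
  let : LinearOrder s := LinearOrder.lift' (s.domRestrict f) hf.injective
  refine ⟨((Finset.univ : Finset s).sort (· ≤ ·)).map (↑), ?_, fun a => by simp⟩
  exact List.pairwise_map.2 (Finset.sortedLT_sort _).pairwise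

namespace EvenPartition

variable {n : ℕ}

theorem exists_list_isMin (n : ℕ) : ∃ l : List (EvenPartition n),
    l.Pairwise (fun π ρ => π.word < ρ.word) ∧ ∀ π, π ∈ l ↔ IsMin π :=
  exists_list_pairwise_lt (Set.toFinite _) word_injOn_isMin

theorem semimodular_withBot (π : EvenPartition n) {x a b y : WithBot (EvenPartition n)}
    (hx : π ≤ x) (ha : x ⋖ a) (hb : x ⋖ b) (hab : a ≠ b) (hay : a ≤ y) (hby : b ≤ y) :
    ∃ z, b ⋖ z ∧ a < z ∧ z ≤ y := by
  lift x to EvenPartition n using ne_bot_of_le_ne_bot WithBot.coe_ne_bot hx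
  lift a to EvenPartition n using ne_bot_of_gt ha.lt
  lift b to EvenPartition n using ne_bot_of_gt hb.lt
  lift y to EvenPartition n using ne_bot_of_le_ne_bot WithBot.coe_ne_bot hay
  rw [WithBot.coe_covBy_coe] at ha hb
  rw [WithBot.coe_le_coe] at hay hby
  obtain ⟨z, hbz, haz, hzy⟩ := semimodular ha hb (fun e => hab (by rw [e])) hay hby
  exact ⟨z, WithBot.coe_covBy_coe.2 hbz, WithBot.coe_lt_coe.2 haz, WithBot.coe_le_coe.2 hzy⟩

theorem exists_exchange_withBot {a b y : WithBot (EvenPartition n)} (ha : ⊥ ⋖ a) (hb : ⊥ ⋖ b)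
    (hab : a.map word < b.map word) (hay : a < y) (hby : b < y) :
    ∃ c, ⊥ ⋖ c ∧ c.map word < b.map word ∧ ∃ z, b ⋖ z ∧ c < z ∧ z ≤ y := by
  lift a to EvenPartition n using ne_bot_of_gt ha.lt
  lift b to EvenPartition n using ne_bot_of_gt hb.lt
  lift y to EvenPartition n using ne_bot_of_gt hay
  rw [WithBot.bot_covBy_coe] at ha hb
  rw [WithBot.coe_lt_coe] at hay hby
  obtain ⟨c, z, hc, hcb, hbz, hcz, hzy⟩ :=
    exists_isMin_word_lt_of_word_lt hb ha (WithBot.coe_lt_coe.1 hab) hby.le hay.le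
  exact ⟨c, WithBot.bot_covBy_coe.2 hc, WithBot.coe_lt_coe.2 hcb, z, WithBot.coe_covBy_coe.2 hbz,
    WithBot.coe_lt_coe.2 hcz, WithBot.coe_le_coe.2 hzy⟩

theorem isRecursiveAtomOrdering {l : List (EvenPartition n)}
    (hl : l.Pairwise (fun π ρ => π.word < ρ.word)) (hmem : ∀ π, π ∈ l ↔ IsMin π) :
    IsRecursiveAtomOrdering (⊥ : WithBot (EvenPartition n)) (l.map (↑)) := by
  have : Std.Asymm fun a b : WithBot (EvenPartition n) => a.map word < b.map word :=
    ⟨fun _ _ h => h.asymm⟩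
  refine .of_pairwise (r := fun a b => a.map word < b.map word) (WithBot.bot_lt_coe _)
    (List.pairwise_map.2 (hl.imp WithBot.coe_lt_coe.2)) (fun a => ?_) (fun a ha hat L hL hL' => ?_)
    fun a b y => exists_exchange_withBot
  · induction a with
    | bot => simp
    | coe a =>
      rw [WithBot.bot_covBy_coe]
      simp [hmem]
  · obtain ⟨π, -, rfl⟩ := List.mem_map.1 ha
    exact .of_semimodular (fun _ _ _ _ => semimodular_withBot π) le_rfl hat hL hL'

end EvenPartition

/-! ### Maximal chains -/

section MaxChain

variable {P : Type*} [PartialOrder P]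

theorem exists_least_of_isChain {F : Finset P} (hF : IsChain (· ≤ ·) (F : Set P))
    (hne : F.Nonempty) : ∃ a ∈ F, ∀ y ∈ F, a ≤ y := by
  obtain ⟨a, ha⟩ := F.exists_minimal hne
  exact ⟨a, ha.prop, fun y hy => (hF.total ha.prop hy).elim id (ha.le_of_le hy)⟩

variable [OrderTop P] {x a b c y z : P} {C E F : Finset P}

/-- `F` is a chain of the open interval `(x, ⊤)`. -/
def IsChainAbove (x : P) (F : Finset P) : Prop :=
  IsChain (· ≤ ·) (F : Set P) ∧ ∀ y ∈ F, x < y ∧ y < ⊤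

/-- `F` is a maximal chain of the open interval `(x, ⊤)`. -/
def IsMaxChainAbove (x : P) (F : Finset P) : Prop :=
  Maximal (IsChainAbove x) F

namespace IsChainAbove

theorem mono (hF : IsChainAbove x F) (h : E ⊆ F) : IsChainAbove x E :=
  ⟨hF.1.mono (Finset.coe_subset.2 h), fun y hy => hF.2 y (h hy)⟩

theorem anti_left (hF : IsChainAbove a F) (h : x ≤ a) : IsChainAbove x F :=
  ⟨hF.1, fun y hy => ⟨h.trans_lt (hF.2 y hy).1, (hF.2 y hy).2⟩⟩

theorem notMem (hF : IsChainAbove a F) : a ∉ F := fun h => (hF.2 a h).1.false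

theorem insert [DecidableEq P] (hF : IsChainAbove x F) (hxc : x < c) (hc : c < ⊤)
    (h : ∀ y ∈ F, c ≤ y ∨ y ≤ c) : IsChainAbove x (insert c F) := by
  refine ⟨?_, (Finset.forall_mem_insert _ _ _).2 ⟨⟨hxc, hc⟩, hF.2⟩⟩
  rw [Finset.coe_insert]
  exact hF.1.insert fun y hy _ => h y hy

theorem insert_bot [DecidableEq P] (hF : IsChainAbove a F) (hxa : x < a) (ha : a < ⊤) :
    IsChainAbove x (Insert.insert a F) :=
  (hF.anti_left hxa.le).insert hxa ha fun y hy => .inl (hF.2 y hy).1.le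

theorem le_of_covBy (hF : IsChainAbove x F) (hxa : x ⋖ a) (ha : a ∈ F) (hy : y ∈ F) : a ≤ y :=
  (hF.1.total ha hy).elim id fun h =>
    (h.eq_or_lt.resolve_right (hxa.2 (hF.2 y hy).1)).ge

theorem eq_of_covBy (hF : IsChainAbove x F) (hxa : x ⋖ a) (hxb : x ⋖ b) (ha : a ∈ F)
    (hb : b ∈ F) : a = b :=
  (hF.le_of_covBy hxa ha hb).antisymm (hF.le_of_covBy hxb hb ha)

theorem erase [DecidableEq P] (hF : IsChainAbove x F) (hxa : x ⋖ a) (ha : a ∈ F) :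
    IsChainAbove a (F.erase a) := by
  refine ⟨hF.1.mono (by simp), fun y hy => ?_⟩
  obtain ⟨hya, hy⟩ := Finset.mem_erase.1 hy
  exact ⟨(hF.le_of_covBy hxa ha hy).lt_of_ne hya.symm, (hF.2 y hy).2⟩

theorem exists_isMaxChainAbove [Finite P] (hC : IsChainAbove x C) :
    ∃ F, C ⊆ F ∧ IsMaxChainAbove x F :=
  Set.Finite.exists_le_maximal (s := {F | IsChainAbove x F}) (Set.toFinite _) hC

end IsChainAbove

namespace IsMaxChainAbove

theorem eq_empty (hF : IsMaxChainAbove x F) (hx : x ⋖ ⊤) : F = ∅ := by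
  rw [Finset.eq_empty_iff_forall_notMem]
  exact fun y hy => hx.2 (hF.prop.2 y hy).1 (hF.prop.2 y hy).2

theorem mem_of_forall_le_or_le (hF : IsMaxChainAbove x F) (hxc : x < c) (hc : c < ⊤)
    (h : ∀ y ∈ F, c ≤ y ∨ y ≤ c) : c ∈ F := by
  classical
  exact hF.le_of_ge (hF.prop.insert hxc hc h) (Finset.subset_insert _ _)
    (Finset.mem_insert_self _ _)

theorem exists_covBy (hF : IsMaxChainAbove x F) (hx : x < ⊤) (hx' : ¬ x ⋖ ⊤) :
    ∃ a ∈ F, x ⋖ a := by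
  have hne : F.Nonempty := by
    rw [Finset.nonempty_iff_ne_empty]
    rintro rfl
    obtain ⟨c, hxc, hc⟩ := exists_lt_lt_of_not_covBy hx hx'
    exact absurd (hF.mem_of_forall_le_or_le hxc hc (by simp)) (by simp)
  obtain ⟨a, ha, hmin⟩ := exists_least_of_isChain hF.prop.1 hne
  refine ⟨a, ha, (hF.prop.2 a ha).1, fun c hxc hca => ?_⟩
  have hc : c ∈ F := hF.mem_of_forall_le_or_le hxc (hca.trans (hF.prop.2 a ha).2) fun y hy =>
    .inl (hca.le.trans (hmin y hy))
  exact (hmin c hc).not_gt hca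

theorem erase [DecidableEq P] (hF : IsMaxChainAbove x F) (hxa : x ⋖ a) (ha : a ∈ F) :
    IsMaxChainAbove a (F.erase a) := by
  refine ⟨hF.prop.erase hxa ha, fun G hG hle y hy => ?_⟩
  have hsub : F ⊆ insert a G := Finset.subset_insert_iff.2 hle
  have hGF := hF.le_of_ge (hG.insert_bot hxa.lt (hF.prop.2 a ha).2) hsub
  exact Finset.mem_erase.2 ⟨(hG.2 y hy).1.ne', hGF (Finset.mem_insert_of_mem hy)⟩

theorem insert [DecidableEq P] (hF : IsMaxChainAbove a F) (hxa : x ⋖ a) (ha : a < ⊤) :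
    IsMaxChainAbove x (insert a F) := by
  refine ⟨hF.prop.insert_bot hxa.lt ha, fun G hG hle => ?_⟩
  obtain ⟨haG, hFG⟩ := Finset.insert_subset_iff.1 hle
  have hsub : F ⊆ G.erase a := fun w hw =>
    Finset.mem_erase.2 ⟨(hF.prop.2 w hw).1.ne', hFG hw⟩
  exact Finset.subset_insert_iff.2 (hF.le_of_ge (hG.erase hxa haG) hsub)

theorem card_add [Finite P] {ρ : P → ℕ} (hρ : ∀ a b : P, a ⋖ b → ρ b + 1 = ρ a)
    (hF : IsMaxChainAbove x F) (hx : x < ⊤) : F.card + 1 + ρ ⊤ = ρ x := by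
  classical
  induction x using (Finite.wellFounded_of_trans_of_irrefl (α := P) (· > ·)).induction
    generalizing F with
  | _ x ih =>
    by_cases hx' : x ⋖ ⊤
    · rw [hF.eq_empty hx', ← hρ _ _ hx', Finset.card_empty]
      ring
    · obtain ⟨a, ha, hxa⟩ := hF.exists_covBy hx hx'
      rw [← hρ _ _ hxa, ← ih a hxa.lt (hF.erase hxa ha) (hF.prop.2 a ha).2,
        ← Finset.card_erase_add_one ha]
      ring

theorem exists_le_inter (hE : IsMaxChainAbove x E) (hF : IsMaxChainAbove x F) (hxa : x ⋖ a)
    (hxb : x ⋖ b) (ha : a ∈ E) (hb : b ∈ F) (hab : a ≠ b) :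
    ∃ y, a < y ∧ b < y ∧ ∀ w ∈ F, w ∈ E → y ≤ w := by
  classical
  by_cases hne : (F ∩ E).Nonempty
  · obtain ⟨y, hy, hmin⟩ := exists_least_of_isChain (hF.prop.1.mono (by simp)) hne
    obtain ⟨hyF, hyE⟩ := Finset.mem_inter.1 hy
    refine ⟨y, (hE.prop.le_of_covBy hxa ha hyE).lt_of_ne ?_,
      (hF.prop.le_of_covBy hxb hb hyF).lt_of_ne ?_, fun w hwF hwE =>
      hmin w (Finset.mem_inter.2 ⟨hwF, hwE⟩)⟩
    · rintro rfl
      exact hab (hF.prop.eq_of_covBy hxa hxb hyF hb)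
    · rintro rfl
      exact hab (hE.prop.eq_of_covBy hxa hxb ha hyE)
  · exact ⟨⊤, (hE.prop.2 a ha).2, (hF.prop.2 b hb).2, fun w hwF hwE =>
      absurd ⟨w, Finset.mem_inter.2 ⟨hwF, hwE⟩⟩ hne⟩

end IsMaxChainAbove

end MaxChain

/-! ### Rankings of facets -/

/-- `F ∩ E` lies in a codimension one face `F \ {v}` of `F` that is contained in `E'`. -/
def HasRidge {V : Type*} (F E E' : Finset V) : Prop :=
  ∃ v ∈ F, v ∉ E ∧ ∀ w ∈ F, w ≠ v → w ∈ E'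

theorem HasRidge.insert_of_erase {V : Type*} [DecidableEq V] {F E E' E₂ : Finset V} {a : V}
    (h : HasRidge (F.erase a) E₂ E') (hE : ∀ w ∈ F, w ≠ a → w ∈ E → w ∈ E₂) :
    HasRidge F E (insert a E') := by
  obtain ⟨v, hv, hvE, hsub⟩ := h
  obtain ⟨hva, hvF⟩ := Finset.mem_erase.1 hv
  refine ⟨v, hvF, fun h => hvE (hE v hvF hva h), fun w hw hwv => ?_⟩
  by_cases hwa : w = a
  · exact hwa ▸ Finset.mem_insert_self _ _
  · exact Finset.mem_insert_of_mem (hsub w (Finset.mem_erase.2 ⟨hwa, hw⟩) hwv)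

/-- A function whose increasing order on the family `M` of facets is a shelling order. -/
structure IsShellingRank {V β : Type*} [LinearOrder β] (M : Set (Finset V)) (f : Finset V → β) :
    Prop where
  injOn : M.InjOn f
  exists_ridge : ∀ E ∈ M, ∀ F ∈ M, f E < f F → ∃ E' ∈ M, f E' < f F ∧ HasRidge F E E'

/-- A shelling, listed in reverse order. -/
inductive IsReverseShelling {V : Type*} : List (Finset V) → Prop
  | nil : IsReverseShelling []
  | cons (F : Finset V) (S : List (Finset V)) (hS : IsReverseShelling S)
      (h : ∀ E ∈ S, ∃ E' ∈ S, HasRidge F E E') : IsReverseShelling (F :: S)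

namespace IsShellingRank

variable {V β : Type*} [LinearOrder β] {M : Set (Finset V)} {f : Finset V → β}

theorem isReverseShelling (hf : IsShellingRank M f) {S : List (Finset V)}
    (hS : S.Pairwise fun E F => f F < f E) (hSM : ∀ F ∈ S, F ∈ M)
    (hlower : ∀ F ∈ S, ∀ E ∈ M, f E < f F → E ∈ S) : IsReverseShelling S := by
  induction S with
  | nil => exact .nil
  | cons F S ih =>
    rw [List.pairwise_cons] at hS
    rw [List.forall_mem_cons] at hSM
    have hlowerF : ∀ E ∈ M, f E < f F → E ∈ S := fun E hE hEF =>
      (List.mem_cons.1 (hlower F (by simp) E hE hEF)).resolve_left fun e => (e ▸ hEF).false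
    refine .cons F S (ih hS.2 hSM.2 fun G hG E hE hEG => hlowerF E hE (hEG.trans (hS.1 G hG)))
      fun E hE => ?_
    obtain ⟨E', hE', hlt, hridge⟩ := hf.exists_ridge E (hSM.2 E hE) F hSM.1 (hS.1 E hE)
    exact ⟨E', hlowerF E' hE' hlt, hridge⟩

theorem isShelling {K : AbstractSimplicialComplex V} (hf : IsShellingRank {F | K.IsFacet F} f)
    {l : List (Finset V)} (hl : l.Pairwise fun E F => f E < f F)
    (hmem : ∀ F, F ∈ l ↔ K.IsFacet F) : K.IsShelling l := by
  classical
  have hmono : StrictMono (f ∘ l.get) := fun i j hij => List.pairwise_iff_get.1 hl i j hij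
  refine ⟨hl.imp fun h => by rintro rfl; exact h.false, hmem, fun k _ G hG => ?_⟩
  obtain ⟨hGk, i, hik, hGi⟩ := hG.prop
  obtain ⟨E', hE', hlt, v, hv, hvi, hsub⟩ := hf.exists_ridge _ ((hmem _).1 (l.get_mem i)) _
    ((hmem _).1 (l.get_mem k)) (hmono hik)
  obtain ⟨j, rfl⟩ := List.mem_iff_get.1 ((hmem E').2 hE')
  have hGv : G ⊆ (l.get k).erase v := fun w hw =>
    Finset.mem_erase.2 ⟨fun e => hvi (e ▸ hGi hw), hGk hw⟩
  have hGmax := hG.le_of_ge (y := (l.get k).erase v)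
    ⟨Finset.erase_subset _ _, j, hmono.lt_iff_lt.1 hlt, fun w hw =>
      hsub w (Finset.mem_of_mem_erase hw) (Finset.ne_of_mem_erase hw)⟩ hGv
  rw [hGv.antisymm hGmax, Finset.card_erase_add_one hv]

theorem exists_isShelling [Finite V] {K : AbstractSimplicialComplex V}
    (hf : IsShellingRank {F | K.IsFacet F} f) :
    ∃ l, K.IsShelling l ∧ IsReverseShelling l.reverse := by
  obtain ⟨l, hl, hmem⟩ := exists_list_pairwise_lt (Set.toFinite {F | K.IsFacet F}) hf.injOn
  refine ⟨l, hf.isShelling hl hmem, hf.isReverseShelling (List.pairwise_reverse.2 hl)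
    (fun F hF => (hmem F).1 (List.mem_reverse.1 hF)) fun _ _ E hE _ => ?_⟩
  exact List.mem_reverse.2 ((hmem E).2 hE)

end IsShellingRank

/-! ### Recursive atom orderings give shellings -/

theorem exists_get_lt_of_pairwise {α : Type*} {l : List α} {p : α → Prop} {a b : α}
    (hl : l.Pairwise fun a b => p b → p a) (ha : a ∈ l) (hpa : p a) (hb : b ∈ l) (hpb : ¬ p b) :
    ∃ i j, i < j ∧ l.get i = a ∧ l.get j = b := by
  obtain ⟨i, rfl⟩ := List.mem_iff_get.1 ha
  obtain ⟨j, rfl⟩ := List.mem_iff_get.1 hb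
  refine ⟨i, j, lt_of_not_ge fun hji => ?_, rfl, rfl⟩
  rcases hji.eq_or_lt with rfl | hlt
  · exact hpb hpa
  · exact hpb (List.pairwise_iff_get.1 hl j i hlt hpa)

section Rank

variable {P : Type*} [PartialOrder P] [OrderTop P] {x : P} {l : List P}

/-- The ranking `f` of the maximal chains of `(x, ⊤)` compares first the positions of their atoms in
the list `l`. -/
def RanksByAtom (x : P) (l : List P) (f : Finset P → List ℕ) : Prop :=
  ∀ E F, IsMaxChainAbove x E → IsMaxChainAbove x F → ∀ i j : Fin l.length, i < j →
    l.get i ∈ E → l.get j ∈ F → f E < f F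

/-- The ranking `f` of the maximal chains of `(x, ⊤)` compares first the positions of their atoms in
the list `l`, and chains with the same atom `aⱼ` by the ranking `g j` of the maximal chains of
`(aⱼ, ⊤)`. -/
def IsConsRank [DecidableEq P] (x : P) (l : List P) (g : Fin l.length → Finset P → List ℕ)
    (f : Finset P → List ℕ) : Prop :=
  ∀ F, IsMaxChainAbove x F → ∀ j, l.get j ∈ F → f F = j.val :: g j (F.erase (l.get j))

theorem exists_isConsRank [DecidableEq P] (hl : l.Nodup) (hatom : ∀ j : Fin l.length, x ⋖ l.get j)
    (g : Fin l.length → Finset P → List ℕ) : ∃ f, IsConsRank x l g f := by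
  let f : Finset P → List ℕ := fun F =>
    if h : ∃ j, l.get j ∈ F then h.choose.val :: g h.choose (F.erase (l.get h.choose)) else []
  refine ⟨f, fun F hF j hj => ?_⟩
  have h : ∃ j, l.get j ∈ F := ⟨j, hj⟩
  have hchoose : h.choose = j := hl.injective_get
    (hF.prop.eq_of_covBy (hatom _) (hatom j) h.choose_spec hj)
  simp only [f, dif_pos h]
  rw [hchoose]

theorem IsConsRank.ranksByAtom [DecidableEq P] {g : Fin l.length → Finset P → List ℕ}
    {f : Finset P → List ℕ} (hf : IsConsRank x l g f) : RanksByAtom x l f := by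
  intro E F hE hF i j hij hi hj
  rw [hf E hE i hi, hf F hF j hj]
  exact List.cons_lt_cons_iff.2 (.inl hij)

theorem IsConsRank.exists_ridge [DecidableEq P] {g : Fin l.length → Finset P → List ℕ}
    {f : Finset P → List ℕ} (hf : IsConsRank x l g f) {E E₂ F : Finset P} {j : Fin l.length}
    (hg : IsShellingRank {F | IsMaxChainAbove (l.get j) F} (g j)) (hj : x ⋖ l.get j)
    (hF : IsMaxChainAbove x F) (hjF : l.get j ∈ F) (hE₂ : IsMaxChainAbove (l.get j) E₂)
    (hlt : g j E₂ < g j (F.erase (l.get j))) (hE : ∀ w ∈ F, w ≠ l.get j → w ∈ E → w ∈ E₂) :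
    ∃ E', IsMaxChainAbove x E' ∧ f E' < f F ∧ HasRidge F E E' := by
  obtain ⟨E', hE', hlt', hridge⟩ := hg.exists_ridge E₂ hE₂ _ (hF.erase hj hjF) hlt
  have hmax : IsMaxChainAbove x (insert (l.get j) E') :=
    IsMaxChainAbove.insert hE' hj (hF.prop.2 _ hjF).2
  refine ⟨_, hmax, ?_, hridge.insert_of_erase hE⟩
  rw [hf _ hmax j (Finset.mem_insert_self _ _), hf F hF j hjF,
    Finset.erase_insert hE'.prop.notMem]
  exact List.cons_lt_cons_iff.2 (.inr ⟨rfl, hlt'⟩)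

namespace IsRecursiveAtomOrdering

theorem lt_top (h : IsRecursiveAtomOrdering x l) : x < ⊤ := by
  cases h with
  | length_one _ hx => exact hx.lt
  | step _ _ hx => exact hx

theorem mem_iff_covBy (h : IsRecursiveAtomOrdering x l) (hx : ¬ x ⋖ ⊤) {a : P} :
    a ∈ l ↔ x ⋖ a := by
  cases h with
  | length_one _ hx' => exact absurd hx' hx
  | step _ _ _ _ _ mem_iff => exact mem_iff a

variable [Finite P]

/-- This is where both conditions of a recursive atom ordering enter: condition (ii) yields an atom
`z` of `[aⱼ, ⊤]` above an earlier atom and below `E ∩ F`, and by condition (i) it precedes the atom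
`b` of `[aⱼ, ⊤]` on the chain `F`. -/
theorem exists_rank_lt_of_exchange {L : List P} {a b z y : P} {early : P → Prop}
    {g : Finset P → List ℕ} {F : Finset P} (hL : IsRecursiveAtomOrdering a L)
    (hcov : ¬ a ⋖ ⊤) (hg : RanksByAtom a L g)
    (come_first : L.Pairwise fun z w => early w → early z) (hF : IsMaxChainAbove a F)
    (hb : b ∈ F) (hab : a ⋖ b) (hb' : ¬ early b) (haz : a ⋖ z) (hz : early z) (hzy : z ≤ y) :
    ∃ E, IsMaxChainAbove a E ∧ g E < g F ∧ ∀ w ∈ F, y ≤ w → w ∈ E := by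
  classical
  obtain ⟨s, t, hst, rfl, rfl⟩ := exists_get_lt_of_pairwise come_first
    ((hL.mem_iff_covBy hcov).2 haz) hz ((hL.mem_iff_covBy hcov).2 hab) hb'
  have hztop : L.get s < ⊤ := lt_top_iff_ne_top.2 fun e => hcov (e ▸ haz)
  have hC : IsChainAbove a (insert (L.get s) (F.filter (y ≤ ·))) :=
    (hF.prop.mono (Finset.filter_subset _ _)).insert haz.lt hztop fun w hw =>
      .inl (hzy.trans (Finset.mem_filter.1 hw).2)
  obtain ⟨E, hCE, hE⟩ := hC.exists_isMaxChainAbove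
  refine ⟨E, hE, hg E F hE hF s t hst (hCE (Finset.mem_insert_self _ _)) hb, fun w hw hyw => ?_⟩
  exact hCE (Finset.mem_insert_of_mem (Finset.mem_filter.2 ⟨hw, hyw⟩))

theorem exists_ridge_of_forall_lt [DecidableEq P] {E F : Finset P} {a b : P}
    (hF : IsMaxChainAbove x F) (hxa : x ⋖ a) (ha : a < ⊤) (hb : b ∈ F)
    (hbE : b ∉ E) (h : ∀ y ∈ F.erase b, a < y) :
    ∃ E', IsMaxChainAbove x E' ∧ a ∈ E' ∧ HasRidge F E E' := by
  have hC : IsChainAbove x (insert a (F.erase b)) :=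
    (hF.prop.mono (Finset.erase_subset _ _)).insert hxa.lt ha fun y hy => .inl (h y hy).le
  obtain ⟨E', hCE', hE'⟩ := hC.exists_isMaxChainAbove
  obtain ⟨haE', hFE'⟩ := Finset.insert_subset_iff.1 hCE'
  exact ⟨E', hE', haE', b, hb, hbE, fun w hw hwb => hFE' (Finset.mem_erase.2 ⟨hwb, hw⟩)⟩

theorem exists_ridge_of_atom_lt [DecidableEq P] {L : Fin l.length → List P}
    {g : Fin l.length → Finset P → List ℕ} {f : Finset P → List ℕ} {E F : Finset P}
    (hatom : ∀ j, x ⋖ l.get j) (hL : ∀ j, IsRecursiveAtomOrdering (l.get j) (L j))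
    (come_first : ∀ j, (L j).Pairwise fun z w =>
      (∃ i < j, l.get i ≤ w) → ∃ i < j, l.get i ≤ z)
    (exchange : ∀ i j, i < j → ∀ y, l.get i < y → l.get j < y →
      ∃ k < j, ∃ z, l.get j ⋖ z ∧ l.get k < z ∧ z ≤ y)
    (hg : ∀ j, IsShellingRank {F | IsMaxChainAbove (l.get j) F} (g j))
    (hgL : ∀ j, RanksByAtom (l.get j) (L j) (g j)) (hf : IsConsRank x l g f)
    (hE : IsMaxChainAbove x E) (hF : IsMaxChainAbove x F) {i j : Fin l.length} (hij : i < j)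
    (hi : l.get i ∈ E) (hj : l.get j ∈ F) (hne : l.get i ≠ l.get j) :
    ∃ E', IsMaxChainAbove x E' ∧ f E' < f F ∧ HasRidge F E E' := by
  by_cases hk : ∃ k < j, ∀ y ∈ F.erase (l.get j), l.get k < y
  · obtain ⟨k, hkj, hk⟩ := hk
    obtain ⟨E', hE', hkE', hridge⟩ := exists_ridge_of_forall_lt (E := E) hF (hatom k) (hL k).lt_top
      hj (fun h => hne (hE.prop.eq_of_covBy (hatom i) (hatom j) hi h)) hk
    exact ⟨E', hE', hf.ranksByAtom E' F hE' hF k j hkj hkE' hj, hridge⟩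
  · have hF' := hF.erase (hatom j) hj
    have hcov : ¬ l.get j ⋖ ⊤ := fun h => hk ⟨i, hij, fun y hy =>
      absurd hy (by rw [hF'.eq_empty h]; exact Finset.notMem_empty y)⟩
    obtain ⟨b, hb, hjb⟩ := hF'.exists_covBy (hL j).lt_top hcov
    have hb' : ¬ ∃ k < j, l.get k ≤ b := by
      rintro ⟨k, hkj, hkb⟩
      have hkb' : l.get k < b := hkb.lt_of_ne fun e => (e ▸ hatom k).2 (hatom j).lt hjb.lt
      exact hk ⟨k, hkj, fun y hy => hkb'.trans_le (hF'.prop.le_of_covBy hjb hb hy)⟩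
    obtain ⟨y, hiy, hjy, hy⟩ := hE.exists_le_inter hF (hatom i) (hatom j) hi hj hne
    obtain ⟨k, hkj, z, hjz, hkz, hzy⟩ := exchange i j hij y hiy hjy
    obtain ⟨E₂, hE₂, hlt, hFE₂⟩ := (hL j).exists_rank_lt_of_exchange hcov (hgL j) (come_first j)
      hF' hb hjb hb' hjz ⟨k, hkj, hkz.le⟩ hzy
    exact hf.exists_ridge (hg j) (hatom j) hF hj hE₂ hlt fun w hw hwj hwE =>
      hFE₂ w (Finset.mem_erase.2 ⟨hwj, hw⟩) (hy w hw hwE)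

theorem exists_rank (hl : IsRecursiveAtomOrdering x l) :
    ∃ f : Finset P → List ℕ, IsShellingRank {F | IsMaxChainAbove x F} f ∧ RanksByAtom x l f := by
  classical
  induction hl with
  | length_one x hx =>
    refine ⟨fun _ => [], ⟨fun E hE F hF _ => ?_, fun E _ F _ h => absurd h (by simp)⟩,
      fun E F _ _ i j hij => absurd hij (by simp [Fin.lt_def])⟩
    exact (IsMaxChainAbove.eq_empty hE hx).trans (IsMaxChainAbove.eq_empty hF hx).symm
  | step x l hx hx' nodup mem_iff L hL come_first exchange ih =>
    choose g hg hgL using ih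
    have hatom : ∀ j, x ⋖ l.get j := fun j => (mem_iff _).1 (l.get_mem j)
    obtain ⟨f, hf⟩ := exists_isConsRank nodup hatom g
    have hpos : ∀ F, IsMaxChainAbove x F → ∃ j, l.get j ∈ F := fun F hF => by
      obtain ⟨a, ha, hxa⟩ := hF.exists_covBy hx hx'
      obtain ⟨j, rfl⟩ := List.mem_iff_get.1 ((mem_iff a).2 hxa)
      exact ⟨j, ha⟩
    refine ⟨f, ⟨fun E hE F hF hEF => ?_, fun E hE F hF hlt => ?_⟩, hf.ranksByAtom⟩
    · obtain ⟨i, hi⟩ := hpos E hE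
      obtain ⟨j, hj⟩ := hpos F hF
      rw [hf E hE i hi, hf F hF j hj, List.cons.injEq, Fin.val_inj] at hEF
      obtain ⟨rfl, hEF⟩ := hEF
      rw [← Finset.insert_erase hi, ← Finset.insert_erase hj, (hg i).injOn
        (IsMaxChainAbove.erase hE (hatom i) hi) (IsMaxChainAbove.erase hF (hatom i) hj) hEF]
    · obtain ⟨i, hi⟩ := hpos E hE
      obtain ⟨j, hj⟩ := hpos F hF
      rw [hf E hE i hi, hf F hF j hj, List.cons_lt_cons_iff, Fin.val_inj, ← Fin.lt_def] at hlt
      rcases hlt with hij | ⟨rfl, hlt⟩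
      · exact exists_ridge_of_atom_lt hatom hL come_first exchange hg hgL hf hE hF hij hi hj
          fun e => hij.ne (nodup.injective_get e)
      · exact hf.exists_ridge (hg i) (hatom i) hF hj (IsMaxChainAbove.erase hE (hatom i) hi) hlt
          fun w _ hwi hwE => Finset.mem_erase.2 ⟨hwi, hwE⟩

end IsRecursiveAtomOrdering

end Rank

section Proper

variable {Q : Type*} [PartialOrder Q] [OrderTop Q]

/-- The proper part of a poset with top, inside the poset with a bottom adjoined. -/
def properEmbedding (Q : Type*) [PartialOrder Q] [OrderTop Q] :
    {q : Q // q ≠ ⊤} ↪o WithBot Q :=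
  (OrderEmbedding.subtype _).trans WithBot.coeOrderHom

theorem mem_range_properEmbedding {y : WithBot Q} :
    y ∈ Set.range (properEmbedding Q) ↔ ⊥ < y ∧ y < ⊤ := by
  constructor
  · rintro ⟨v, rfl⟩
    exact ⟨WithBot.bot_lt_coe _, WithBot.coe_lt_coe.2 (lt_top_iff_ne_top.2 v.2)⟩
  · rintro ⟨hbot, htop⟩
    lift y to Q using hbot.ne'
    exact ⟨⟨y, (WithBot.coe_lt_coe.1 htop).ne⟩, rfl⟩

theorem isChainAbove_bot_map_iff {F : Finset {q : Q // q ≠ ⊤}} :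
    IsChainAbove (⊥ : WithBot Q) (F.map (properEmbedding Q).toEmbedding) ↔
      IsChain (· ≤ ·) (F : Set {q : Q // q ≠ ⊤}) := by
  refine ⟨fun h a ha b hb _ => ?_, fun h => ⟨?_, fun y hy => ?_⟩⟩
  · simpa using h.1.total (Finset.mem_map_of_mem _ ha) (Finset.mem_map_of_mem _ hb)
  · rw [Finset.coe_map]
    rintro _ ⟨a, ha, rfl⟩ _ ⟨b, hb, rfl⟩ _
    simpa using h.total ha hb
  · obtain ⟨v, -, rfl⟩ := Finset.mem_map.1 hy
    exact mem_range_properEmbedding.1 ⟨v, rfl⟩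

theorem exists_map_properEmbedding_eq {G : Finset (WithBot Q)} (hG : IsChainAbove ⊥ G) :
    ∃ F : Finset {q : Q // q ≠ ⊤}, F.map (properEmbedding Q).toEmbedding = G := by
  classical
  have hrange : (G : Set (WithBot Q)) ⊆ properEmbedding Q '' Set.univ := fun y hy => by
    rw [Set.image_univ]
    exact mem_range_properEmbedding.2 (hG.2 y hy)
  obtain ⟨F, -, rfl⟩ := Finset.subset_set_image_iff.1 hrange
  exact ⟨F, Finset.map_eq_image _ _⟩

variable [Nonempty {q : Q // q ≠ ⊤}]

theorem isMaxChainAbove_bot_map_iff {F : Finset {q : Q // q ≠ ⊤}} :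
    IsMaxChainAbove (⊥ : WithBot Q) (F.map (properEmbedding Q).toEmbedding) ↔
      (orderComplex {q : Q // q ≠ ⊤}).IsFacet F := by
  constructor
  · intro h
    refine ⟨⟨?_, isChainAbove_bot_map_iff.1 h.prop⟩, fun G hG hle => ?_⟩
    · rw [Finset.nonempty_iff_ne_empty]
      rintro rfl
      obtain ⟨v⟩ := ‹Nonempty {q : Q // q ≠ ⊤}›
      have hv : IsChainAbove (⊥ : WithBot Q) (Finset.map (properEmbedding Q).toEmbedding {v}) :=
        isChainAbove_bot_map_iff.2 (by simp)
      simpa using h.le_of_ge hv (by simp)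
    · exact Finset.map_subset_map.1
        (h.le_of_ge (isChainAbove_bot_map_iff.2 hG.2) (Finset.map_subset_map.2 hle))
  · intro h
    refine ⟨isChainAbove_bot_map_iff.2 h.prop.2, fun G hG hle => ?_⟩
    obtain ⟨G, rfl⟩ := exists_map_properEmbedding_eq hG
    have hsub : F ⊆ G := Finset.map_subset_map.1 hle
    exact Finset.map_subset_map.2
      (h.le_of_ge ⟨h.prop.1.mono hsub, isChainAbove_bot_map_iff.1 hG⟩ hsub)

theorem IsRecursiveAtomOrdering.exists_isShelling [Finite Q] {l : List (WithBot Q)}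
    (h : IsRecursiveAtomOrdering (⊥ : WithBot Q) l) :
    ∃ l, (orderComplex {q : Q // q ≠ ⊤}).IsShelling l ∧ IsReverseShelling l.reverse := by
  obtain ⟨f, hf, -⟩ := h.exists_rank
  refine IsShellingRank.exists_isShelling (f := fun F => f (F.map (properEmbedding Q).toEmbedding))
    ⟨fun E hE F hF hEF => ?_, fun E hE F hF hEF => ?_⟩
  · exact Finset.map_injective _
      (hf.injOn (isMaxChainAbove_bot_map_iff.2 hE) (isMaxChainAbove_bot_map_iff.2 hF) hEF)
  · obtain ⟨E', hE', hlt, v, hv, hvE, hsub⟩ := hf.exists_ridge _ (isMaxChainAbove_bot_map_iff.2 hE)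
      _ (isMaxChainAbove_bot_map_iff.2 hF) hEF
    obtain ⟨E', rfl⟩ := exists_map_properEmbedding_eq (Maximal.prop hE')
    obtain ⟨v, hvF, rfl⟩ := Finset.mem_map.1 hv
    refine ⟨E', isMaxChainAbove_bot_map_iff.1 hE', hlt, v, hvF,
      fun hv' => hvE (Finset.mem_map_of_mem _ hv'), fun w hw hwv => ?_⟩
    simpa using hsub (properEmbedding Q w) (by simpa using hw) (by simpa using hwv)

end Proper

namespace EvenPartition

variable {n : ℕ}

theorem card_parts_of_isMin {π : EvenPartition n} (h : IsMin π) : π.1.parts.card = n := by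
  have hcard : ∀ B ∈ π.1.parts, B.card = 2 := fun B hB => by
    obtain ⟨a, ha⟩ := π.1.nonempty_of_mem_parts hB
    rw [← π.1.part_eq_of_mem hB ha, isMin_iff_card_part.1 h]
  have hsum := π.1.sum_card_parts
  rw [Finset.sum_congr rfl hcard, Finset.sum_const, Finset.card_univ, Fintype.card_fin,
    smul_eq_mul] at hsum
  omega

theorem exists_isMin_le (π : EvenPartition n) : ∃ μ, μ ≤ π ∧ IsMin μ := by
  obtain ⟨μ, hle, hμ⟩ := Set.Finite.exists_le_minimal
    (Set.toFinite (Set.univ : Set (EvenPartition n))) (Set.mem_univ π)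
  exact ⟨μ, hle, fun ρ hρ => hμ.le_of_le (Set.mem_univ ρ) hρ⟩

theorem card_parts_top (hn : 1 ≤ n) : (⊤ : EvenPartition n).1.parts.card = 1 := by
  have hsub : (⊤ : EvenPartition n).1.parts ⊆ {Finset.univ} :=
    Finpartition.parts_top_subset (Finset.univ : Finset (Fin (2 * n)))
  have hne : ((⊤ : EvenPartition n).1.parts).Nonempty :=
    ⟨_, (⊤ : EvenPartition n).1.part_mem.2 (Finset.mem_univ (⟨0, by omega⟩ : Fin (2 * n)))⟩
  exact le_antisymm (Finset.card_le_card hsub) hne.card_pos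

theorem card_of_isMaxChainAbove (hn : 1 ≤ n) {F : Finset (WithBot (EvenPartition n))}
    (hF : IsMaxChainAbove ⊥ F) : F.card + 1 = n := by
  let ρ : WithBot (EvenPartition n) → ℕ :=
    fun x => WithBot.recBotCoe (n + 1) (fun π : EvenPartition n => π.1.parts.card) x
  have hρ : ∀ a b, a ⋖ b → ρ b + 1 = ρ a := fun a b hab => by
    lift b to EvenPartition n using ne_bot_of_gt hab.lt
    induction a with
    | bot => exact congrArg (· + 1) (card_parts_of_isMin (WithBot.bot_covBy_coe.1 hab))
    | coe a => exact card_parts_covBy (WithBot.coe_covBy_coe.1 hab)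
  have hcard : F.card + 1 + ρ ⊤ = n + 1 := hF.card_add hρ (WithBot.bot_lt_coe _)
  rw [show ρ ⊤ = 1 from card_parts_top hn] at hcard
  exact Nat.add_right_cancel hcard

theorem nonempty_proper (hn : 2 ≤ n) : Nonempty (EvenPartitionProper n) := by
  obtain ⟨μ, -, hμ⟩ := exists_isMin_le (⊤ : EvenPartition n)
  refine ⟨⟨μ, ?_⟩⟩
  rintro rfl
  have htop := card_parts_top (n := n) (by omega)
  rw [card_parts_of_isMin hμ] at htop
  omega

theorem isEmpty_proper : IsEmpty (EvenPartitionProper 1) := by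
  refine ⟨fun π => ?_⟩
  obtain ⟨μ, hle, hμ⟩ := exists_isMin_le π.1
  have hlt := card_parts_lt (hle.trans_lt (lt_top_iff_ne_top.2 π.2))
  rw [card_parts_of_isMin hμ, card_parts_top le_rfl] at hlt
  exact hlt.false

theorem card_of_isFacet (hn : 2 ≤ n) {F : Finset (EvenPartitionProper n)}
    (hF : (orderComplex (EvenPartitionProper n)).IsFacet F) : F.card + 1 = n := by
  have := nonempty_proper hn
  have hcard := card_of_isMaxChainAbove (by omega) (isMaxChainAbove_bot_map_iff.2 hF)
  rwa [Finset.card_map] at hcard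

end EvenPartition

/-! ### Restrictions of facets -/

section Restriction

variable {V : Type*}

/-- The set `R` is the restriction of the facet `F` when `F` is attached to the facets in `S`: the
faces of `F` that are new are those that contain `R`. -/
def IsRestriction (F : Finset V) (S : List (Finset V)) (R : Finset V) : Prop :=
  R ⊆ F ∧ ∀ G ⊆ F, (∃ E ∈ S, G ⊆ E) ↔ ¬ R ⊆ G

theorem exists_isRestriction {F : Finset V} {S : List (Finset V)}
    (h : ∀ E ∈ S, ∃ E' ∈ S, HasRidge F E E') : ∃ R, IsRestriction F S R := by
  classical
  refine ⟨F.filter fun v => ∃ E ∈ S, ∀ w ∈ F, w ≠ v → w ∈ E, Finset.filter_subset _ _,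
    fun G hG => ⟨?_, fun hR => ?_⟩⟩
  · rintro ⟨E, hE, hGE⟩ hR
    obtain ⟨E', hE', v, hv, hvE, hsub⟩ := h E hE
    exact hvE (hGE (hR (Finset.mem_filter.2 ⟨hv, E', hE', hsub⟩)))
  · obtain ⟨v, hv, hvG⟩ := Finset.not_subset.1 hR
    obtain ⟨-, E, hE, hsub⟩ := Finset.mem_filter.1 hv
    exact ⟨E, hE, fun w hwG => hsub w (hG hwG) fun e => hvG (e ▸ hwG)⟩

theorem IsRestriction.nonempty {F R : Finset V} {S : List (Finset V)} (hR : IsRestriction F S R)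
    (hS : S ≠ []) : R.Nonempty := by
  rw [Finset.nonempty_iff_ne_empty]
  rintro rfl
  obtain ⟨E, hE⟩ := List.exists_mem_of_ne_nil S hS
  exact (hR.2 ∅ (Finset.empty_subset _)).1 ⟨E, hE, Finset.empty_subset _⟩ (Finset.empty_subset _)

theorem sum_Icc_neg_one_pow_card [DecidableEq V] {R F : Finset V} (h : R ⊂ F) :
    ∑ G ∈ Finset.Icc R F, (-1 : ℤ) ^ G.card = 0 := by
  have hdisj : ∀ T ∈ (F \ R).powerset, Disjoint R T := fun T hT =>
    Finset.disjoint_sdiff.mono_right (Finset.mem_powerset.1 hT)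
  rw [Finset.Icc_eq_image_powerset h.subset, Finset.sum_image]
  · calc ∑ T ∈ (F \ R).powerset, (-1 : ℤ) ^ (R ∪ T).card
      _ = ∑ T ∈ (F \ R).powerset, (-1 : ℤ) ^ R.card * (-1) ^ T.card :=
        Finset.sum_congr rfl fun T hT => by
          rw [Finset.card_union_of_disjoint (hdisj T hT), pow_add]
      _ = 0 := by
        rw [← Finset.mul_sum, Finset.sum_powerset_neg_one_pow_card_of_nonempty
          (Finset.sdiff_nonempty.2 h.not_subset), mul_zero]
  · intro T hT T' hT' hTT'
    rw [← Finset.union_sdiff_cancel_left (hdisj T hT),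
      ← Finset.union_sdiff_cancel_left (hdisj T' hT')]
    exact congrArg (· \ R) hTT'

end Restriction

/-! ### Pushing masses -/

section PushMass

variable {V : Type*} [DecidableEq V]

/-- Take the fraction `t` of the smallest of the masses `w v`, `v ∈ R`, away from each vertex of `R`
and add it to the vertex `u`. -/
def pushMass (R : Finset V) (hR : R.Nonempty) (u : V) (t : ℝ) (w : V → ℝ) : V → ℝ := fun v =>
  w v + t * R.inf' hR w * ((if v = u then (R.card : ℝ) else 0) - if v ∈ R then 1 else 0)

theorem continuous_pushMass (R : Finset V) (hR : R.Nonempty) (u : V) :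
    Continuous fun p : ℝ × (V → ℝ) => pushMass R hR u p.1 p.2 := by
  refine continuous_pi fun v => ?_
  unfold pushMass
  exact ((continuous_apply v).comp continuous_snd).add <|
    (continuous_fst.mul (Continuous.finset_inf'_apply hR fun i _ =>
      (continuous_apply i).comp continuous_snd)).mul continuous_const

theorem pushMass_eq_zero {R : Finset V} {u v : V} {t : ℝ} {w : V → ℝ} (hR : R.Nonempty)
    (hvu : v ≠ u) (hvR : v ∉ R) (hv : w v = 0) : pushMass R hR u t w v = 0 := by
  simp [pushMass, hvu, hvR, hv]

end PushMass

/-! ### Realizations of families of faces -/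

section Realization

variable {V : Type*} [Fintype V] {A : Finset (Finset V)} {w : V → ℝ}

/-- The points of the standard simplex that are supported on a member of `A`. -/
def faceRealization (A : Finset (Finset V)) : Set (V → ℝ) :=
  {w | w ∈ stdSimplex ℝ V ∧ ∃ s ∈ A, ∀ v ∉ s, w v = 0}

theorem realization_eq_faceRealization {K : AbstractSimplicialComplex V}
    (hA : ∀ s : Finset V, s.Nonempty → (s ∈ A ↔ s ∈ K)) : K.realization = faceRealization A := by
  ext w
  have hsum : ∀ s : Finset V, (∀ v ∉ s, w v = 0) → ∑ v ∈ s, w v = ∑ v, w v := fun s hs =>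
    Finset.sum_subset (Finset.subset_univ s) fun v _ hv => hs v hv
  constructor
  · rintro ⟨hnonneg, s, hs, hsupp, hone⟩
    exact ⟨⟨hnonneg, by rw [← hsum s hsupp, hone]⟩, s,
      (hA s (K.isRelLowerSet_faces hs).1).2 hs, hsupp⟩
  · rintro ⟨⟨hnonneg, hone⟩, s, hs, hsupp⟩
    have hone_s := (hsum s hsupp).trans hone
    have hne : s.Nonempty := Finset.nonempty_of_sum_ne_zero (hone_s ▸ one_ne_zero)
    exact ⟨hnonneg, s, (hA s hne).1 hs, hsupp, hone_s⟩

theorem isClosed_faceRealization (A : Finset (Finset V)) : IsClosed (faceRealization A) := by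
  have hunion : faceRealization A = stdSimplex ℝ V ∩ ⋃ s ∈ A, ⋂ v, ⋂ _ : v ∉ s, {w | w v = 0} := by
    ext w
    simp [faceRealization]
  rw [hunion]
  refine (isClosed_stdSimplex ℝ V).inter (Set.Finite.isClosed_biUnion A.finite_toSet fun s _ => ?_)
  exact isClosed_iInter fun v => isClosed_iInter fun _ =>
    isClosed_eq (continuous_apply v) continuous_const

theorem isCompact_faceRealization (A : Finset (Finset V)) : IsCompact (faceRealization A) :=
  (isCompact_stdSimplex ℝ V).of_isClosed_subset (isClosed_faceRealization A) fun _ hw => hw.1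

theorem faceRealization_mono {A A' : Finset (Finset V)} (h : A ⊆ A') :
    faceRealization A ⊆ faceRealization A' :=
  fun _ hw => ⟨hw.1, hw.2.imp fun _ hs => ⟨h hs.1, hs.2⟩⟩

theorem contractibleSpace_faceRealization_powerset {F : Finset V} (hF : F.Nonempty) :
    ContractibleSpace (faceRealization F.powerset) := by
  classical
  have heq : faceRealization F.powerset = stdSimplex ℝ V ∩ {w | ∀ v ∉ F, w v = 0} := by
    ext w
    refine and_congr_right fun _ => ⟨?_, fun h => ⟨F, Finset.mem_powerset_self F, h⟩⟩
    rintro ⟨s, hs, hsupp⟩ v hv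
    exact hsupp v fun hvs => hv (Finset.mem_powerset.1 hs hvs)
  rw [heq]
  have hconv : Convex ℝ {w : V → ℝ | ∀ v ∉ F, w v = 0} := by
    intro w hw w' hw' a b _ _ _ v hv
    simp [hw v hv, hw' v hv]
  obtain ⟨u, hu⟩ := hF
  refine ((convex_stdSimplex ℝ V).inter hconv).contractibleSpace
    ⟨Pi.single u 1, single_mem_stdSimplex ℝ u, fun v hv => Pi.single_eq_of_ne ?_ _⟩
  rintro rfl
  exact hv hu

/-! ### Elementary collapses -/

theorem contractibleSpace_of_deformation {X : Type*} [TopologicalSpace X] {S T : Set X}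
    [ContractibleSpace S] (hST : S ⊆ T) {h : ℝ × X → X} (hh : Continuous h)
    (h_mem : ∀ t ∈ unitInterval, ∀ x ∈ T, h (t, x) ∈ T) (h_zero : ∀ x, h (0, x) = x)
    (h_one : ∀ x ∈ T, h (1, x) ∈ S) (h_fix : ∀ x ∈ S, h (1, x) = x) : ContractibleSpace T := by
  let i : C(S, T) := ⟨Set.inclusion hST, continuous_inclusion _⟩
  let r : C(T, S) := ⟨fun x => ⟨h (1, x.1), h_one x.1 x.2⟩,
    (hh.comp (continuous_const.prodMk continuous_subtype_val)).subtype_mk _⟩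
  let H : (ContinuousMap.id T).Homotopy (i.comp r) :=
    { toFun := fun p => ⟨h (p.1, p.2.1), h_mem _ p.1.2 _ p.2.2⟩
      continuous_toFun := (hh.comp ((continuous_subtype_val.comp continuous_fst).prodMk
        (continuous_subtype_val.comp continuous_snd))).subtype_mk _
      map_zero_left := fun x => Subtype.ext (h_zero x.1)
      map_one_left := fun _ => rfl }
  have hri : r.comp i = ContinuousMap.id S := by
    ext1 x
    exact Subtype.ext (h_fix x.1 x.2)
  exact ContinuousMap.HomotopyEquiv.contractibleSpace
    { toFun := r, invFun := i, left_inv := ⟨H.symm⟩, right_inv := by rw [hri] }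

variable [DecidableEq V] {R F : Finset V} {u v : V} {t : ℝ}

theorem pushMass_mem_stdSimplex (hR : R.Nonempty) (hu : u ∉ R) (ht : t ∈ unitInterval)
    (hw : w ∈ stdSimplex ℝ V) : pushMass R hR u t w ∈ stdSimplex ℝ V := by
  have hinf : 0 ≤ R.inf' hR w := (Finset.le_inf'_iff hR w).2 fun v _ => hw.1 v
  refine ⟨fun v => ?_, ?_⟩
  · unfold pushMass
    by_cases hvR : v ∈ R
    · have hvu : v ≠ u := fun e => hu (e ▸ hvR)
      have hle : t * R.inf' hR w ≤ 1 * w v :=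
        mul_le_mul ht.2 (Finset.inf'_le w hvR) hinf zero_le_one
      simp only [hvu, hvR, if_true, if_false]
      linarith
    · simp only [hvR, if_false, sub_zero]
      refine add_nonneg (hw.1 v) (mul_nonneg (mul_nonneg ht.1 hinf) ?_)
      split_ifs <;> positivity
  · unfold pushMass
    rw [Finset.sum_add_distrib, ← Finset.mul_sum, Finset.sum_sub_distrib, hw.2]
    simp

theorem pushMass_eq_self (hR : R.Nonempty) (hA : IsLowerSet (A : Set (Finset V))) (hRA : R ∉ A)
    (hw : w ∈ faceRealization A) : pushMass R hR u t w = w := by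
  obtain ⟨hw, s, hs, hsupp⟩ := hw
  obtain ⟨v, hv, hvs⟩ := Finset.not_subset.1 fun h => hRA (hA h hs)
  have hinf : R.inf' hR w = 0 := le_antisymm (hsupp v hvs ▸ Finset.inf'_le w hv)
    ((Finset.le_inf'_iff hR w).2 fun v _ => hw.1 v)
  funext v
  simp [pushMass, hinf]

theorem pushMass_mem_union (hR : R.Nonempty) (hRF : R ⊆ F) (huF : u ∈ F) (huR : u ∉ R)
    (hA : IsLowerSet (A : Set (Finset V))) (hRA : R ∉ A) (ht : t ∈ unitInterval)
    (hw : w ∈ faceRealization (A ∪ Finset.Icc R F)) :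
    pushMass R hR u t w ∈ faceRealization (A ∪ Finset.Icc R F) := by
  obtain ⟨hw, s, hs, hsupp⟩ := hw
  rcases Finset.mem_union.1 hs with hsA | hsRF
  · rw [pushMass_eq_self hR hA hRA ⟨hw, s, hsA, hsupp⟩]
    exact ⟨hw, s, hs, hsupp⟩
  · refine ⟨pushMass_mem_stdSimplex hR huR ht hw, F, by simp [hRF], fun v hv => ?_⟩
    exact pushMass_eq_zero hR (fun e => hv (e ▸ huF)) (fun h => hv (hRF h))
      (hsupp v fun h => hv ((Finset.mem_Icc.1 hsRF).2 h))

/-- At time `1` the vertex of `R` of smallest mass has lost its mass, so the point has moved to the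
face `F \ {v}`. -/
theorem pushMass_one_mem (hR : R.Nonempty) (hRF : R ⊆ F) (huF : u ∈ F) (huR : u ∉ R)
    (hA : IsLowerSet (A : Set (Finset V))) (hRA : R ∉ A) (hbd : ∀ v ∈ R, F.erase v ∈ A)
    (hw : w ∈ faceRealization (A ∪ Finset.Icc R F)) :
    pushMass R hR u 1 w ∈ faceRealization A := by
  obtain ⟨hw, s, hs, hsupp⟩ := hw
  rcases Finset.mem_union.1 hs with hsA | hsRF
  · rw [pushMass_eq_self hR hA hRA ⟨hw, s, hsA, hsupp⟩]
    exact ⟨hw, s, hsA, hsupp⟩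
  · obtain ⟨v₀, hv₀, hmin⟩ := Finset.exists_mem_eq_inf' hR w
    refine ⟨pushMass_mem_stdSimplex hR huR unitInterval.one_mem hw, F.erase v₀, hbd v₀ hv₀,
      fun v hv => ?_⟩
    by_cases hvv₀ : v = v₀
    · subst hvv₀
      have hvu : v ≠ u := fun e => huR (e ▸ hv₀)
      simp [pushMass, hvu, hv₀, hmin]
    · have hvF : v ∉ F := fun h => hv (Finset.mem_erase.2 ⟨hvv₀, h⟩)
      exact pushMass_eq_zero hR (fun e => hvF (e ▸ huF)) (fun h => hvF (hRF h))
        (hsupp v fun h => hvF ((Finset.mem_Icc.1 hsRF).2 h))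

theorem contractibleSpace_faceRealization_union (hR : R.Nonempty) (hRF : R ⊂ F)
    (hA : IsLowerSet (A : Set (Finset V))) (hRA : R ∉ A) (hbd : ∀ v ∈ R, F.erase v ∈ A)
    [ContractibleSpace (faceRealization A)] :
    ContractibleSpace (faceRealization (A ∪ Finset.Icc R F)) := by
  obtain ⟨u, huF, huR⟩ := Finset.exists_of_ssubset hRF
  exact contractibleSpace_of_deformation (faceRealization_mono Finset.subset_union_left)
    (continuous_pushMass R hR u)
    (fun t ht w => pushMass_mem_union hR hRF.subset huF huR hA hRA ht)
    (fun w => by funext v; simp [pushMass])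
    (fun w => pushMass_one_mem hR hRF.subset huF huR hA hRA hbd)
    (fun w => pushMass_eq_self hR hA hRA)

/-! ### The structure of shellable complexes -/

/-- The complex with facets `S`, all of them with `c` vertices, is decomposed into a contractible
subcomplex `A` and a set `B` of facets whose boundaries lie in `A`. The empty set counts as a
face. -/
structure IsContractibleDecomposition (S : List (Finset V)) (c : ℕ) (A B : Finset (Finset V)) :
    Prop where
  disjoint : Disjoint A B
  mem_union_iff : ∀ G, G ∈ A ∪ B ↔ ∃ F ∈ S, G ⊆ F
  isLowerSet : IsLowerSet (A : Set (Finset V))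
  card_eq : ∀ F ∈ B, F.card = c
  erase_mem : ∀ F ∈ B, ∀ v ∈ F, F.erase v ∈ A
  contractibleSpace : ContractibleSpace (faceRealization A)
  sum_neg_one_pow_card : ∑ G ∈ A, (-1 : ℤ) ^ G.card = 0

theorem isContractibleDecomposition_singleton (hF : F.Nonempty) :
    IsContractibleDecomposition [F] F.card F.powerset ∅ where
  disjoint := Finset.disjoint_empty_right _
  mem_union_iff G := by simp
  isLowerSet _ _ hle hs := by
    rw [Finset.mem_coe, Finset.mem_powerset] at hs ⊢
    exact hle.trans hs
  card_eq := by simp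
  erase_mem := by simp
  contractibleSpace := contractibleSpace_faceRealization_powerset hF
  sum_neg_one_pow_card := Finset.sum_powerset_neg_one_pow_card_of_nonempty hF

namespace IsContractibleDecomposition

variable {S : List (Finset V)} {c : ℕ} {B : Finset (Finset V)} {G : Finset V}

theorem mem_of_ssubset (h : IsContractibleDecomposition S c A B) (hF : F.card = c)
    (hR : IsRestriction F S R) (hG : G ⊂ F) (hRG : ¬ R ⊆ G) : G ∈ A := by
  have hGAB : G ∈ A ∪ B := (h.mem_union_iff G).2 ((hR.2 G hG.subset).2 hRG)
  refine (Finset.mem_union.1 hGAB).resolve_right fun hGB => ?_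
  exact (Finset.card_lt_card hG).ne ((h.card_eq G hGB).trans hF.symm)

theorem erase_mem_of_mem (h : IsContractibleDecomposition S c A B) (hF : F.card = c)
    (hR : IsRestriction F S R) (hv : v ∈ R) : F.erase v ∈ A :=
  h.mem_of_ssubset hF hR (Finset.erase_ssubset (hR.1 hv)) fun hsub =>
    Finset.notMem_erase v F (hsub hv)

theorem disjoint_Icc (h : IsContractibleDecomposition S c A B) (hR : IsRestriction F S R) :
    Disjoint (A ∪ B) (Finset.Icc R F) := by
  refine Finset.disjoint_left.2 fun G hG hGRF => ?_
  obtain ⟨hRG, hGF⟩ := Finset.mem_Icc.1 hGRF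
  exact (hR.2 G hGF).1 ((h.mem_union_iff G).1 hG) hRG

theorem mem_union_Icc_iff (h : IsContractibleDecomposition S c A B) (hR : IsRestriction F S R) :
    G ∈ A ∪ B ∪ Finset.Icc R F ↔ ∃ E ∈ F :: S, G ⊆ E := by
  rw [Finset.mem_union, h.mem_union_iff, Finset.mem_Icc, List.exists_mem_cons_iff]
  constructor
  · rintro (hG | hG)
    exacts [.inr hG, .inl hG.2]
  · rintro (hGF | hG)
    · by_cases hRG : R ⊆ G
      exacts [.inr ⟨hRG, hGF⟩, .inl ((hR.2 G hGF).2 hRG)]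
    · exact .inl hG

theorem cons_of_restriction_eq (h : IsContractibleDecomposition S c A B) (hF : F.card = c)
    (hR : IsRestriction F S F) : IsContractibleDecomposition (F :: S) c A (insert F B) where
  disjoint := Finset.disjoint_insert_right.2 ⟨fun hFA =>
    Finset.disjoint_left.1 (h.disjoint_Icc hR) (Finset.mem_union_left _ hFA) (by simp), h.disjoint⟩
  mem_union_iff G := by
    rw [← h.mem_union_Icc_iff hR, Finset.Icc_self, Finset.union_assoc, Finset.union_singleton]
  isLowerSet := h.isLowerSet
  card_eq := Finset.forall_mem_insert _ _ _ |>.2 ⟨hF, h.card_eq⟩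
  erase_mem := Finset.forall_mem_insert _ _ _ |>.2
    ⟨fun _ hv => h.erase_mem_of_mem hF hR hv, h.erase_mem⟩
  contractibleSpace := h.contractibleSpace
  sum_neg_one_pow_card := h.sum_neg_one_pow_card

theorem cons_of_restriction_ssubset (h : IsContractibleDecomposition S c A B) (hF : F.card = c)
    (hR : IsRestriction F S R) (hRne : R.Nonempty) (hRF : R ⊂ F) :
    IsContractibleDecomposition (F :: S) c (A ∪ Finset.Icc R F) B where
  disjoint := Finset.disjoint_union_left.2 ⟨h.disjoint,
    ((h.disjoint_Icc hR).mono_left Finset.subset_union_right).symm⟩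
  mem_union_iff G := by rw [← h.mem_union_Icc_iff hR, Finset.union_right_comm]
  isLowerSet s s' hle hs := by
    rw [Finset.mem_coe, Finset.mem_union] at hs ⊢
    rcases hs with hs | hs
    · exact .inl (h.isLowerSet hle hs)
    · have hs'F : s' ⊆ F := Finset.Subset.trans hle (Finset.mem_Icc.1 hs).2
      by_cases hRs : R ⊆ s'
      · exact .inr (Finset.mem_Icc.2 ⟨hRs, hs'F⟩)
      · refine .inl (h.mem_of_ssubset hF hR (hs'F.ssubset_of_ne ?_) hRs)
        rintro rfl
        exact hRs hRF.subset
  card_eq := h.card_eq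
  erase_mem E hE v hv := Finset.mem_union_left _ (h.erase_mem E hE v hv)
  contractibleSpace := by
    have := h.contractibleSpace
    refine contractibleSpace_faceRealization_union hRne hRF h.isLowerSet (fun hRA => ?_)
      fun v hv => h.erase_mem_of_mem hF hR hv
    exact Finset.disjoint_left.1 (h.disjoint_Icc hR) (Finset.mem_union_left _ hRA)
      (Finset.left_mem_Icc.2 hRF.subset)
  sum_neg_one_pow_card := by
    rw [Finset.sum_union ((h.disjoint_Icc hR).mono_left Finset.subset_union_left),
      h.sum_neg_one_pow_card, sum_Icc_neg_one_pow_card hRF, add_zero]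

end IsContractibleDecomposition

theorem IsReverseShelling.exists_isContractibleDecomposition {S : List (Finset V)}
    (hS : IsReverseShelling S) {c : ℕ} (hc : 0 < c) (hne : S ≠ []) (hcard : ∀ F ∈ S, F.card = c) :
    ∃ A B, IsContractibleDecomposition S c A B := by
  induction hS with
  | nil => exact absurd rfl hne
  | cons F S _ h ih =>
    rw [List.forall_mem_cons] at hcard
    by_cases hS : S = []
    · subst hS
      rw [← hcard.1]
      exact ⟨_, _, isContractibleDecomposition_singleton (Finset.card_pos.1 (hcard.1 ▸ hc))⟩
    · obtain ⟨A, B, hAB⟩ := ih hS hcard.2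
      obtain ⟨R, hR⟩ := exists_isRestriction h
      rcases hR.1.eq_or_ssubset with rfl | hRF
      · exact ⟨_, _, hAB.cons_of_restriction_eq hcard.1 hR⟩
      · exact ⟨_, _, hAB.cons_of_restriction_ssubset hcard.1 hR (hR.nonempty hS) hRF⟩

end Realization

/-! ### Collapsing a contractible subspace -/

section Collapse

variable {X W : Type*} [TopologicalSpace X] [TopologicalSpace W]

theorem nonempty_homotopyEquiv_of_collapse [CompactSpace X] [T2Space W] (f : C(X, W))
    (hf : Function.Surjective f) {S : Set X} (hfib : ∀ x y, f x = f y → x = y ∨ (x ∈ S ∧ y ∈ S))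
    (hS : ∀ x ∈ S, ∀ y ∈ S, f x = f y) (H : C(unitInterval × X, X)) (H0 : ∀ x, H (0, x) = x)
    (HS : ∀ t, ∀ x ∈ S, H (t, x) ∈ S) (H1 : ∀ x ∈ S, ∀ y ∈ S, H (1, x) = H (1, y)) :
    Nonempty (X ≃ₕ W) := by
  have hq : Topology.IsQuotientMap f := f.continuous.isClosedMap.isQuotientMap f.continuous hf
  let F : C(unitInterval × X, unitInterval × W) := (ContinuousMap.id _).prodMap f
  have hF : Topology.IsQuotientMap F := F.continuous.isClosedMap.isQuotientMap F.continuous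
    (Function.surjective_id.prodMap hf)
  let h₁ : C(X, X) := H.comp ((ContinuousMap.const X 1).prodMk (ContinuousMap.id X))
  have hg : Function.FactorsThrough h₁ f := by
    intro x y hxy
    rcases hfib x y hxy with rfl | ⟨hx, hy⟩
    exacts [rfl, H1 x hx y hy]
  let g : C(W, X) := hq.lift h₁ hg
  have hgf : ∀ x, g (f x) = H (1, x) := fun x => DFunLike.congr_fun (hq.lift_comp h₁ hg) x
  have hk : Function.FactorsThrough (f.comp H) F := by
    rintro ⟨t, x⟩ ⟨t', y⟩ hxy
    obtain ⟨rfl, h⟩ : t = t' ∧ f x = f y := Prod.ext_iff.1 hxy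
    rcases hfib x y h with rfl | ⟨hx, hy⟩
    exacts [rfl, hS _ (HS t x hx) _ (HS t y hy)]
  let k : C(unitInterval × W, W) := hF.lift (f.comp H) hk
  have hkF : ∀ t x, k (t, f x) = f (H (t, x)) := fun t x =>
    DFunLike.congr_fun (hF.lift_comp (f.comp H) hk) (t, x)
  let HX : (ContinuousMap.id X).Homotopy (g.comp f) :=
    { toContinuousMap := H
      map_zero_left := H0
      map_one_left := fun x => (hgf x).symm }
  let HW : (ContinuousMap.id W).Homotopy (f.comp g) :=
    { toContinuousMap := k
      map_zero_left := hf.forall.2 fun x => (hkF 0 x).trans (congrArg f (H0 x))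
      map_one_left := hf.forall.2 fun x => (hkF 1 x).trans (congrArg f (hgf x).symm) }
  exact ⟨{ toFun := f, invFun := g, left_inv := ⟨HX.symm⟩, right_inv := ⟨HW.symm⟩ }⟩

theorem exists_contraction (S : Set X) [ContractibleSpace S] :
    ∃ (x₀ : X) (k : ℝ × X → X), ContinuousOn k (Set.univ ×ˢ S) ∧ ∀ x ∈ S,
      k (0, x) = x ∧ k (1, x) = x₀ ∧ ∀ t, k (t, x) ∈ S := by
  classical
  obtain ⟨x₀, ⟨c⟩⟩ := id_nullhomotopic S
  let k : ℝ × X → X := fun p =>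
    if hx : p.2 ∈ S then (c (Set.projIcc 0 1 zero_le_one p.1, ⟨p.2, hx⟩) : S).1 else p.2
  have hk : ∀ t x (hx : x ∈ S), k (t, x) = (c (Set.projIcc 0 1 zero_le_one t, ⟨x, hx⟩) : S).1 :=
    fun t x hx => dif_pos hx
  refine ⟨x₀, k, ?_, fun x hx => ⟨?_, ?_, fun t => ?_⟩⟩
  · rw [continuousOn_iff_continuous_domRestrict]
    have hrestrict : Set.domRestrict (Set.univ ×ˢ S) k = fun p =>
        (c (Set.projIcc 0 1 zero_le_one p.1.1, ⟨p.1.2, p.2.2⟩) : S).1 := by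
      funext p
      exact hk _ _ p.2.2
    rw [hrestrict]
    refine continuous_subtype_val.comp (c.continuous.comp (Continuous.prodMk ?_ ?_))
    · exact continuous_projIcc.comp (continuous_fst.comp continuous_subtype_val)
    · exact (continuous_snd.comp continuous_subtype_val).subtype_mk _
  · rw [hk 0 x hx, Set.projIcc_left]
    exact congrArg Subtype.val (c.apply_zero ⟨x, hx⟩)
  · rw [hk 1 x hx, Set.projIcc_right]
    exact congrArg Subtype.val (c.apply_one ⟨x, hx⟩)
  · rw [hk t x hx]
    exact (c _).2

/-- The map `e` expands a collar of `S` onto `S`, and `s` measures how far a point has been pushed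
into `S`; a contraction of `S` is run up to the time `s`. -/
theorem exists_homotopy_of_expansion (S : Set X) [ContractibleSpace S] (e : C(unitInterval × X, X))
    (s : C(unitInterval × X, ℝ)) (h : ∀ p, 0 ≤ s p → e p ∈ S) (he0 : ∀ x, e (0, x) = x)
    (hs0 : ∀ x, s (0, x) ≤ 0) (heS : ∀ t, ∀ x ∈ S, e (t, x) = x)
    (hsS : ∀ (t : unitInterval), ∀ x ∈ S, s (t, x) = t) :
    ∃ H : C(unitInterval × X, X), (∀ x, H (0, x) = x) ∧ (∀ t, ∀ x ∈ S, H (t, x) ∈ S) ∧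
      ∀ x ∈ S, ∀ y ∈ S, H (1, x) = H (1, y) := by
  classical
  obtain ⟨x₀, k, hk, hkS⟩ := exists_contraction S
  have hcont : Continuous fun p => if s p ≤ 0 then e p else k (s p, e p) := by
    refine continuous_if_le s.continuous continuous_const e.continuous.continuousOn ?_ ?_
    · exact hk.comp (s.continuous.prodMk e.continuous).continuousOn fun p hp =>
        ⟨Set.mem_univ _, h p hp⟩
    · intro p hp
      rw [hp, (hkS _ (h p hp.ge)).1]
  have hone : ∀ x ∈ S, (if s (1, x) ≤ 0 then e (1, x) else k (s (1, x), e (1, x))) = x₀ := by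
    intro x hx
    rw [heS 1 x hx, hsS 1 x hx, Set.Icc.coe_one, if_neg (by norm_num), (hkS x hx).2.1]
  refine ⟨⟨_, hcont⟩, fun x => ?_, fun t x hx => ?_,
    fun x hx y hy => (hone x hx).trans (hone y hy).symm⟩
  · simp [hs0, he0]
  · simp only [ContinuousMap.coe_mk, heS t x hx]
    split_ifs
    exacts [hx, (hkS x hx).2.2 _]

end Collapse

/-! ### Wedges of spheres -/

section Wedge

variable {r d : ℕ}

theorem sphereBase_mem (d : ℕ) :
    sphereBase (d + 1) ∈ Metric.sphere (0 : EuclideanSpace ℝ (Fin (d + 1))) 1 := by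
  rw [mem_sphere_zero_iff_norm, EuclideanSpace.norm_eq, Real.sqrt_eq_one]
  simp [sphereBase]

/-- The retraction of a wedge of spheres onto its `i`-th sphere, which sends the other spheres to
the base point. A point of the wedge is determined by its images under all of these. -/
def wedgeCoord (r d : ℕ) (i : Fin r) :
    SphereWedge r (d + 1) → Metric.sphere (0 : EuclideanSpace ℝ (Fin (d + 1))) 1 :=
  Quotient.lift (fun x => if x.1 = i then x.2 else ⟨_, sphereBase_mem d⟩) (by
    rintro ⟨j, x⟩ ⟨j', y⟩ (h | ⟨h, h'⟩)
    · rw [h]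
    · have hx : x = ⟨_, sphereBase_mem d⟩ := Subtype.ext h
      have hy : y = ⟨_, sphereBase_mem d⟩ := Subtype.ext h'
      simp [hx, hy])

theorem wedgeCoord_mk (i j : Fin r)
    (x : Metric.sphere (0 : EuclideanSpace ℝ (Fin (d + 1))) 1) :
    wedgeCoord r d i (Quotient.mk _ (j, x)) = if j = i then x else ⟨_, sphereBase_mem d⟩ := rfl

theorem continuous_wedgeCoord (i : Fin r) : Continuous (wedgeCoord r d i) := by
  refine continuous_quot_lift _ (continuous_prod_of_discrete_left.2 fun j => ?_)
  by_cases h : j = i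
  · simpa [h] using continuous_id'
  · simpa [h] using continuous_const

theorem wedgeCoord_injective :
    Function.Injective fun (x : SphereWedge r (d + 1)) i => wedgeCoord r d i x := by
  rintro ⟨i, x⟩ ⟨j, y⟩ h
  have hi := congrFun h i
  have hj := congrFun h j
  change wedgeCoord r d i (Quotient.mk _ _) = wedgeCoord r d i (Quotient.mk _ _) at hi
  change wedgeCoord r d j (Quotient.mk _ _) = wedgeCoord r d j (Quotient.mk _ _) at hj
  rw [wedgeCoord_mk, wedgeCoord_mk] at hi hj
  by_cases hij : i = j
  · subst hij
    rw [if_pos rfl, if_pos rfl] at hi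
    rw [hi]
  · rw [if_pos rfl, if_neg (Ne.symm hij)] at hi
    rw [if_pos rfl, if_neg hij] at hj
    exact Quotient.sound (Or.inr ⟨congrArg Subtype.val hi, congrArg Subtype.val hj.symm⟩)

theorem continuous_wedgeCoords :
    Continuous fun (x : SphereWedge r (d + 1)) i => wedgeCoord r d i x :=
  continuous_pi continuous_wedgeCoord

instance (r d : ℕ) : T2Space (SphereWedge r (d + 1)) :=
  T2Space.of_injective_continuous wedgeCoord_injective continuous_wedgeCoords

theorem continuous_of_wedgeCoord {X : Type*} [TopologicalSpace X] {f : X → SphereWedge r (d + 1)}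
    (hf : ∀ i, Continuous fun x => wedgeCoord r d i (f x)) : Continuous f :=
  (continuous_wedgeCoords.isClosedEmbedding wedgeCoord_injective).isEmbedding.continuous_iff.2
    (continuous_pi hf)

end Wedge

/-! ### Maps of simplices onto spheres -/

section Cell

variable {V : Type*} {d : ℕ} (ε : Fin (d + 1) → V)

/-- The smallest of the coordinates of `w` at the vertices `ε 0, …, ε d` of a simplex. On the
simplex it vanishes exactly on the boundary. -/
noncomputable def minCoord (w : V → ℝ) : ℝ :=
  Finset.univ.inf' Finset.univ_nonempty fun j => w (ε j)

theorem minCoord_le (w : V → ℝ) (j : Fin (d + 1)) : minCoord ε w ≤ w (ε j) :=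
  Finset.inf'_le (fun j => w (ε j)) (Finset.mem_univ j)

theorem exists_minCoord_eq (w : V → ℝ) : ∃ j, minCoord ε w = w (ε j) := by
  obtain ⟨j, -, hj⟩ := Finset.exists_mem_eq_inf' Finset.univ_nonempty fun j => w (ε j)
  exact ⟨j, hj⟩

theorem minCoord_nonneg {w : V → ℝ} (hw : ∀ v, 0 ≤ w v) : 0 ≤ minCoord ε w :=
  Finset.le_inf' _ _ fun _ _ => hw _

theorem minCoord_eq_zero {w : V → ℝ} (hw : ∀ v, 0 ≤ w v) {j : Fin (d + 1)} (h : w (ε j) = 0) :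
    minCoord ε w = 0 :=
  le_antisymm (h ▸ minCoord_le ε w j) (minCoord_nonneg ε hw)

theorem continuous_minCoord : Continuous (minCoord ε) :=
  Continuous.finset_inf'_apply _ fun j _ => continuous_apply (ε j)

/-- The denominator of `cellMap`. Its last term vanishes on the simplex spanned by the `ε j`; it
makes the denominator positive on all of `V → ℝ`. -/
noncomputable def cellDenom (w : V → ℝ) : ℝ :=
  minCoord ε w ^ 2 + ∑ j, (w (ε j) - w (ε 0)) ^ 2 + (1 - ∑ j, w (ε j)) ^ 2

theorem cellDenom_pos (w : V → ℝ) : 0 < cellDenom ε w := by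
  have hmin_sq : 0 ≤ minCoord ε w ^ 2 := sq_nonneg _
  have hdiff_sq : 0 ≤ ∑ j, (w (ε j) - w (ε 0)) ^ 2 := Finset.sum_nonneg fun _ _ => sq_nonneg _
  have hsum_sq : 0 ≤ (1 - ∑ j, w (ε j)) ^ 2 := sq_nonneg _
  refine lt_of_le_of_ne (by unfold cellDenom; positivity) fun h => ?_
  unfold cellDenom at h
  have hmin : minCoord ε w = 0 := pow_eq_zero_iff two_ne_zero |>.1 (by linarith)
  have hdiff : ∑ j, (w (ε j) - w (ε 0)) ^ 2 = 0 := by linarith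
  have hsum : 1 - ∑ j, w (ε j) = 0 := pow_eq_zero_iff two_ne_zero |>.1 (by linarith)
  rw [Finset.sum_eq_zero_iff_of_nonneg fun _ _ => sq_nonneg _] at hdiff
  have hconst : ∀ j, w (ε j) = w (ε 0) := fun j =>
    sub_eq_zero.1 (pow_eq_zero_iff two_ne_zero |>.1 (hdiff j (Finset.mem_univ j)))
  obtain ⟨i, hi⟩ := exists_minCoord_eq ε w
  have hzero : ∀ j, w (ε j) = 0 := fun j => by rw [hconst j, ← hconst i, ← hi, hmin]
  simp [hzero] at hsum

/-- The map from a simplex to a sphere that collapses the boundary to the base point. In the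
interior it is the inverse stereographic projection of the point with the coordinates
`(w (ε j) - w (ε 0)) / minCoord ε w`, `j ≠ 0`. -/
noncomputable def cellMap (w : V → ℝ) : EuclideanSpace ℝ (Fin (d + 1)) :=
  WithLp.toLp 2 fun j => (if j.val = 0 then 1 - 2 * minCoord ε w ^ 2 / cellDenom ε w else 0) +
    2 * minCoord ε w * (w (ε j) - w (ε 0)) / cellDenom ε w

theorem cellMap_zero (w : V → ℝ) :
    cellMap ε w 0 = 1 - 2 * minCoord ε w ^ 2 / cellDenom ε w := by
  simp [cellMap]

theorem cellMap_of_ne (w : V → ℝ) {j : Fin (d + 1)} (hj : j ≠ 0) :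
    cellMap ε w j = 2 * minCoord ε w * (w (ε j) - w (ε 0)) / cellDenom ε w := by
  simp [cellMap, hj]

theorem continuous_cellMap : Continuous (cellMap ε) := by
  have hmin := continuous_minCoord ε
  have hdenom : Continuous (cellDenom ε) := by unfold cellDenom; fun_prop
  have hne : ∀ w, cellDenom ε w ≠ 0 := fun w => (cellDenom_pos ε w).ne'
  refine (PiLp.continuous_toLp 2 _).comp (continuous_pi fun j => Continuous.add ?_ ?_)
  · split_ifs
    · exact continuous_const.sub (((hmin.pow 2).const_mul 2).div hdenom hne)
    · exact continuous_const
  · exact ((hmin.const_mul 2).mul ((continuous_apply _).sub (continuous_apply _))).div hdenom hne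

theorem norm_cellMap {w : V → ℝ} (h : minCoord ε w ≠ 0 → ∑ j, w (ε j) = 1) :
    ‖cellMap ε w‖ = 1 := by
  have hD := (cellDenom_pos ε w).ne'
  have hsucc : ∀ j : Fin d, ‖cellMap ε w j.succ‖ ^ 2 =
      4 * minCoord ε w ^ 2 / cellDenom ε w ^ 2 * (w (ε j.succ) - w (ε 0)) ^ 2 := fun j => by
    rw [cellMap_of_ne ε w (Fin.succ_ne_zero j), Real.norm_eq_abs, sq_abs]
    field_simp
    ring
  have hdenom : ∑ j : Fin d, (w (ε j.succ) - w (ε 0)) ^ 2 =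
      cellDenom ε w - minCoord ε w ^ 2 - (1 - ∑ j, w (ε j)) ^ 2 := by
    rw [cellDenom, Fin.sum_univ_succ]
    ring
  rw [EuclideanSpace.norm_eq, Real.sqrt_eq_one, Fin.sum_univ_succ, cellMap_zero]
  simp only [hsucc]
  rw [← Finset.mul_sum, Real.norm_eq_abs, sq_abs, hdenom]
  by_cases hm : minCoord ε w = 0
  · simp [hm]
  · rw [h hm]
    field_simp
    ring

theorem cellMap_eq_sphereBase_iff {w : V → ℝ} :
    cellMap ε w = sphereBase (d + 1) ↔ minCoord ε w = 0 := by
  refine ⟨fun h => ?_, fun h => by simp [cellMap, sphereBase, h]⟩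
  have hzero : cellMap ε w 0 = 1 := by simp [h, sphereBase]
  rw [cellMap_zero, sub_eq_self, div_eq_zero_iff, or_iff_left (cellDenom_pos ε w).ne'] at hzero
  simpa using hzero

theorem sub_div_minCoord_eq {w : V → ℝ} (hm : minCoord ε w ≠ 0) {j : Fin (d + 1)} (hj : j ≠ 0) :
    (w (ε j) - w (ε 0)) / minCoord ε w = cellMap ε w j / (1 - cellMap ε w 0) := by
  have hD := (cellDenom_pos ε w).ne'
  rw [cellMap_of_ne ε w hj, cellMap_zero]
  field_simp
  ring

/-- The hypothesis fixes the numbers `w (ε j) / minCoord ε w` up to a translation; their minimum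
is `1`. -/
theorem div_minCoord_eq_of_sub_div_eq {w w' : V → ℝ} (hm : 0 < minCoord ε w)
    (hm' : 0 < minCoord ε w') (h : ∀ j, (w (ε j) - w (ε 0)) / minCoord ε w =
      (w' (ε j) - w' (ε 0)) / minCoord ε w') (j : Fin (d + 1)) :
    w (ε j) / minCoord ε w = w' (ε j) / minCoord ε w' := by
  have hone_le : ∀ {u : V → ℝ}, 0 < minCoord ε u → ∀ i, 1 ≤ u (ε i) / minCoord ε u :=
    fun hu i => (one_le_div hu).2 (minCoord_le ε _ i)
  have hexists_one : ∀ {u : V → ℝ}, 0 < minCoord ε u → ∃ i, u (ε i) / minCoord ε u = 1 :=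
    fun {u} hu => (exists_minCoord_eq ε u).imp fun i hi => by rw [← hi, div_self hu.ne']
  have hsub : ∀ i, w (ε i) / minCoord ε w - w (ε 0) / minCoord ε w =
      w' (ε i) / minCoord ε w' - w' (ε 0) / minCoord ε w' := by
    simpa only [sub_div] using h
  obtain ⟨i, hi⟩ := hexists_one hm
  obtain ⟨i', hi'⟩ := hexists_one hm'
  linarith [hsub i, hsub i', hsub j, hone_le hm i', hone_le hm' i]

theorem eq_of_cellMap_eq {w w' : V → ℝ} (h : cellMap ε w = cellMap ε w')
    (hm : 0 < minCoord ε w) (hm' : 0 < minCoord ε w') (hsum : ∑ j, w (ε j) = 1)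
    (hsum' : ∑ j, w' (ε j) = 1) (j : Fin (d + 1)) : w (ε j) = w' (ε j) := by
  have hdiv := div_minCoord_eq_of_sub_div_eq ε hm hm' fun i => by
    rcases eq_or_ne i 0 with rfl | hi
    · simp
    · rw [sub_div_minCoord_eq ε hm.ne' hi, sub_div_minCoord_eq ε hm'.ne' hi, h]
  have hmin : minCoord ε w = minCoord ε w' := by
    have hinv : (minCoord ε w)⁻¹ = (minCoord ε w')⁻¹ := by
      rw [← one_div, ← one_div]
      nth_rw 1 [← hsum]
      rw [← hsum', Finset.sum_div, Finset.sum_div]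
      exact Finset.sum_congr rfl fun i _ => hdiv i
    exact inv_injective hinv
  have hj := hdiv j
  rwa [hmin, div_left_inj' hm'.ne'] at hj

theorem cellMap_eq_of_sub_eq {w : V → ℝ} (hm : minCoord ε w ≠ 0) (hsum : ∑ j, w (ε j) = 1)
    {x : EuclideanSpace ℝ (Fin (d + 1))} (hx : ‖x‖ = 1) (hx0 : x 0 ≠ 1)
    (h : ∀ j, j ≠ 0 → w (ε j) - w (ε 0) = minCoord ε w * (x j / (1 - x 0))) :
    cellMap ε w = x := by
  have hy : 1 - x 0 ≠ 0 := sub_ne_zero.2 hx0.symm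
  have hsq : ∑ j : Fin d, x j.succ ^ 2 = 1 - x 0 ^ 2 := by
    rw [EuclideanSpace.norm_eq, Real.sqrt_eq_one, Fin.sum_univ_succ] at hx
    simp only [Real.norm_eq_abs, sq_abs] at hx
    linarith
  have hdenom : cellDenom ε w = 2 * minCoord ε w ^ 2 / (1 - x 0) := by
    have hterm : ∀ j : Fin d, (w (ε j.succ) - w (ε 0)) ^ 2 =
        minCoord ε w ^ 2 / (1 - x 0) ^ 2 * x j.succ ^ 2 := fun j => by
      rw [h _ (Fin.succ_ne_zero j)]
      field_simp
    rw [cellDenom, hsum, Fin.sum_univ_succ, Finset.sum_congr rfl fun j _ => hterm j,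
      ← Finset.mul_sum, hsq]
    field_simp
    ring
  ext j
  rcases eq_or_ne j 0 with rfl | hj
  · rw [cellMap_zero, hdenom]
    field_simp
    ring
  · rw [cellMap_of_ne ε w hj, hdenom, h j hj]
    field_simp

theorem apply_zero_ne_one_of_ne_sphereBase {x : EuclideanSpace ℝ (Fin (d + 1))} (hx : ‖x‖ = 1)
    (hbase : x ≠ sphereBase (d + 1)) : x 0 ≠ 1 := by
  refine fun h => hbase ?_
  rw [EuclideanSpace.norm_eq, Real.sqrt_eq_one, Fin.sum_univ_succ, h, norm_one, one_pow,
    add_eq_left, Finset.sum_eq_zero_iff_of_nonneg fun _ _ => sq_nonneg _] at hx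
  ext j
  refine Fin.cases (by simp [h, sphereBase]) (fun i => ?_) j
  have hi : x i.succ = 0 := by simpa using hx i (Finset.mem_univ i)
  simp [hi, sphereBase]

variable {ε}

theorem exists_sub_eq_minCoord_mul (hε : Function.Injective ε) {z : Fin (d + 1) → ℝ}
    (hz : z 0 = 0) :
    ∃ w : V → ℝ, (∀ v, 0 ≤ w v) ∧ ∑ j, w (ε j) = 1 ∧ (∀ v ∉ Set.range ε, w v = 0) ∧
      minCoord ε w ≠ 0 ∧ ∀ j, w (ε j) - w (ε 0) = minCoord ε w * z j := by
  obtain ⟨i, -, hi⟩ := Finset.exists_mem_eq_inf' Finset.univ_nonempty z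
  let y : Fin (d + 1) → ℝ := fun j => 1 - z i + z j
  have hy : ∀ j, 1 ≤ y j := fun j => by
    have := hi ▸ Finset.inf'_le z (Finset.mem_univ j)
    simp only [y]
    linarith
  have hyi : y i = 1 := sub_add_cancel _ _
  have hpos : 0 < ∑ j, y j :=
    Finset.sum_pos (fun j _ => zero_lt_one.trans_le (hy j)) Finset.univ_nonempty
  let m : ℝ := (∑ j, y j)⁻¹
  have hm : 0 < m := inv_pos.2 hpos
  let w : V → ℝ := Function.extend ε (fun j => m * y j) 0
  have hw : ∀ j, w (ε j) = m * y j := fun j => hε.extend_apply _ _ j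
  have hw_notMem : ∀ v ∉ Set.range ε, w v = 0 := fun v hv => Function.extend_apply' _ _ _ hv
  have hmin : minCoord ε w = m := by
    refine le_antisymm ?_ (Finset.le_inf' _ _ fun j _ => ?_)
    · simpa [hw, hyi] using minCoord_le ε w i
    · rw [hw]
      exact le_mul_of_one_le_right hm.le (hy j)
  refine ⟨w, fun v => ?_, ?_, hw_notMem, hmin ▸ hm.ne', fun j => ?_⟩
  · by_cases hv : v ∈ Set.range ε
    · obtain ⟨j, rfl⟩ := hv
      rw [hw]
      exact mul_nonneg hm.le (zero_le_one.trans (hy j))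
    · rw [hw_notMem v hv]
  · rw [Finset.sum_congr rfl fun j _ => hw j, ← Finset.mul_sum, inv_mul_cancel₀ hpos.ne']
  · rw [hw, hw, hmin]
    simp only [y, hz]
    ring

theorem exists_cellMap_eq (hε : Function.Injective ε) {x : EuclideanSpace ℝ (Fin (d + 1))}
    (hx : ‖x‖ = 1) (hbase : x ≠ sphereBase (d + 1)) :
    ∃ w : V → ℝ, (∀ v, 0 ≤ w v) ∧ ∑ j, w (ε j) = 1 ∧ (∀ v ∉ Set.range ε, w v = 0) ∧
      cellMap ε w = x := by
  obtain ⟨w, hnonneg, hsum, hsupp, hm, hsub⟩ :=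
    exists_sub_eq_minCoord_mul hε (z := fun j => if j = 0 then 0 else x j / (1 - x 0)) (if_pos rfl)
  refine ⟨w, hnonneg, hsum, hsupp,
    cellMap_eq_of_sub_eq ε hm hsum hx (apply_zero_ne_one_of_ne_sphereBase hx hbase) fun j hj => ?_⟩
  rw [hsub, if_neg hj]

end Cell

/-! ### Attaching cells to a contractible complex -/

theorem contractibleSpace_preimage_val {X : Type*} [TopologicalSpace X] {S T : Set X} (h : T ⊆ S)
    [ContractibleSpace T] : ContractibleSpace (Subtype.val ⁻¹' T : Set S) :=
  ((Topology.IsEmbedding.subtypeVal.homeomorphImage _).trans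
    (Homeomorph.setCongr (by rw [Subtype.image_preimage_coe, Set.inter_eq_right.2 h]))
      ).contractibleSpace

section Attach

variable {V : Type*} [DecidableEq V] {d r : ℕ}

/-- The simplices with the vertices `ε i 0, …, ε i d` are distinct and can be attached along their
boundaries to the complex with the set of faces `A`. -/
structure IsCellAttachment (A : Finset (Finset V)) (ε : Fin r → Fin (d + 1) → V) : Prop where
  injective : ∀ i, Function.Injective (ε i)
  isLowerSet : IsLowerSet (A : Set (Finset V))
  notMem : ∀ i, Finset.univ.image (ε i) ∉ A
  boundary : ∀ i j, (Finset.univ.image (ε i)).erase (ε i j) ∈ A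
  ne : ∀ i j, i ≠ j → Finset.univ.image (ε i) ≠ Finset.univ.image (ε j)

/-- The faces of `A` together with the simplices listed by `ε`. -/
def attachedFaces (A : Finset (Finset V)) (ε : Fin r → Fin (d + 1) → V) : Finset (Finset V) :=
  A ∪ Finset.univ.image fun i => Finset.univ.image (ε i)

/-- The factor by which `stretch` shrinks, at time `t`, a simplex whose smallest coordinate is `m`
in order to move its points away from the barycentre. The points with
`(1 + t) * (1 - (d + 1) * m) ≥ 1` reach the boundary. -/
noncomputable def stretchScale (d : ℕ) (t m : ℝ) : ℝ := max (1 - (d + 1) * m) (1 / (1 + t))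

theorem stretchScale_pos {t : ℝ} (ht : 0 ≤ t) (m : ℝ) : 0 < stretchScale d t m :=
  lt_max_of_lt_right (by positivity)

theorem stretchScale_zero_right {t : ℝ} (ht : 0 ≤ t) : stretchScale d t 0 = 1 := by
  have : 1 / (1 + t) ≤ 1 := div_le_one_of_le₀ (by linarith) (by linarith)
  simpa [stretchScale] using this

theorem stretchScale_zero_left {m : ℝ} (hm : 0 ≤ m) : stretchScale d 0 m = 1 := by
  have : 0 ≤ ((d : ℝ) + 1) * m := by positivity
  simpa [stretchScale] using this

/-- The homotopy that expands the attached simplices from their barycentres and fixes `A`. A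
point `w` lies in the interior of at most one of them, and the other terms of the sum vanish. -/
noncomputable def stretch (ε : Fin r → Fin (d + 1) → V) (t : ℝ) (w : V → ℝ) : V → ℝ := fun v =>
  w v + ∑ i, (1 / stretchScale d t (minCoord (ε i) w) - 1) *
    (w v - if v ∈ Finset.univ.image (ε i) then 1 / ((d : ℝ) + 1) else 0)

theorem stretch_of_forall (ε : Fin r → Fin (d + 1) → V) {t : ℝ} (ht : 0 ≤ t) {w : V → ℝ}
    (h : ∀ i, minCoord (ε i) w = 0) : stretch ε t w = w := by
  funext v
  simp [stretch, h, stretchScale_zero_right ht]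

theorem stretch_zero (ε : Fin r → Fin (d + 1) → V) {w : V → ℝ} (hw : ∀ v, 0 ≤ w v) :
    stretch ε 0 w = w := by
  funext v
  simp [stretch, stretchScale_zero_left (minCoord_nonneg _ hw)]

theorem continuous_stretch (ε : Fin r → Fin (d + 1) → V) :
    Continuous fun p : unitInterval × (V → ℝ) => stretch ε p.1 p.2 := by
  have hcoord : ∀ v, Continuous fun p : unitInterval × (V → ℝ) => p.2 v := fun v =>
    (continuous_apply v).comp continuous_snd
  have hscale : ∀ i, Continuous fun p : unitInterval × (V → ℝ) =>
      stretchScale d p.1 (minCoord (ε i) p.2) := fun i => by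
    have hmin := (continuous_minCoord (ε i)).comp (continuous_snd (X := unitInterval))
    have htime : Continuous fun p : unitInterval × (V → ℝ) => 1 + (p.1 : ℝ) :=
      continuous_const.add (continuous_subtype_val.comp continuous_fst)
    exact (continuous_const.sub (hmin.const_mul _)).max
      (continuous_const.div htime fun p => by linarith [p.1.2.1])
  exact continuous_pi fun v => (hcoord v).add <| continuous_finsetSum _ fun i _ =>
    ((continuous_const.div (hscale i) fun p => (stretchScale_pos p.1.2.1 _).ne').sub
      continuous_const).mul ((hcoord v).sub continuous_const)

theorem card_image_cell {ε : Fin (d + 1) → V} (hε : Function.Injective ε) :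
    (Finset.univ.image ε).card = d + 1 := by
  rw [Finset.card_image_of_injective _ hε, Finset.card_univ, Fintype.card_fin]

theorem IsCellAttachment.eq_of_image_subset {A : Finset (Finset V)} {ε : Fin r → Fin (d + 1) → V}
    (hA : IsCellAttachment A ε) {i j : Fin r}
    (h : Finset.univ.image (ε i) ⊆ Finset.univ.image (ε j)) : i = j := by
  refine not_imp_comm.1 (hA.ne i j) fun hne => hne (Finset.eq_of_subset_of_card_le h ?_)
  rw [card_image_cell (hA.injective i), card_image_cell (hA.injective j)]

variable [Fintype V]

theorem sum_cell {ε : Fin (d + 1) → V} (hε : Function.Injective ε) {w : V → ℝ}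
    (h : ∀ v ∉ Finset.univ.image ε, w v = 0) : ∑ j, w (ε j) = ∑ v, w v := by
  rw [← Finset.sum_image (f := w) hε.injOn]
  exact Finset.sum_subset (Finset.subset_univ _) fun v _ hv => h v hv

namespace IsCellAttachment

variable {A : Finset (Finset V)} {ε : Fin r → Fin (d + 1) → V} {w : V → ℝ} {i : Fin r}

theorem eq_zero_of_minCoord_ne_zero (hA : IsCellAttachment A ε)
    (hw : w ∈ faceRealization (attachedFaces A ε)) (hi : minCoord (ε i) w ≠ 0) :
    ∀ v ∉ Finset.univ.image (ε i), w v = 0 := by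
  obtain ⟨⟨hnonneg, -⟩, s, hs, hsupp⟩ := hw
  have hsub : Finset.univ.image (ε i) ⊆ s := by
    intro v hv
    obtain ⟨j, -, rfl⟩ := Finset.mem_image.1 hv
    by_contra hn
    exact hi (minCoord_eq_zero _ hnonneg (hsupp _ hn))
  rcases Finset.mem_union.1 hs with hs | hs
  · exact absurd (hA.isLowerSet hsub hs) (hA.notMem i)
  · obtain ⟨j, -, rfl⟩ := Finset.mem_image.1 hs
    rwa [hA.eq_of_image_subset hsub]

theorem sum_eq_one (hA : IsCellAttachment A ε) (hw : w ∈ faceRealization (attachedFaces A ε))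
    (hi : minCoord (ε i) w ≠ 0) : ∑ j, w (ε i j) = 1 := by
  rw [sum_cell (hA.injective i) (hA.eq_zero_of_minCoord_ne_zero hw hi), hw.1.2]

theorem minCoord_eq_zero_of_ne (hA : IsCellAttachment A ε)
    (hw : w ∈ faceRealization (attachedFaces A ε)) (hi : minCoord (ε i) w ≠ 0) {j : Fin r}
    (hij : j ≠ i) : minCoord (ε j) w = 0 := by
  obtain ⟨v, hv, hvi⟩ := Finset.not_subset.1 fun hsub => hij (hA.eq_of_image_subset hsub)
  obtain ⟨k, -, rfl⟩ := Finset.mem_image.1 hv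
  exact minCoord_eq_zero _ hw.1.1 (hA.eq_zero_of_minCoord_ne_zero hw hi _ hvi)

theorem minCoord_eq_zero_of_mem (hA : IsCellAttachment A ε) (hw : w ∈ faceRealization A)
    (i : Fin r) : minCoord (ε i) w = 0 := by
  obtain ⟨⟨hnonneg, -⟩, s, hs, hsupp⟩ := hw
  obtain ⟨v, hv, hvi⟩ := Finset.not_subset.1 fun h => hA.notMem i (hA.isLowerSet h hs)
  obtain ⟨k, -, rfl⟩ := Finset.mem_image.1 hv
  exact minCoord_eq_zero _ hnonneg (hsupp _ hvi)

theorem mem_of_eq_zero (hA : IsCellAttachment A ε) (hw : w ∈ stdSimplex ℝ V)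
    (hi : ∀ v ∉ Finset.univ.image (ε i), w v = 0) {j : Fin (d + 1)} (hj : w (ε i j) = 0) :
    w ∈ faceRealization A := by
  refine ⟨hw, _, hA.boundary i j, fun v hv => ?_⟩
  by_cases h : v = ε i j
  · rw [h, hj]
  · exact hi v fun hv' => hv (Finset.mem_erase.2 ⟨h, hv'⟩)

theorem mem_of_minCoord_eq_zero (hA : IsCellAttachment A ε)
    (hw : w ∈ faceRealization (attachedFaces A ε)) (h : ∀ i, minCoord (ε i) w = 0) :
    w ∈ faceRealization A := by
  obtain ⟨hstd, s, hs, hsupp⟩ := hw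
  rcases Finset.mem_union.1 hs with hs | hs
  · exact ⟨hstd, s, hs, hsupp⟩
  · obtain ⟨i, -, rfl⟩ := Finset.mem_image.1 hs
    obtain ⟨j, hj⟩ := exists_minCoord_eq (ε i) w
    exact hA.mem_of_eq_zero hstd hsupp (hj ▸ h i)

theorem mem_or_exists_minCoord_ne_zero (hA : IsCellAttachment A ε)
    (hw : w ∈ faceRealization (attachedFaces A ε)) :
    w ∈ faceRealization A ∨ ∃ i, minCoord (ε i) w ≠ 0 := by
  by_cases h : ∃ i, minCoord (ε i) w ≠ 0
  · exact Or.inr h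
  · exact Or.inl (hA.mem_of_minCoord_eq_zero hw (by simpa using h))

theorem cellMap_mem (hA : IsCellAttachment A ε) (hw : w ∈ faceRealization (attachedFaces A ε))
    (i : Fin r) : cellMap (ε i) w ∈ Metric.sphere (0 : EuclideanSpace ℝ (Fin (d + 1))) 1 :=
  mem_sphere_zero_iff_norm.2 (norm_cellMap _ fun hi => hA.sum_eq_one hw hi)

/-- The map onto the wedge of spheres that collapses `A` to the base point. -/
noncomputable def toWedge (hA : IsCellAttachment A ε) (hr : 0 < r)
    (w : faceRealization (attachedFaces A ε)) : SphereWedge r (d + 1) :=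
  open Classical in
  if h : ∃ i, minCoord (ε i) w.1 ≠ 0 then
    Quotient.mk _ (h.choose, ⟨_, hA.cellMap_mem w.2 h.choose⟩)
  else Quotient.mk _ (⟨0, hr⟩, ⟨_, sphereBase_mem d⟩)

theorem wedgeCoord_toWedge (hA : IsCellAttachment A ε) (hr : 0 < r)
    (w : faceRealization (attachedFaces A ε)) (i : Fin r) :
    wedgeCoord r d i (hA.toWedge hr w) = ⟨_, hA.cellMap_mem w.2 i⟩ := by
  have hbase : ∀ j, minCoord (ε j) w.1 = 0 →
      (⟨_, sphereBase_mem d⟩ : Metric.sphere (0 : EuclideanSpace ℝ (Fin (d + 1))) 1) =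
        ⟨_, hA.cellMap_mem w.2 j⟩ := fun j hj =>
    Subtype.ext ((cellMap_eq_sphereBase_iff _).2 hj).symm
  by_cases h : ∃ i, minCoord (ε i) w.1 ≠ 0
  · rw [toWedge, dif_pos h, wedgeCoord_mk]
    split_ifs with he
    · simp only [he]
    · exact hbase i (hA.minCoord_eq_zero_of_ne w.2 h.choose_spec (Ne.symm he))
  · rw [toWedge, dif_neg h, wedgeCoord_mk, ite_self]
    exact hbase i (not_not.1 fun hi => h ⟨i, hi⟩)

theorem toWedge_eq_iff (hA : IsCellAttachment A ε) (hr : 0 < r)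
    {w : faceRealization (attachedFaces A ε)} {x : SphereWedge r (d + 1)} :
    hA.toWedge hr w = x ↔ ∀ i, cellMap (ε i) w.1 = (wedgeCoord r d i x).1 := by
  refine ⟨?_, fun h => wedgeCoord_injective (funext fun i => ?_)⟩
  · rintro rfl i
    rw [wedgeCoord_toWedge]
  · exact (hA.wedgeCoord_toWedge hr w i).trans (Subtype.ext (h i))

theorem continuous_toWedge (hA : IsCellAttachment A ε) (hr : 0 < r) :
    Continuous (hA.toWedge hr) := by
  refine continuous_of_wedgeCoord fun i => ?_
  simp only [wedgeCoord_toWedge]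
  exact ((continuous_cellMap (ε i)).comp continuous_subtype_val).subtype_mk _

theorem toWedge_eq_of_mem (hA : IsCellAttachment A ε) (hr : 0 < r)
    {w w' : faceRealization (attachedFaces A ε)} (hw : w.1 ∈ faceRealization A)
    (hw' : w'.1 ∈ faceRealization A) : hA.toWedge hr w = hA.toWedge hr w' := by
  refine (hA.toWedge_eq_iff hr).2 fun i => ?_
  rw [wedgeCoord_toWedge, (cellMap_eq_sphereBase_iff _).2 (hA.minCoord_eq_zero_of_mem hw i)]
  exact ((cellMap_eq_sphereBase_iff _).2 (hA.minCoord_eq_zero_of_mem hw' i)).symm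

theorem eq_or_mem_of_toWedge_eq (hA : IsCellAttachment A ε) (hr : 0 < r)
    {w w' : faceRealization (attachedFaces A ε)} (h : hA.toWedge hr w = hA.toWedge hr w') :
    w = w' ∨ (w.1 ∈ faceRealization A ∧ w'.1 ∈ faceRealization A) := by
  have hcell : ∀ i, cellMap (ε i) w.1 = cellMap (ε i) w'.1 := fun i => by
    rw [(hA.toWedge_eq_iff hr).1 h i, wedgeCoord_toWedge]
  have hmin : ∀ i, minCoord (ε i) w.1 = 0 ↔ minCoord (ε i) w'.1 = 0 := fun i => by
    rw [← cellMap_eq_sphereBase_iff, hcell, cellMap_eq_sphereBase_iff]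
  by_cases hall : ∀ i, minCoord (ε i) w.1 = 0
  · exact Or.inr ⟨hA.mem_of_minCoord_eq_zero w.2 hall,
      hA.mem_of_minCoord_eq_zero w'.2 fun i => (hmin i).1 (hall i)⟩
  · obtain ⟨i, hi⟩ := not_forall.1 hall
    have hi' : minCoord (ε i) w'.1 ≠ 0 := fun h0 => hi ((hmin i).2 h0)
    refine Or.inl (Subtype.ext (funext fun v => ?_))
    by_cases hv : v ∈ Finset.univ.image (ε i)
    · obtain ⟨j, -, rfl⟩ := Finset.mem_image.1 hv
      exact eq_of_cellMap_eq (ε i) (hcell i) ((minCoord_nonneg _ w.2.1.1).lt_of_ne' hi)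
        ((minCoord_nonneg _ w'.2.1.1).lt_of_ne' hi') (hA.sum_eq_one w.2 hi)
        (hA.sum_eq_one w'.2 hi') j
    · rw [hA.eq_zero_of_minCoord_ne_zero w.2 hi v hv, hA.eq_zero_of_minCoord_ne_zero w'.2 hi' v hv]

theorem mem_attachedFaces_of_eq_zero (hw : w ∈ stdSimplex ℝ V)
    (hi : ∀ v ∉ Finset.univ.image (ε i), w v = 0) : w ∈ faceRealization (attachedFaces A ε) :=
  ⟨hw, _, Finset.mem_union_right _ (Finset.mem_image_of_mem _ (Finset.mem_univ i)), hi⟩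

theorem toWedge_surjective (hA : IsCellAttachment A ε) (hr : 0 < r)
    (hne : (faceRealization A).Nonempty) : Function.Surjective (hA.toWedge hr) := by
  rintro ⟨i, x, hx⟩
  by_cases hbase : x = sphereBase (d + 1)
  · obtain ⟨w, hw⟩ := hne
    refine ⟨⟨w, faceRealization_mono Finset.subset_union_left hw⟩,
      (hA.toWedge_eq_iff hr).2 fun j => ?_⟩
    rw [(cellMap_eq_sphereBase_iff _).2 (hA.minCoord_eq_zero_of_mem hw j)]
    change _ = (wedgeCoord r d j (Quotient.mk _ _)).1
    rw [wedgeCoord_mk]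
    split_ifs
    exacts [hbase.symm, rfl]
  · obtain ⟨w, hnonneg, hsum, hrange, rfl⟩ := exists_cellMap_eq (hA.injective i)
      (mem_sphere_zero_iff_norm.1 hx) hbase
    have hsupp : ∀ v ∉ Finset.univ.image (ε i), w v = 0 := fun v hv =>
      hrange v fun ⟨j, hj⟩ => hv (Finset.mem_image.2 ⟨j, Finset.mem_univ j, hj⟩)
    have hw : w ∈ faceRealization (attachedFaces A ε) := mem_attachedFaces_of_eq_zero
      ⟨hnonneg, by rw [← sum_cell (hA.injective i) hsupp, hsum]⟩ hsupp
    have hi : minCoord (ε i) w ≠ 0 := fun h => hbase ((cellMap_eq_sphereBase_iff _).2 h)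
    refine ⟨⟨w, hw⟩, (hA.toWedge_eq_iff hr).2 fun j => ?_⟩
    change _ = (wedgeCoord r d j (Quotient.mk _ _)).1
    rw [wedgeCoord_mk]
    split_ifs with hij
    · subst hij
      rfl
    · exact (cellMap_eq_sphereBase_iff _).2 (hA.minCoord_eq_zero_of_ne hw hi (Ne.symm hij))

variable {t : ℝ}

theorem stretch_apply (hA : IsCellAttachment A ε) (hw : w ∈ faceRealization (attachedFaces A ε))
    (hi : minCoord (ε i) w ≠ 0) (ht : 0 ≤ t) (v : V) :
    stretch ε t w v = w v + (1 / stretchScale d t (minCoord (ε i) w) - 1) *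
      (w v - if v ∈ Finset.univ.image (ε i) then 1 / ((d : ℝ) + 1) else 0) := by
  rw [stretch, Finset.sum_eq_single i]
  · intro j _ hj
    rw [hA.minCoord_eq_zero_of_ne hw hi hj, stretchScale_zero_right ht, div_one, sub_self, zero_mul]
  · simp

theorem stretch_apply_vertex (hA : IsCellAttachment A ε)
    (hw : w ∈ faceRealization (attachedFaces A ε)) (hi : minCoord (ε i) w ≠ 0) (ht : 0 ≤ t)
    (j : Fin (d + 1)) :
    stretch ε t w (ε i j) =
      ((d + 1) * w (ε i j) - (1 - stretchScale d t (minCoord (ε i) w))) /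
        (stretchScale d t (minCoord (ε i) w) * (d + 1)) := by
  rw [hA.stretch_apply hw hi ht, if_pos (Finset.mem_image_of_mem _ (Finset.mem_univ j))]
  have := (stretchScale_pos (d := d) ht (minCoord (ε i) w)).ne'
  field_simp
  ring

theorem stretch_apply_of_notMem (hA : IsCellAttachment A ε)
    (hw : w ∈ faceRealization (attachedFaces A ε)) (hi : minCoord (ε i) w ≠ 0) (ht : 0 ≤ t)
    {v : V} (hv : v ∉ Finset.univ.image (ε i)) : stretch ε t w v = 0 := by
  rw [hA.stretch_apply hw hi ht, if_neg hv, hA.eq_zero_of_minCoord_ne_zero hw hi v hv]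
  simp

theorem stretch_mem_stdSimplex (hA : IsCellAttachment A ε)
    (hw : w ∈ faceRealization (attachedFaces A ε)) (hi : minCoord (ε i) w ≠ 0) (ht : 0 ≤ t) :
    stretch ε t w ∈ stdSimplex ℝ V := by
  constructor
  · intro v
    by_cases hv : v ∈ Finset.univ.image (ε i)
    · obtain ⟨j, -, rfl⟩ := Finset.mem_image.1 hv
      have hscale := stretchScale_pos (d := d) ht (minCoord (ε i) w)
      have hle : 1 - (d + 1) * minCoord (ε i) w ≤ stretchScale d t (minCoord (ε i) w) :=
        le_max_left _ _
      have hmin : (d + 1) * minCoord (ε i) w ≤ (d + 1) * w (ε i j) :=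
        mul_le_mul_of_nonneg_left (minCoord_le _ w j) (by positivity)
      rw [hA.stretch_apply_vertex hw hi ht]
      exact div_nonneg (by linarith) (by positivity)
    · rw [hA.stretch_apply_of_notMem hw hi ht hv]
  · simp only [hA.stretch_apply hw hi ht]
    rw [Finset.sum_add_distrib, ← Finset.mul_sum, Finset.sum_sub_distrib, hw.1.2,
      Finset.sum_ite_mem, Finset.univ_inter, Finset.sum_const, card_image_cell (hA.injective i),
      nsmul_eq_mul, Nat.cast_add_one, mul_one_div_cancel (by positivity), sub_self, mul_zero,
      add_zero]

theorem stretch_mem (hA : IsCellAttachment A ε) (hw : w ∈ faceRealization (attachedFaces A ε))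
    (ht : 0 ≤ t) : stretch ε t w ∈ faceRealization (attachedFaces A ε) := by
  rcases hA.mem_or_exists_minCoord_ne_zero hw with hwA | ⟨i, hi⟩
  · rwa [stretch_of_forall ε ht (hA.minCoord_eq_zero_of_mem hwA)]
  · exact mem_attachedFaces_of_eq_zero (hA.stretch_mem_stdSimplex hw hi ht) fun v hv =>
      hA.stretch_apply_of_notMem hw hi ht hv

theorem stretch_mem_of_le (hA : IsCellAttachment A ε)
    (hw : w ∈ faceRealization (attachedFaces A ε)) (ht : 0 ≤ t)
    (h : 1 ≤ (1 + t) * (1 - (d + 1) * ∑ i, minCoord (ε i) w)) :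
    stretch ε t w ∈ faceRealization A := by
  rcases hA.mem_or_exists_minCoord_ne_zero hw with hwA | ⟨i, hi⟩
  · rwa [stretch_of_forall ε ht (hA.minCoord_eq_zero_of_mem hwA)]
  have hsum : ∑ j, minCoord (ε j) w = minCoord (ε i) w :=
    Finset.sum_eq_single i (fun j _ hj => hA.minCoord_eq_zero_of_ne hw hi hj) (by simp)
  have hscale : stretchScale d t (minCoord (ε i) w) = 1 - (d + 1) * minCoord (ε i) w :=
    max_eq_left ((div_le_iff₀' (by linarith)).2 (hsum ▸ h))
  obtain ⟨j, hj⟩ := exists_minCoord_eq (ε i) w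
  refine hA.mem_of_eq_zero (hA.stretch_mem_stdSimplex hw hi ht)
    (fun v hv => hA.stretch_apply_of_notMem hw hi ht hv) (j := j) ?_
  rw [hA.stretch_apply_vertex hw hi ht, hscale, ← hj, sub_sub_cancel, sub_self, zero_div]

/-- At time `t`, the homotopy first expands the attached simplices by `stretch`, and then contracts
the part of the complex that has been pushed into `A`. -/
theorem exists_homotopy (hA : IsCellAttachment A ε) [ContractibleSpace (faceRealization A)] :
    ∃ H : C(unitInterval × faceRealization (attachedFaces A ε),
        faceRealization (attachedFaces A ε)),
      (∀ w, H (0, w) = w) ∧ (∀ t w, w.1 ∈ faceRealization A → (H (t, w)).1 ∈ faceRealization A) ∧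
      ∀ w w', w.1 ∈ faceRealization A → w'.1 ∈ faceRealization A → H (1, w) = H (1, w') := by
  let X := faceRealization (attachedFaces A ε)
  let S : Set X := Subtype.val ⁻¹' faceRealization A
  have : ContractibleSpace S :=
    contractibleSpace_preimage_val (faceRealization_mono Finset.subset_union_left)
  let e : C(unitInterval × X, X) := ⟨fun p => ⟨stretch ε p.1 p.2.1, hA.stretch_mem p.2.2 p.1.2.1⟩,
    ((continuous_stretch ε).comp (continuous_fst.prodMk
      (continuous_subtype_val.comp continuous_snd))).subtype_mk _⟩
  let s : C(unitInterval × X, ℝ) :=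
    ⟨fun p => (1 + p.1.1) * (1 - (d + 1) * ∑ i, minCoord (ε i) p.2.1) - 1, by
      have : ∀ i, Continuous fun p : unitInterval × X => minCoord (ε i) p.2.1 := fun i =>
        (continuous_minCoord (ε i)).comp (continuous_subtype_val.comp continuous_snd)
      fun_prop⟩
  have hs0 : ∀ w, s (0, w) ≤ 0 := fun w => by
    have : 0 ≤ ((d : ℝ) + 1) * ∑ i, minCoord (ε i) w.1 :=
      mul_nonneg (by positivity) (Finset.sum_nonneg fun i _ => minCoord_nonneg _ w.2.1.1)
    simpa [s] using this
  obtain ⟨H, H0, HS, H1⟩ := exists_homotopy_of_expansion S e s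
    (fun p hp => hA.stretch_mem_of_le p.2.2 p.1.2.1 (sub_nonneg.1 hp))
    (fun w => Subtype.ext (stretch_zero ε w.2.1.1)) hs0
    (fun t w hw => Subtype.ext (stretch_of_forall ε t.2.1 (hA.minCoord_eq_zero_of_mem hw)))
    (fun t w hw => by simp [s, hA.minCoord_eq_zero_of_mem hw])
  exact ⟨H, H0, HS, fun w w' hw => H1 w hw w'⟩

theorem nonempty_homotopyEquiv (hA : IsCellAttachment A ε) (hr : 0 < r)
    [ContractibleSpace (faceRealization A)] :
    Nonempty (faceRealization (attachedFaces A ε) ≃ₕ SphereWedge r (d + 1)) := by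
  have : CompactSpace (faceRealization (attachedFaces A ε)) :=
    isCompact_iff_compactSpace.1 (isCompact_faceRealization _)
  have hne : (faceRealization A).Nonempty := Set.nonempty_coe_sort.1 inferInstance
  obtain ⟨H, H0, HS, H1⟩ := hA.exists_homotopy
  exact nonempty_homotopyEquiv_of_collapse (S := Subtype.val ⁻¹' faceRealization A)
    ⟨hA.toWedge hr, hA.continuous_toWedge hr⟩ (hA.toWedge_surjective hr hne)
    (fun w w' h => hA.eq_or_mem_of_toWedge_eq hr h)
    (fun w hw w' hw' => hA.toWedge_eq_of_mem hr hw hw') H H0 HS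
    (fun w hw w' => H1 w w' hw)

end IsCellAttachment

theorem IsContractibleDecomposition.exists_isCellAttachment {S : List (Finset V)}
    {A B : Finset (Finset V)} (h : IsContractibleDecomposition S (d + 1) A B) :
    ∃ ε : Fin B.card → Fin (d + 1) → V, IsCellAttachment A ε ∧ attachedFaces A ε = A ∪ B := by
  let cell : Fin B.card ≃ B := B.equivFin.symm
  have hcard : ∀ i, (cell i).1.card = d + 1 := fun i => h.card_eq _ (cell i).2
  let ε : Fin B.card → Fin (d + 1) → V := fun i j =>
    (((cell i).1.equivFinOfCardEq (hcard i)).symm j).1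
  have himage : ∀ i, Finset.univ.image (ε i) = (cell i).1 := fun i => by
    ext v
    simp only [Finset.mem_image, Finset.mem_univ, true_and]
    refine ⟨?_, fun hv => ⟨(cell i).1.equivFinOfCardEq (hcard i) ⟨v, hv⟩, by simp [ε]⟩⟩
    rintro ⟨j, rfl⟩
    exact Subtype.prop _
  refine ⟨ε, ⟨fun i => Subtype.val_injective.comp (Equiv.injective _), h.isLowerSet, fun i => ?_,
    fun i j => ?_, fun i j hij heq => hij ?_⟩, ?_⟩
  · rw [himage]
    exact Finset.disjoint_right.1 h.disjoint (cell i).2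
  · rw [himage]
    exact h.erase_mem _ (cell i).2 _ (Subtype.prop _)
  · rw [himage, himage] at heq
    exact cell.injective (Subtype.ext heq)
  · rw [attachedFaces]
    congr 1
    ext F
    simp only [Finset.mem_image, Finset.mem_univ, true_and]
    refine ⟨?_, fun hF => ⟨cell.symm ⟨F, hF⟩, by simp [himage]⟩⟩
    rintro ⟨i, rfl⟩
    exact (himage i).symm ▸ (cell i).2

end Attach

theorem IsReverseShelling.nonempty_homotopyEquiv {V : Type*} [Fintype V] {d : ℕ}
    {S : List (Finset V)} (hS : IsReverseShelling S) (hne : S ≠ [])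
    (hcard : ∀ F ∈ S, F.card = d + 1) {K : Finset (Finset V)}
    (hK : ∀ G, G ∈ K ↔ ∃ F ∈ S, G ⊆ F) {b : ℕ} (hb : 0 < b)
    (hχ : ∑ G ∈ K, (-1 : ℤ) ^ G.card = (-1) ^ (d + 1) * b) :
    Nonempty (faceRealization K ≃ₕ SphereWedge b (d + 1)) := by
  classical
  obtain ⟨A, B, h⟩ := hS.exists_isContractibleDecomposition d.succ_pos hne hcard
  obtain rfl : K = A ∪ B := by
    ext G
    rw [hK, h.mem_union_iff]
  obtain rfl : B.card = b := by
    rw [Finset.sum_union h.disjoint, h.sum_neg_one_pow_card, zero_add,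
      Finset.sum_congr rfl fun F hF => by rw [h.card_eq F hF], Finset.sum_const, nsmul_eq_mul,
      mul_comm] at hχ
    exact_mod_cast mul_left_cancel₀ (pow_ne_zero _ (by norm_num)) hχ
  obtain ⟨ε, hA, hAB⟩ := h.exists_isCellAttachment
  rw [← hAB]
  have := h.contractibleSpace
  exact hA.nonempty_homotopyEquiv hb

/-! ### Homology of a shellable order complex -/

section ChainSupport

variable {P : Type*} [PartialOrder P] {m : ℕ}

/-- The face of the order complex spanned by a chain. -/
def chainSupport (c : Fin m ↪o P) : Finset P := Finset.univ.map c.toEmbedding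

theorem mem_chainSupport {c : Fin m ↪o P} {x : P} : x ∈ chainSupport c ↔ ∃ i, c i = x := by
  simp [chainSupport]

theorem card_chainSupport (c : Fin m ↪o P) : (chainSupport c).card = m := by
  simp [chainSupport]

theorem isChain_chainSupport (c : Fin m ↪o P) :
    IsChain (· ≤ ·) (chainSupport c : Set P) := by
  intro x hx y hy _
  obtain ⟨i, rfl⟩ := mem_chainSupport.1 hx
  obtain ⟨j, rfl⟩ := mem_chainSupport.1 hy
  simpa using le_total i j

theorem chainSupport_injective :
    Function.Injective (chainSupport : (Fin m ↪o P) → Finset P) := by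
  intro c c' h
  refine DFunLike.coe_injective ((StrictMono.range_inj c.strictMono c'.strictMono).1 ?_)
  ext x
  rw [Set.mem_range, Set.mem_range, ← mem_chainSupport, h, mem_chainSupport]

theorem exists_chainSupport_eq {G : Finset P} (hG : IsChain (· ≤ ·) (G : Set P))
    (hm : G.card = m) : ∃ c : Fin m ↪o P, chainSupport c = G := by
  classical
  let _ : LinearOrder (G : Set P) := hG.linearOrder
  let e := monoEquivOfFin (G : Set P) (by simpa using hm)
  refine ⟨e.toOrderEmbedding.trans (OrderEmbedding.subtype _), ?_⟩
  ext x
  rw [mem_chainSupport]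
  constructor
  · rintro ⟨i, rfl⟩
    exact (e i).2
  · intro hx
    exact ⟨e.symm ⟨x, hx⟩, by simp⟩

theorem card_orderEmbedding {K : Finset (Finset P)}
    (hK : ∀ G : Finset P, G ∈ K ↔ IsChain (· ≤ ·) (G : Set P)) :
    Nat.card (Fin m ↪o P) = (K.filter fun G => G.card = m).card := by
  rw [← Nat.card_eq_finsetCard]
  refine Nat.card_eq_of_bijective (fun c => ⟨chainSupport c, Finset.mem_filter.2
    ⟨(hK _).2 (isChain_chainSupport c), card_chainSupport c⟩⟩) ⟨fun c c' h =>
      chainSupport_injective (congrArg Subtype.val h), fun ⟨G, hG⟩ => ?_⟩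
  rw [Finset.mem_filter, hK] at hG
  obtain ⟨c, hc⟩ := exists_chainSupport_eq hG.1 hG.2
  exact ⟨c, Subtype.ext hc⟩

variable [DecidableEq P]

theorem chainSupport_succAbove (c : Fin (m + 1) ↪o P) (i : Fin (m + 1)) :
    chainSupport ((Fin.succAboveOrderEmb i).trans c) = (chainSupport c).erase (c i) := by
  ext x
  rw [Finset.mem_erase, mem_chainSupport, mem_chainSupport]
  constructor
  · rintro ⟨j, rfl⟩
    exact ⟨fun h => Fin.succAbove_ne i j (c.injective h), _, rfl⟩
  · rintro ⟨h, j, rfl⟩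
    obtain ⟨j', rfl⟩ := Fin.exists_succAbove_eq (x := j) (y := i) fun e => h (by rw [e])
    exact ⟨j', rfl⟩

theorem chainSupport_eq_insert {c : Fin (m + 1) ↪o P} {g : Fin m ↪o P} {u : P}
    (huc : u ∈ chainSupport c) (hug : u ∉ chainSupport g)
    (h : chainSupport g ⊆ chainSupport c) : chainSupport c = insert u (chainSupport g) := by
  refine (Finset.eq_of_subset_of_card_le (Finset.insert_subset huc h) ?_).symm
  rw [Finset.card_insert_of_notMem hug, card_chainSupport, card_chainSupport]

theorem exists_chainSupport_eq_insert {F : Finset P} (hF : IsChain (· ≤ ·) (F : Set P))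
    {g : Fin m ↪o P} (hg : chainSupport g ⊆ F) {u : P} (huF : u ∈ F) (hug : u ∉ chainSupport g) :
    ∃ c : Fin (m + 1) ↪o P, chainSupport c = insert u (chainSupport g) :=
  exists_chainSupport_eq (hF.mono (Finset.coe_subset.2 (Finset.insert_subset huF hg)))
    (by rw [Finset.card_insert_of_notMem hug, card_chainSupport])

theorem exists_chainSupport_eq_erase {c : Fin (m + 1) ↪o P} {u : P} (hu : u ∈ chainSupport c) :
    ∃ g : Fin m ↪o P, chainSupport g = (chainSupport c).erase u := by
  obtain ⟨i, rfl⟩ := mem_chainSupport.1 hu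
  exact ⟨_, chainSupport_succAbove c i⟩

end ChainSupport

section Incidence

variable {P : Type*} [PartialOrder P] {k : Type*} [CommRing k] {m : ℕ}

theorem orderBoundary_single (c : Fin (m + 1) ↪o P) (a : k) :
    orderBoundary k P m (Finsupp.single c a) = ∑ i : Fin (m + 1),
      Finsupp.single ((Fin.succAboveOrderEmb i).trans c) (a * (-1) ^ i.val) := by
  simp [orderBoundary, Finset.smul_sum]

variable (k) in
/-- The incidence number of two chains: the coefficient of `g` in the boundary of `c`. -/
noncomputable def incidence (c : Fin (m + 1) ↪o P) (g : Fin m ↪o P) : k :=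
  orderBoundary k P m (Finsupp.single c 1) g

theorem orderBoundary_apply (z : OrderChain k P (m + 1)) (g : Fin m ↪o P) :
    orderBoundary k P m z g = z.sum fun c a => a * incidence k c g := by
  simp [incidence, orderBoundary, Finsupp.linearCombination_apply]

theorem incidence_eq_zero {c : Fin (m + 1) ↪o P} {g : Fin m ↪o P}
    (h : ¬ chainSupport g ⊆ chainSupport c) : incidence k c g = 0 := by
  classical
  rw [incidence, orderBoundary_single, Finsupp.finsetSum_apply]
  refine Finset.sum_eq_zero fun i _ => Finsupp.single_eq_of_ne fun e => h ?_
  rw [e, chainSupport_succAbove]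
  exact Finset.erase_subset _ _

theorem incidence_succAbove (c : Fin (m + 1) ↪o P) (i : Fin (m + 1)) :
    incidence k c ((Fin.succAboveOrderEmb i).trans c) = (-1) ^ i.val := by
  classical
  rw [incidence, orderBoundary_single, Finsupp.finsetSum_apply,
    Finset.sum_eq_single_of_mem i (Finset.mem_univ i)]
  · simp
  · intro j _ hji
    refine Finsupp.single_eq_of_ne fun e => ?_
    have hmem : c i ∈ (chainSupport c).erase (c j) :=
      Finset.mem_erase.2 ⟨fun e => hji (c.injective e).symm, mem_chainSupport.2 ⟨i, rfl⟩⟩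
    rw [← chainSupport_succAbove, ← e, chainSupport_succAbove] at hmem
    exact Finset.notMem_erase _ _ hmem

theorem incidence_mul_self {c : Fin (m + 1) ↪o P} {g : Fin m ↪o P}
    (h : chainSupport g ⊆ chainSupport c) : incidence k c g * incidence k c g = 1 := by
  classical
  obtain ⟨x, hxc, hxg⟩ : ∃ x ∈ chainSupport c, x ∉ chainSupport g := by
    refine Finset.exists_mem_notMem_of_card_lt_card ?_
    rw [card_chainSupport, card_chainSupport]
    exact Nat.lt_succ_self m
  obtain ⟨i, rfl⟩ := mem_chainSupport.1 hxc
  obtain rfl : (Fin.succAboveOrderEmb i).trans c = g := by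
    refine chainSupport_injective ?_
    rw [chainSupport_succAbove, chainSupport_eq_insert hxc hxg h, Finset.erase_insert hxg]
  rw [incidence_succAbove, ← pow_add, Even.neg_one_pow ⟨_, rfl⟩]

theorem orderBoundary_orderBoundary (z : OrderChain k P (m + 2)) :
    orderBoundary k P m (orderBoundary k P (m + 1) z) = 0 := by
  suffices h : orderBoundary k P m ∘ₗ orderBoundary k P (m + 1) = 0 from
    LinearMap.congr_fun h z
  ext1 c
  refine LinearMap.ext_ring ?_
  simp only [LinearMap.comp_apply, Finsupp.lsingle_apply, LinearMap.zero_apply,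
    orderBoundary_single, map_sum, one_mul, ← pow_add]
  rw [← Fintype.sum_prod_type' (f := fun i j =>
      Finsupp.single ((Fin.succAboveOrderEmb j).trans ((Fin.succAboveOrderEmb i).trans c))
        ((-1 : k) ^ (i.val + j.val)))]
  -- The two orders in which a pair of elements can be deleted cancel.
  refine Finset.sum_involution (fun x _ => (x.1.succAbove x.2, x.2.predAbove x.1)) ?_ ?_ ?_ ?_
  · rintro ⟨i, j⟩ -
    have : (Fin.succAboveOrderEmb (j.predAbove i)).trans
        ((Fin.succAboveOrderEmb (i.succAbove j)).trans c) =
        (Fin.succAboveOrderEmb j).trans ((Fin.succAboveOrderEmb i).trans c) := by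
      ext1 l
      simp [Fin.succAbove_succAbove_succAbove_predAbove]
    dsimp only
    rw [this, ← Finsupp.single_add, Fin.neg_one_pow_succAbove_add_predAbove, add_neg_cancel,
      Finsupp.single_zero]
  · rintro ⟨i, j⟩ - - h
    exact Fin.succAbove_ne i j (congrArg Prod.fst h)
  · simp
  · rintro ⟨i, j⟩ -
    simp [Fin.succAbove_succAbove_predAbove, Fin.predAbove_predAbove_succAbove]

theorem range_orderBoundary_le_orderCycles :
    LinearMap.range (orderBoundary k P m) ≤ orderCycles k P m := by
  rintro _ ⟨z, rfl⟩
  cases m with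
  | zero => trivial
  | succ m => exact orderBoundary_orderBoundary z

theorem eq_zero_of_mem_orderCycles {z : OrderChain k P (m + 1)}
    (hz : z ∈ orderCycles k P (m + 1)) {c : Fin (m + 1) ↪o P} {g : Fin m ↪o P}
    (hgc : chainSupport g ⊆ chainSupport c)
    (h : ∀ c', z c' ≠ 0 → chainSupport g ⊆ chainSupport c' → c' = c) : z c = 0 := by
  have hsum : z.sum (fun c' a => a * incidence k c' g) = 0 := by
    rw [← orderBoundary_apply, LinearMap.mem_ker.1 hz, Finsupp.zero_apply]
  rw [Finsupp.sum_eq_single c ?_ (by simp)] at hsum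
  · rw [← mul_one (z c), ← incidence_mul_self hgc, ← mul_assoc, hsum, zero_mul]
  · intro c' hc' hne
    rw [incidence_eq_zero fun hg => hne (h c' hc' hg), mul_zero]

theorem IsRestriction.apply_eq_zero_of_mem_orderCycles {F R : Finset P} {S : List (Finset P)}
    (hR : IsRestriction F S R) {u : P} (huR : u ∉ R) {z : OrderChain k P m}
    (hz : z ∈ orderCycles k P m)
    (hsupp : ∀ g, z g ≠ 0 → chainSupport g ⊆ F ∨ ∃ E ∈ S, chainSupport g ⊆ E)
    (hzu : ∀ g, chainSupport g ⊆ F → u ∉ chainSupport g → z g = 0) {g : Fin m ↪o P}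
    (hgF : chainSupport g ⊆ F) (hRg : R ⊆ chainSupport g) : z g = 0 := by
  classical
  by_cases hug : u ∉ chainSupport g
  · exact hzu g hgF hug
  rw [not_not] at hug
  cases m with
  | zero => simp [chainSupport] at hug
  | succ m =>
    obtain ⟨g', hg'⟩ := exists_chainSupport_eq_erase hug
    have hg'g : chainSupport g' ⊆ chainSupport g := hg' ▸ Finset.erase_subset _ _
    have hRg' : R ⊆ chainSupport g' := hg' ▸ Finset.subset_erase.2 ⟨hRg, huR⟩
    have hug' : u ∉ chainSupport g' := hg' ▸ Finset.notMem_erase _ _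
    refine eq_zero_of_mem_orderCycles hz hg'g fun c hzc hg'c => chainSupport_injective ?_
    have hcF : chainSupport c ⊆ F := (hsupp c hzc).resolve_right fun ⟨E, hE, hcE⟩ =>
      (hR.2 _ (hg'g.trans hgF)).1 ⟨E, hE, hg'c.trans hcE⟩ hRg'
    have huc : u ∈ chainSupport c := by
      by_contra huc
      exact hzc (hzu c hcF huc)
    rw [chainSupport_eq_insert huc hug' hg'c, chainSupport_eq_insert hug hug' hg'g]

end Incidence

section Cone

variable {P : Type*} [PartialOrder P] [Finite P] {k : Type*} [CommRing k] {m : ℕ}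

instance (m : ℕ) : Finite (Fin m ↪o P) := DFunLike.finite _

open Classical in
/-- The cone with apex `u` over the part of the chain `z` that lies in the face `F`: a chain `c`
through `u` inside `F` gets the coefficient of `c` without `u` in `z`, with the sign for which the
boundary of the cone agrees with `z` on the chains in `F` that avoid `u`. -/
noncomputable def orderCone (F : Finset P) (u : P) (z : OrderChain k P m) :
    OrderChain k P (m + 1) :=
  Finsupp.equivFunOnFinite.symm fun c =>
    if u ∈ chainSupport c ∧ chainSupport c ⊆ F then
      z.sum fun g a => if u ∈ chainSupport g then 0 else a * incidence k c g
    else 0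

theorem mem_of_orderCone_ne_zero {F : Finset P} {u : P} {z : OrderChain k P m}
    {c : Fin (m + 1) ↪o P} (h : orderCone F u z c ≠ 0) :
    u ∈ chainSupport c ∧ chainSupport c ⊆ F := by
  by_contra hc
  exact h (if_neg hc)

theorem orderCone_apply {F : Finset P} {u : P} (z : OrderChain k P m) {c : Fin (m + 1) ↪o P}
    {g : Fin m ↪o P} (hc : u ∈ chainSupport c ∧ chainSupport c ⊆ F) (hug : u ∉ chainSupport g)
    (hgc : chainSupport g ⊆ chainSupport c) : orderCone F u z c = z g * incidence k c g := by
  classical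
  refine (if_pos hc).trans ((Finsupp.sum_eq_single g (fun g' _ hne => ?_) (by simp)).trans
    (if_neg hug))
  refine ite_eq_left_iff.2 fun hug' => ?_
  rw [incidence_eq_zero, mul_zero]
  intro hgc'
  refine hne (chainSupport_injective ?_)
  rw [← Finset.erase_insert hug', ← chainSupport_eq_insert hc.1 hug' hgc',
    chainSupport_eq_insert hc.1 hug hgc, Finset.erase_insert hug]

theorem orderBoundary_orderCone_of_not_subset {F : Finset P} {u : P} (z : OrderChain k P m)
    {g : Fin m ↪o P} (hg : ¬ chainSupport g ⊆ F) :
    orderBoundary k P m (orderCone F u z) g = 0 := by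
  rw [orderBoundary_apply]
  refine Finset.sum_eq_zero fun c hc => ?_
  have hcF := (mem_of_orderCone_ne_zero (Finsupp.mem_support_iff.1 hc)).2
  dsimp only
  rw [incidence_eq_zero fun hgc => hg (hgc.trans hcF), mul_zero]

theorem orderBoundary_orderCone {F : Finset P} (hF : IsChain (· ≤ ·) (F : Set P)) {u : P}
    (huF : u ∈ F) (z : OrderChain k P m) {g : Fin m ↪o P} (hg : chainSupport g ⊆ F)
    (hug : u ∉ chainSupport g) : orderBoundary k P m (orderCone F u z) g = z g := by
  classical
  obtain ⟨c, hc⟩ := exists_chainSupport_eq_insert hF hg huF hug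
  have hgc : chainSupport g ⊆ chainSupport c := hc ▸ Finset.subset_insert _ _
  have hcF : u ∈ chainSupport c ∧ chainSupport c ⊆ F :=
    hc ▸ ⟨Finset.mem_insert_self _ _, Finset.insert_subset huF hg⟩
  rw [orderBoundary_apply, Finsupp.sum_eq_single c _ (by simp), orderCone_apply z hcF hug hgc,
    mul_assoc, incidence_mul_self hgc, mul_one]
  intro c' hc' hne
  rw [incidence_eq_zero, mul_zero]
  intro hgc'
  refine hne (chainSupport_injective ?_)
  rw [hc, chainSupport_eq_insert (mem_of_orderCone_ne_zero hc').1 hug hgc']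

/-- The cycle is pushed off the last facet along the cone whose apex `u` is a vertex outside the
restriction. -/
theorem IsRestriction.exists_subset_of_sub_orderBoundary_ne_zero {F R : Finset P}
    {S : List (Finset P)} (hR : IsRestriction F S R) (hF : IsChain (· ≤ ·) (F : Set P)) {u : P}
    (huF : u ∈ F) (huR : u ∉ R) {z : OrderChain k P m} (hz : z ∈ orderCycles k P m)
    (hsupp : ∀ g, z g ≠ 0 → ∃ E ∈ F :: S, chainSupport g ⊆ E) {g : Fin m ↪o P}
    (hg : (z - orderBoundary k P m (orderCone F u z)) g ≠ 0) :
    ∃ E ∈ S, chainSupport g ⊆ E := by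
  have hsupp' : ∀ g, (z - orderBoundary k P m (orderCone F u z)) g ≠ 0 →
      chainSupport g ⊆ F ∨ ∃ E ∈ S, chainSupport g ⊆ E := by
    intro g hg
    refine or_iff_not_imp_left.2 fun hgF => ?_
    rw [Finsupp.sub_apply, orderBoundary_orderCone_of_not_subset z hgF, sub_zero] at hg
    simpa [hgF] using hsupp g hg
  by_contra hgS
  have hgF := (hsupp' g hg).resolve_right hgS
  refine hg (hR.apply_eq_zero_of_mem_orderCycles huR (Submodule.sub_mem _ hz
    (range_orderBoundary_le_orderCycles (LinearMap.mem_range_self _ _))) hsupp' ?_ hgF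
    (not_not.1 fun h => hgS ((hR.2 _ hgF).2 h)))
  intro g' hg'F hug'
  rw [Finsupp.sub_apply, orderBoundary_orderCone hF huF z hg'F hug', sub_self]

theorem IsReverseShelling.mem_range_orderBoundary {S : List (Finset P)} (hS : IsReverseShelling S)
    (hcard : ∀ F ∈ S, m < F.card) (hchain : ∀ F ∈ S, IsChain (· ≤ ·) (F : Set P))
    (z : OrderChain k P m) (hz : z ∈ orderCycles k P m)
    (hsupp : ∀ g, z g ≠ 0 → ∃ E ∈ S, chainSupport g ⊆ E) :
    z ∈ LinearMap.range (orderBoundary k P m) := by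
  induction hS generalizing z with
  | nil =>
    obtain rfl : z = 0 := by
      ext g
      by_contra hg
      simpa using hsupp g hg
    exact Submodule.zero_mem _
  | cons F S _ h ih =>
    rw [List.forall_mem_cons] at hcard hchain
    specialize ih hcard.2 hchain.2
    obtain ⟨R, hR⟩ := exists_isRestriction h
    by_cases hRF : R = F
    · refine ih z hz fun g hg => ?_
      obtain ⟨E, hE, hgE⟩ := hsupp g hg
      rcases List.mem_cons.1 hE with rfl | hE
      · refine (hR.2 _ hgE).2 fun hRg => hcard.1.not_ge ?_
        rw [← card_chainSupport g]
        exact Finset.card_le_card (hRF ▸ hRg)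
      · exact ⟨E, hE, hgE⟩
    · obtain ⟨u, huF, huR⟩ := Finset.exists_of_ssubset (hR.1.ssubset_of_ne hRF)
      have hB := LinearMap.mem_range_self (orderBoundary k P m) (orderCone F u z)
      rw [← sub_add_cancel z (orderBoundary k P m (orderCone F u z))]
      exact Submodule.add_mem _ (ih _
        (Submodule.sub_mem _ hz (range_orderBoundary_le_orderCycles hB)) fun g =>
          hR.exists_subset_of_sub_orderBoundary_ne_zero hchain.1 huF huR hz hsupp) hB

end Cone

section Rank

variable {k : Type*} [CommRing k]

theorem subquotientRank_eq_zero {M : Type*} [AddCommGroup M] [Module k M] [Nontrivial k]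
    {Z B : Submodule k M} (h : Z ≤ B) : subquotientRank Z B = 0 := by
  have : Subsingleton (Subquotient Z B) :=
    Submodule.Quotient.subsingleton_iff.2 (Submodule.comap_subtype_eq_top.2 h)
  exact Module.finrank_zero_of_subsingleton

theorem subquotientRank_bot {M : Type*} [AddCommGroup M] [Module k M] (Z : Submodule k M) :
    subquotientRank Z ⊥ = Module.finrank k Z :=
  (Submodule.quotEquivOfEqBot _ (by simp [Submodule.submoduleOf])).finrank_eq

variable {P : Type*} [PartialOrder P] {m : ℕ}

theorem reducedBetti_natCast_sub_one (k : Type*) [CommRing k] (P : Type*) [PartialOrder P]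
    (m : ℕ) : reducedBetti k P ((m : ℤ) - 1) =
      subquotientRank (orderCycles k P m) (LinearMap.range (orderBoundary k P m)) := by
  rw [reducedBetti, if_neg (by lia), sub_add_cancel, Int.toNat_natCast]

theorem sum_neg_one_pow_card {K : Finset (Finset P)}
    (hK : ∀ G : Finset P, G ∈ K ↔ IsChain (· ≤ ·) (G : Set P)) {d : ℕ}
    (hd : ∀ G ∈ K, G.card ≤ d) : ∑ G ∈ K, (-1 : ℤ) ^ G.card =
      ∑ j ∈ Finset.range (d + 1), (-1 : ℤ) ^ j * Nat.card (Fin j ↪o P) := by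
  rw [← Finset.sum_fiberwise_of_maps_to (t := Finset.range (d + 1)) (g := Finset.card)
    fun G hG => Finset.mem_range_succ_iff.2 (hd G hG)]
  refine Finset.sum_congr rfl fun j _ => ?_
  rw [card_orderEmbedding hK, Finset.sum_congr rfl fun G hG => by
    rw [(Finset.mem_filter.1 hG).2], Finset.sum_const, nsmul_eq_mul, mul_comm]

variable [Finite P]

theorem finrank_orderChain [Nontrivial k] :
    Module.finrank k (OrderChain k P m) = Nat.card (Fin m ↪o P) := by
  have := Fintype.ofFinite (Fin m ↪o P)
  rw [Module.finrank_finsupp_self, Nat.card_eq_fintype_card]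

theorem finrank_range_orderBoundary_add_finrank_orderCycles [IsDomain k] :
    Module.finrank k (LinearMap.range (orderBoundary k P m)) +
      Module.finrank k (orderCycles k P (m + 1)) = Nat.card (Fin (m + 1) ↪o P) := by
  rw [← finrank_orderChain (k := k), ← (orderBoundary k P m).quotKerEquivRange.finrank_eq]
  exact Submodule.finrank_quotient_add_finrank _

theorem finrank_orderCycles_of_exact [IsDomain k]
    (h : ∀ j < m, orderCycles k P j ≤ LinearMap.range (orderBoundary k P j)) :
    (Module.finrank k (orderCycles k P m) : ℤ) =
      (-1) ^ m * ∑ j ∈ Finset.range (m + 1), (-1 : ℤ) ^ j * Nat.card (Fin j ↪o P) := by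
  induction m with
  | zero =>
    have htop : Module.finrank k (orderCycles k P 0) = Nat.card (Fin 0 ↪o P) :=
      (finrank_top _ _).trans finrank_orderChain
    simp [htop]
  | succ m ih =>
    have hrank := finrank_range_orderBoundary_add_finrank_orderCycles (k := k) (P := P) (m := m)
    rw [le_antisymm range_orderBoundary_le_orderCycles (h m m.lt_succ_self)] at hrank
    rw [Finset.sum_range_succ, ← hrank, mul_add, ← mul_assoc, ← pow_add,
      Even.neg_one_pow ⟨_, rfl⟩, one_mul, pow_succ, mul_neg_one, neg_mul,
      ← ih fun j hj => h j (hj.trans m.lt_succ_self)]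
    push_cast
    ring

theorem IsReverseShelling.reducedBetti_eq [IsDomain k]
    {S : List (Finset P)} (hS : IsReverseShelling S)
    {d : ℕ} (hcard : ∀ F ∈ S, F.card = d) {K : Finset (Finset P)}
    (hK : ∀ G : Finset P, G ∈ K ↔ IsChain (· ≤ ·) (G : Set P))
    (hKS : ∀ G, G ∈ K ↔ ∃ F ∈ S, G ⊆ F) {b : ℕ}
    (hχ : ∑ G ∈ K, (-1 : ℤ) ^ G.card = (-1) ^ d * b)
    (i : ℤ) : reducedBetti k P i = if i = (d : ℤ) - 1 then b else 0 := by
  have hsupp : ∀ {m : ℕ} (g : Fin m ↪o P), ∃ F ∈ S, chainSupport g ⊆ F := fun g =>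
    (hKS _).1 ((hK _).2 (isChain_chainSupport g))
  have hdim : ∀ G ∈ K, G.card ≤ d := fun G hG => by
    obtain ⟨F, hF, hGF⟩ := (hKS G).1 hG
    exact hcard F hF ▸ Finset.card_le_card hGF
  have hexact : ∀ m < d, orderCycles k P m ≤ LinearMap.range (orderBoundary k P m) :=
    fun m hm z hz => hS.mem_range_orderBoundary (fun F hF => hm.trans_eq (hcard F hF).symm)
      (fun F hF => (hK F).1 ((hKS F).2 ⟨F, hF, subset_rfl⟩)) z hz fun g _ => hsupp g
  have hempty : ∀ m, d < m → IsEmpty (Fin m ↪o P) := fun m hm => ⟨fun g => hm.not_ge <|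
    card_chainSupport g ▸ hdim _ ((hK _).2 (isChain_chainSupport g))⟩
  rcases lt_or_ge i (-1) with hi | hi
  · rw [reducedBetti, if_pos hi, if_neg (by lia)]
  obtain ⟨m, rfl⟩ : ∃ m : ℕ, i = (m : ℤ) - 1 := ⟨(i + 1).toNat, by lia⟩
  rw [reducedBetti_natCast_sub_one]
  rcases lt_trichotomy m d with hlt | rfl | hgt
  · rw [subquotientRank_eq_zero (hexact m hlt), if_neg (by lia)]
  · have := hempty (m + 1) m.lt_succ_self
    rw [LinearMap.range_eq_bot.2 (Subsingleton.elim _ 0), subquotientRank_bot, if_pos rfl]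
    have hrank := finrank_orderCycles_of_exact hexact
    rw [← sum_neg_one_pow_card hK hdim, hχ, ← mul_assoc, ← pow_add, Even.neg_one_pow ⟨_, rfl⟩,
      one_mul] at hrank
    exact_mod_cast hrank
  · have := hempty m hgt
    rw [subquotientRank_eq_zero fun z _ => Subsingleton.elim 0 z ▸ Submodule.zero_mem _,
      if_neg (by lia)]

end Rank

/-! ### The Euler characteristic of the proper part -/

section ChainsBelow

variable {Q : Type*} [PartialOrder Q] [Fintype Q]

open Classical in
/-- The chains all of whose elements lie strictly below `ρ`; for `ρ = ⊤` these are, together with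
the empty chain, the faces of the order complex of the proper part. -/
noncomputable def chainsBelow (ρ : Q) : Finset (Finset Q) :=
  Finset.univ.filter fun G => IsChain (· ≤ ·) (G : Set Q) ∧ ∀ x ∈ G, x < ρ

variable {π ρ : Q} {G : Finset Q}

theorem mem_chainsBelow :
    G ∈ chainsBelow ρ ↔ IsChain (· ≤ ·) (G : Set Q) ∧ ∀ x ∈ G, x < ρ := by
  simp [chainsBelow]

theorem notMem_of_mem_chainsBelow (hG : G ∈ chainsBelow π) : π ∉ G :=
  fun h => lt_irrefl π ((mem_chainsBelow.1 hG).2 π h)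

theorem insert_mem_chainsBelow [DecidableEq Q] (hπ : π < ρ) (hG : G ∈ chainsBelow π) :
    insert π G ∈ chainsBelow ρ := by
  rw [mem_chainsBelow] at hG ⊢
  refine ⟨?_, ?_⟩
  · rw [Finset.coe_insert]
    exact hG.1.insert fun b hb _ => Or.inr (hG.2 b hb).le
  · rw [Finset.forall_mem_insert]
    exact ⟨hπ, fun x hx => (hG.2 x hx).trans hπ⟩

theorem eq_of_insert_eq_insert [DecidableEq Q] {π' : Q} {G' : Finset Q}
    (hG : G ∈ chainsBelow π) (hG' : G' ∈ chainsBelow π') (h : insert π G = insert π' G') :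
    π = π' ∧ G = G' := by
  have hle : ∀ {σ τ : Q} {H : Finset Q}, H ∈ chainsBelow τ → σ ∈ insert τ H → σ ≤ τ := by
    intro σ τ H hH hσ
    rcases Finset.mem_insert.1 hσ with rfl | hσ
    · exact le_rfl
    · exact ((mem_chainsBelow.1 hH).2 σ hσ).le
  obtain rfl : π = π' := le_antisymm (hle hG' (h ▸ Finset.mem_insert_self π G))
    (hle hG (h.symm ▸ Finset.mem_insert_self π' G'))
  refine ⟨rfl, ?_⟩
  rw [← Finset.erase_insert (notMem_of_mem_chainsBelow hG), h,
    Finset.erase_insert (notMem_of_mem_chainsBelow hG')]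

theorem exists_insert_eq_of_mem_chainsBelow [DecidableEq Q] (hG : G ∈ chainsBelow ρ)
    (hne : G.Nonempty) : ∃ π < ρ, ∃ G' ∈ chainsBelow π, insert π G' = G := by
  obtain ⟨hch, hlt⟩ := mem_chainsBelow.1 hG
  obtain ⟨π, hπ, hmax⟩ := G.exists_maximal hne
  have hle : ∀ x ∈ G, x ≤ π := fun x hx => (hch.total hx hπ).elim id fun h => hmax hx h
  refine ⟨π, hlt π hπ, G.erase π, mem_chainsBelow.2
    ⟨hch.mono (Finset.coe_subset.2 (Finset.erase_subset _ _)), fun x hx => ?_⟩,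
    Finset.insert_erase hπ⟩
  rw [Finset.mem_erase] at hx
  exact lt_of_le_of_ne (hle x hx.2) hx.1

theorem sum_chainsBelow [DecidableLT Q] (ρ : Q) :
    ∑ G ∈ chainsBelow ρ, (-1 : ℤ) ^ G.card =
      1 - ∑ π with π < ρ, ∑ G ∈ chainsBelow π, (-1 : ℤ) ^ G.card := by
  classical
  have hempty : ∅ ∈ chainsBelow ρ := by simp [mem_chainsBelow]
  rw [← Finset.add_sum_erase _ _ hempty, Finset.card_empty, pow_zero, sub_eq_add_neg,
    add_right_inj, Finset.sum_sigma', ← Finset.sum_neg_distrib, eq_comm]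
  -- A nonempty chain is its largest element together with a chain below that element.
  refine Finset.sum_bij (fun x _ => insert x.1 x.2) ?_ ?_ ?_ ?_
  · rintro ⟨π, G⟩ h
    simp only [Finset.mem_sigma, Finset.mem_filter, Finset.mem_univ, true_and] at h
    exact Finset.mem_erase.2 ⟨Finset.insert_ne_empty _ _, insert_mem_chainsBelow h.1 h.2⟩
  · rintro ⟨π, G⟩ h ⟨π', G'⟩ h' he
    obtain ⟨rfl, rfl⟩ :=
      eq_of_insert_eq_insert (Finset.mem_sigma.1 h).2 (Finset.mem_sigma.1 h').2 he
    rfl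
  · intro G hG
    obtain ⟨hne, hG⟩ := Finset.mem_erase.1 hG
    obtain ⟨π, hπ, G', hG', rfl⟩ :=
      exists_insert_eq_of_mem_chainsBelow hG (Finset.nonempty_iff_ne_empty.2 hne)
    exact ⟨⟨π, G'⟩, by simp [hπ, hG'], rfl⟩
  · rintro ⟨π, G⟩ h
    rw [Finset.card_insert_of_notMem (notMem_of_mem_chainsBelow (Finset.mem_sigma.1 h).2), pow_succ,
      mul_neg_one]

/-- Möbius inversion: both sides are the negative of the Möbius function from an adjoined bottom
element. -/
theorem sum_chainsBelow_eq_of_sum_le [DecidableLE Q] {w : Q → ℤ}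
    (hw : ∀ ρ, ∑ π with π ≤ ρ, w π = 1) (ρ : Q) :
    ∑ G ∈ chainsBelow ρ, (-1 : ℤ) ^ G.card = w ρ := by
  classical
  induction ρ using WellFoundedLT.induction with
  | ind ρ ih =>
    have hsplit : (Finset.univ.filter fun π => π ≤ ρ) =
        insert ρ (Finset.univ.filter fun π => π < ρ) := by
      ext π
      simp [le_iff_eq_or_lt]
    have hsum := hw ρ
    rw [hsplit, Finset.sum_insert (by simp)] at hsum
    rw [sum_chainsBelow, Finset.sum_congr rfl fun π hπ => ih π (Finset.mem_filter.1 hπ).2,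
      sub_eq_iff_eq_add, hsum]

theorem sum_isChain_proper [OrderTop Q] {K : Finset (Finset {q : Q // q ≠ ⊤})}
    (hK : ∀ G, G ∈ K ↔ IsChain (· ≤ ·) (G : Set {q : Q // q ≠ ⊤})) :
    ∑ G ∈ K, (-1 : ℤ) ^ G.card = ∑ G ∈ chainsBelow (⊤ : Q), (-1 : ℤ) ^ G.card := by
  classical
  refine Finset.sum_bij (fun G _ => G.map (Function.Embedding.subtype _)) ?_
    (fun G _ G' _ h => Finset.map_injective _ h) ?_ (fun G _ => by rw [Finset.card_map])
  · intro G hG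
    rw [mem_chainsBelow, Finset.coe_map]
    refine ⟨?_, fun x hx => ?_⟩
    · rintro _ ⟨x, hx, rfl⟩ _ ⟨y, hy, rfl⟩ _
      exact ((hK G).1 hG).total hx hy
    · obtain ⟨y, -, rfl⟩ := Finset.mem_map.1 hx
      exact lt_top_iff_ne_top.2 y.2
  · intro G hG
    rw [mem_chainsBelow] at hG
    refine ⟨G.subtype fun q => q ≠ ⊤, (hK _).2 fun x hx y hy _ => ?_,
      Finset.subtype_map_of_mem fun x hx => (hG.2 x hx).ne⟩
    exact hG.1.total (Finset.mem_subtype.1 hx) (Finset.mem_subtype.1 hy)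

end ChainsBelow

section PartitionSum

variable {α : Type*} [DecidableEq α] {S T : Finset α}

theorem exists_parts_eq_erase (P : Finpartition S) (hT : T ∈ P.parts) :
    ∃ P' : Finpartition (S \ T), P'.parts = P.parts.erase T := by
  refine ⟨P.ofSubset (Finset.erase_subset T _) ?_, rfl⟩
  ext a
  simp only [Finset.mem_sup, Finset.mem_erase, id, Finset.mem_sdiff]
  constructor
  · rintro ⟨B, ⟨hBT, hB⟩, haB⟩
    exact ⟨P.le hB haB, fun haT => hBT (P.eq_of_mem_parts hB hT haB haT)⟩
  · rintro ⟨haS, haT⟩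
    obtain ⟨B, hB, haB⟩ := P.exists_mem haS
    exact ⟨B, ⟨fun h => haT (h ▸ haB), hB⟩, haB⟩

theorem exists_parts_eq_insert (hT : T.Nonempty) (hTS : T ⊆ S) (P : Finpartition (S \ T)) :
    ∃ P' : Finpartition S, P'.parts = insert T P.parts :=
  ⟨P.extend hT.ne_empty Finset.sdiff_disjoint (Finset.sdiff_union_of_subset hTS), rfl⟩

theorem notMem_parts_sdiff (hT : T.Nonempty) (P : Finpartition (S \ T)) : T ∉ P.parts := by
  intro h
  obtain ⟨a, ha⟩ := hT
  exact (Finset.mem_sdiff.1 (P.le h ha)).2 ha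

theorem sum_prod_parts_eq_sum_powerset {R : Type*} [CommSemiring R] (p : Finset α → Prop)
    [DecidablePred p] (w : Finset α → R) {x : α} (hx : x ∈ S) :
    ∑ P : Finpartition S with ∀ B ∈ P.parts, p B, ∏ B ∈ P.parts, w B =
      ∑ T ∈ S.powerset with x ∈ T ∧ p T,
        w T * ∑ P : Finpartition (S \ T) with ∀ B ∈ P.parts, p B, ∏ B ∈ P.parts, w B := by
  simp only [Finset.mul_sum]
  rw [Finset.sum_sigma']
  have hpart : ∀ P : Finpartition S, P.part x ∈ P.parts := fun P => P.part_mem.2 hx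
  choose rest hrest using fun P : Finpartition S => exists_parts_eq_erase P (hpart P)
  refine Finset.sum_bij (fun P _ => ⟨P.part x, rest P⟩) ?_ ?_ ?_ ?_
  · intro P hP
    simp only [Finset.mem_sigma, Finset.mem_filter, Finset.mem_univ, true_and,
      Finset.mem_powerset, hrest] at hP ⊢
    exact ⟨⟨P.part_subset x, P.mem_part hx, hP _ (hpart P)⟩,
      fun B hB => hP B (Finset.mem_of_mem_erase hB)⟩
  · intro P _ P' _ h
    obtain ⟨hxx, hr⟩ := Sigma.mk.inj_iff.1 h
    refine Finpartition.ext ?_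
    have hparts : (rest P).parts = (rest P').parts := by
      congr 1
      simp [hxx]
    rw [← Finset.insert_erase (hpart P), ← hrest, hparts, hrest, hxx,
      Finset.insert_erase (hpart P')]
  · rintro ⟨T, P'⟩ h
    simp only [Finset.mem_sigma, Finset.mem_filter, Finset.mem_univ, true_and,
      Finset.mem_powerset] at h
    obtain ⟨⟨hTS, hxT, hpT⟩, hp⟩ := h
    obtain ⟨P, hP⟩ := exists_parts_eq_insert ⟨x, hxT⟩ hTS P'
    obtain rfl : P.part x = T := P.part_eq_of_mem (hP ▸ Finset.mem_insert_self T _) hxT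
    refine ⟨P, ?_, ?_⟩
    · simp only [Finset.mem_filter, Finset.mem_univ, true_and, hP, Finset.forall_mem_insert]
      exact ⟨hpT, hp⟩
    · congr 1
      refine Finpartition.ext ?_
      rw [hrest, hP, Finset.erase_insert (notMem_parts_sdiff ⟨x, hxT⟩ P')]
  · intro P _
    rw [hrest, Finset.mul_prod_erase _ _ (hpart P)]

theorem even_card_filter_sdiff {p : α → Prop} [DecidablePred p] (hTS : T ⊆ S)
    (hS : Even (S.filter p).card) (hT : Even (T.filter p).card) :
    Even ((S \ T).filter p).card := by
  have hle := Finset.filter_subset_filter p hTS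
  have hsdiff : (S \ T).filter p = S.filter p \ T.filter p := by
    ext a
    simp only [Finset.mem_filter, Finset.mem_sdiff]
    tauto
  rw [hsdiff, Finset.card_sdiff_of_subset hle, Nat.even_sub (Finset.card_le_card hle)]
  exact iff_of_true hS hT

theorem sum_prod_even_parts_eq_one {β : Type*} [DecidableEq β] (f : α → β) {c : ℕ → ℤ}
    (hc : ∀ (D : Finset α), ∀ x ∈ D, Even D.card →
      ∑ T ∈ D.powerset with x ∈ T ∧ Even T.card, c T.card = 1)
    (S : Finset α) (hS : ∀ b, Even (S.filter fun a => f a = b).card) :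
    ∑ P : Finpartition S with ∀ B ∈ P.parts, Even B.card ∧ ∀ y ∈ B, ∀ z ∈ B, f y = f z,
      ∏ B ∈ P.parts, c B.card = 1 := by
  induction S using Finset.strongInduction with
  | H S ih =>
    rcases S.eq_empty_or_nonempty with rfl | ⟨x, hx⟩
    · have : Unique (Finpartition (∅ : Finset α)) :=
        inferInstanceAs (Unique (Finpartition (⊥ : Finset α)))
      have hparts : ∀ P : Finpartition (∅ : Finset α), P.parts = ∅ := fun P => by
        simp [Subsingleton.elim P default]
      simp [hparts]
    rw [sum_prod_parts_eq_sum_powerset _ _ hx,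
      ← hc (S.filter fun a => f a = f x) x (by simp [hx]) (hS (f x))]
    have hset : (S.powerset.filter fun T => x ∈ T ∧ Even T.card ∧ ∀ y ∈ T, ∀ z ∈ T, f y = f z) =
        (S.filter fun a => f a = f x).powerset.filter fun T => x ∈ T ∧ Even T.card := by
      ext T
      simp only [Finset.mem_filter, Finset.mem_powerset, Finset.subset_iff]
      grind
    rw [hset]
    refine Finset.sum_congr rfl fun T hT => ?_
    simp only [Finset.mem_filter, Finset.mem_powerset] at hT
    obtain ⟨hTx, hxT, hTe⟩ := hT
    have hTS : T ⊆ S := hTx.trans (Finset.filter_subset _ _)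
    have hf : ∀ a ∈ T, f a = f x := fun a ha => (Finset.mem_filter.1 (hTx ha)).2
    rw [ih (S \ T) (Finset.sdiff_ssubset hTS ⟨x, hxT⟩) fun b => ?_, mul_one]
    refine even_card_filter_sdiff hTS (hS b) ?_
    by_cases hb : b = f x
    · rwa [Finset.filter_true_of_mem fun a ha => (hf a ha).trans hb.symm]
    · simp [Finset.filter_false_of_mem fun a ha (e : f a = b) => hb (e.symm.trans (hf a ha))]

end PartitionSum

section BlockWeight

/-- The weight `(-1)ʲ⁻¹ E₂ⱼ₋₁` of a block of size `m = 2j`; only even `m ≥ 2` are meaningful. -/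
noncomputable def blockWeight (m : ℕ) : ℤ := (-1) ^ (m / 2 - 1) * eulerNumber (m - 1)

theorem sum_powerset_mem {α M : Type*} [DecidableEq α] [AddCommMonoid M] {D : Finset α} {x : α}
    (hx : x ∈ D) (p : ℕ → Prop) [DecidablePred p] (c : ℕ → M) :
    ∑ T ∈ D.powerset with x ∈ T ∧ p T.card, c T.card =
      ∑ U ∈ (D.erase x).powerset, if p (U.card + 1) then c (U.card + 1) else 0 := by
  have hxU : ∀ U ∈ (D.erase x).powerset, x ∉ U := fun U hU hxU =>
    Finset.notMem_erase x D (Finset.mem_powerset.1 hU hxU)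
  rw [Finset.sum_filter, ← Finset.insert_erase hx,
    Finset.sum_powerset_insert (Finset.notMem_erase x D), Finset.erase_insert_eq_erase,
    Finset.erase_eq_of_notMem (Finset.notMem_erase x D),
    Finset.sum_eq_zero fun U hU => if_neg fun h => hxU U hU h.1, zero_add]
  refine Finset.sum_congr rfl fun U hU => ?_
  simp only [Finset.card_insert_of_notMem (hxU U hU), Finset.mem_insert_self, true_and]

theorem sum_blockWeight {α : Type*} [DecidableEq α] {D : Finset α} {x : α} (hx : x ∈ D)
    (hD : Even D.card) :
    ∑ T ∈ D.powerset with x ∈ T ∧ Even T.card, blockWeight T.card = 1 := by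
  obtain ⟨n, hcard⟩ : ∃ n, (D.erase x).card = 2 * n + 1 := by
    rw [← Finset.card_erase_add_one hx, Nat.even_add_one, Nat.not_even_iff_odd] at hD
    exact hD
  rw [sum_powerset_mem hx, Finset.sum_powerset_apply_card
    (fun m => if Even (m + 1) then blockWeight (m + 1) else 0), hcard,
    show 2 * n + 1 + 1 = 2 * (n + 1) by ring, sum_range_two_mul, ← sum_choose_mul_eulerNumber n]
  refine Finset.sum_congr rfl fun j _ => ?_
  have hj : (2 * j + 1 + 1) / 2 - 1 = j := by lia
  have heven : Even (2 * j + 1 + 1) := ⟨j + 1, by ring⟩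
  rw [if_neg (Nat.not_even_bit1 j), if_pos heven, blockWeight, hj, Nat.add_sub_cancel, smul_zero,
    zero_add, nsmul_eq_mul]
  push_cast
  ring

end BlockWeight

namespace EvenPartition

variable {n : ℕ}

theorem le_iff_forall_part_eq {π ρ : EvenPartition n} :
    π ≤ ρ ↔ ∀ B ∈ π.1.parts, ∀ a ∈ B, ∀ b ∈ B, ρ.1.part a = ρ.1.part b := by
  rw [le_iff_mem_part]
  constructor
  · intro h B hB a ha b hb
    exact part_eq_part (h a b (by rwa [π.1.part_eq_of_mem hB hb]))
  · intro h a b hab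
    rw [← h _ (π.1.part_mem.2 (Finset.mem_univ b)) a hab b (π.1.mem_part (Finset.mem_univ b))]
    exact ρ.1.mem_part (Finset.mem_univ a)

theorem even_card_filter_part_eq (ρ : EvenPartition n) (B : Finset (Fin (2 * n))) :
    Even (Finset.univ.filter fun a => ρ.1.part a = B).card := by
  rcases (Finset.univ.filter fun a => ρ.1.part a = B).eq_empty_or_nonempty with h | ⟨a, ha⟩
  · simp [h]
  · rw [Finset.mem_filter] at ha
    convert ρ.even_card_part a
    ext b
    rw [Finset.mem_filter, ρ.1.mem_part_iff_part_eq_part (by simp) (by simp), ha.2]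
    simp

open Classical in
theorem sum_prod_blockWeight (ρ : EvenPartition n) :
    ∑ π : EvenPartition n with π ≤ ρ, ∏ B ∈ π.1.parts, blockWeight B.card = 1 := by
  rw [← sum_prod_even_parts_eq_one ρ.1.part (fun D x => sum_blockWeight) Finset.univ
    ρ.even_card_filter_part_eq]
  refine Finset.sum_bij (fun π _ => π.1) ?_ (fun _ _ _ _ => Subtype.ext) ?_ fun _ _ => rfl
  · intro π hπ
    rw [Finset.mem_filter, le_iff_forall_part_eq] at hπ
    simp only [Finset.mem_filter, Finset.mem_univ, true_and]
    exact fun B hB => ⟨π.2 B hB, hπ.2 B hB⟩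
  · intro P hP
    simp only [Finset.mem_filter, Finset.mem_univ, true_and] at hP
    exact ⟨⟨P, fun B hB => (hP B hB).1⟩, Finset.mem_filter.2
      ⟨Finset.mem_univ _, le_iff_forall_part_eq.2 fun B hB => (hP B hB).2⟩, rfl⟩

theorem sum_isChain (hn : 1 ≤ n) {K : Finset (Finset (EvenPartitionProper n))}
    (hK : ∀ G, G ∈ K ↔ IsChain (· ≤ ·) (G : Set (EvenPartitionProper n))) :
    ∑ G ∈ K, (-1 : ℤ) ^ G.card = (-1) ^ (n - 1) * eulerNumber (2 * n - 1) := by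
  classical
  have htop : (⊤ : EvenPartition n).1.parts = {Finset.univ} :=
    Finset.eq_of_subset_of_card_le (Finpartition.parts_top_subset _)
      (by rw [card_parts_top hn, Finset.card_singleton])
  rw [sum_isChain_proper hK,
    sum_chainsBelow_eq_of_sum_le (w := fun π => ∏ B ∈ π.1.parts, blockWeight B.card)
      fun ρ => by convert sum_prod_blockWeight ρ,
    htop, Finset.prod_singleton, Finset.card_univ, Fintype.card_fin, blockWeight,
    Nat.mul_div_cancel_left n two_pos]

end EvenPartition

/-! ### Topology and homology of the proper part -/

theorem exists_isFacet_superset {V : Type*} [Finite V] {K : AbstractSimplicialComplex V}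
    {G : Finset V} (hG : G ∈ K) : ∃ F, K.IsFacet F ∧ G ⊆ F := by
  obtain ⟨F, hGF, hF⟩ := (Set.toFinite {F | F ∈ K}).exists_le_maximal hG
  exact ⟨F, hF, hGF⟩

theorem isChain_iff_exists_isFacet_superset {P : Type*} [PartialOrder P] [Finite P] [Nonempty P]
    {G : Finset P} :
    IsChain (· ≤ ·) (G : Set P) ↔ ∃ F, (orderComplex P).IsFacet F ∧ G ⊆ F := by
  constructor
  · intro hG
    rcases G.eq_empty_or_nonempty with rfl | hne
    · obtain ⟨F, hF, -⟩ :=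
        exists_isFacet_superset ((orderComplex P).singleton_mem (Classical.arbitrary P))
      exact ⟨F, hF, F.empty_subset⟩
    · exact exists_isFacet_superset (K := orderComplex P) ⟨hne, hG⟩
  · rintro ⟨F, hF, hGF⟩
    exact hF.prop.2.mono (Finset.coe_subset.2 hGF)

theorem isEmpty_realization {V : Type*} [IsEmpty V] (K : AbstractSimplicialComplex V) :
    IsEmpty K.realization := by
  refine ⟨fun w => ?_⟩
  obtain ⟨-, s, -, -, hsum⟩ := w.2
  simp [s.eq_empty_of_isEmpty] at hsum

theorem isEmpty_sphereWedge_zero (r : ℕ) : IsEmpty (SphereWedge r 0) := by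
  refine ⟨Quotient.ind fun p => ?_⟩
  have hnorm : ‖p.2.1‖ = 1 := mem_sphere_zero_iff_norm.1 p.2.2
  rw [Subsingleton.elim p.2.1 0, norm_zero] at hnorm
  exact zero_ne_one hnorm

namespace EvenPartition

variable {n : ℕ}

theorem exists_isRecursiveAtomOrdering (n : ℕ) :
    ∃ l : List (EvenPartition n), l.Pairwise (fun π ρ => π.word < ρ.word) ∧
      IsRecursiveAtomOrdering (⊥ : WithBot (EvenPartition n)) (l.map (↑)) := by
  obtain ⟨l, hl, hmem⟩ := exists_list_isMin n
  exact ⟨l, hl, isRecursiveAtomOrdering hl hmem⟩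

theorem exists_isShelling (hn : 2 ≤ n) :
    ∃ l, (orderComplex (EvenPartitionProper n)).IsShelling l ∧ IsReverseShelling l.reverse := by
  have := nonempty_proper hn
  obtain ⟨l, -, hl⟩ := exists_isRecursiveAtomOrdering n
  exact hl.exists_isShelling

theorem not_isFacet_one (F : Finset (EvenPartitionProper 1)) :
    ¬(orderComplex (EvenPartitionProper 1)).IsFacet F := by
  intro hF
  obtain ⟨x, -⟩ := hF.prop.1
  exact isEmpty_proper.elim x

theorem isPureOfDim (hn : 1 ≤ n) :
    (orderComplex (EvenPartitionProper n)).IsPureOfDim ((n : ℤ) - 2) := by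
  intro F hF
  rcases hn.eq_or_lt with rfl | hn
  · exact absurd hF (not_isFacet_one F)
  · have := card_of_isFacet hn hF
    lia

theorem shellable (hn : 1 ≤ n) : (orderComplex (EvenPartitionProper n)).Shellable := by
  rcases hn.eq_or_lt with rfl | hn
  · exact ⟨[], List.nodup_nil, by simp [not_isFacet_one], fun k => k.elim0⟩
  · obtain ⟨l, hl, -⟩ := exists_isShelling hn
    exact ⟨l, hl⟩

-- For `n = 1` the order complex has no facets, and the empty face plays the role of the only one.
theorem exists_isReverseShelling (hn : 1 ≤ n) :
    ∃ S : List (Finset (EvenPartitionProper n)), S ≠ [] ∧ IsReverseShelling S ∧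
      (∀ F ∈ S, F.card = n - 1) ∧
      ∀ G : Finset (EvenPartitionProper n),
        IsChain (· ≤ ·) (G : Set (EvenPartitionProper n)) ↔ ∃ F ∈ S, G ⊆ F := by
  rcases hn.eq_or_lt with rfl | hn
  · have := isEmpty_proper
    refine ⟨[∅], by simp, .cons _ _ .nil (by simp), by simp, fun G => ?_⟩
    simp [G.eq_empty_of_isEmpty]
  · have := nonempty_proper hn
    obtain ⟨l, ⟨-, hl, -⟩, hS⟩ := exists_isShelling hn
    have hchain : ∀ G : Finset (EvenPartitionProper n),
        IsChain (· ≤ ·) (G : Set (EvenPartitionProper n)) ↔ ∃ F ∈ l.reverse, G ⊆ F := by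
      simp only [List.mem_reverse, hl, isChain_iff_exists_isFacet_superset, implies_true]
    refine ⟨l.reverse, ?_, hS, fun F hF => ?_, hchain⟩
    · obtain ⟨F, hF, -⟩ := (hchain ∅).1 (by simp)
      exact List.ne_nil_of_mem hF
    · have := card_of_isFacet hn ((hl F).1 (List.mem_reverse.1 hF))
      lia

theorem nonempty_homotopyEquiv (hn : 1 ≤ n) :
    Nonempty ((orderComplex (EvenPartitionProper n)).realization ≃ₕ
      SphereWedge (eulerNumber (2 * n - 1)) (n - 1)) := by
  classical
  rcases hn.eq_or_lt with rfl | hn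
  · have := isEmpty_proper
    have := isEmpty_realization (orderComplex (EvenPartitionProper 1))
    have := isEmpty_sphereWedge_zero (eulerNumber (2 * 1 - 1))
    exact ⟨Homeomorph.empty.toHomotopyEquiv⟩
  · obtain ⟨S, hne, hS, hcard, hchain⟩ := exists_isReverseShelling (n := n) (by lia)
    let K : Finset (Finset (EvenPartitionProper n)) :=
      Finset.univ.filter fun G => IsChain (· ≤ ·) (G : Set (EvenPartitionProper n))
    have hK : ∀ G, G ∈ K ↔ IsChain (· ≤ ·) (G : Set (EvenPartitionProper n)) := fun G => by
      simp [K]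
    obtain ⟨d, rfl⟩ : ∃ d, n = d + 2 := ⟨n - 2, by lia⟩
    rw [realization_eq_faceRealization fun s hs => (hK s).trans (and_iff_right hs).symm]
    exact hS.nonempty_homotopyEquiv hne hcard (fun G => (hK G).trans (hchain G))
      (eulerNumber_pos _) (sum_isChain (by lia) hK)

variable (k : Type*) [CommRing k] [IsDomain k]

theorem reducedBetti_eq (hn : 1 ≤ n) (i : ℤ) :
    reducedBetti k (EvenPartitionProper n) i =
      if i = (n : ℤ) - 2 then eulerNumber (2 * n - 1) else 0 := by
  classical
  obtain ⟨S, -, hS, hcard, hchain⟩ := exists_isReverseShelling hn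
  let K : Finset (Finset (EvenPartitionProper n)) :=
    Finset.univ.filter fun G => IsChain (· ≤ ·) (G : Set (EvenPartitionProper n))
  have hK : ∀ G, G ∈ K ↔ IsChain (· ≤ ·) (G : Set (EvenPartitionProper n)) := fun G => by
    simp [K]
  have hdim : ((n - 1 : ℕ) : ℤ) - 1 = n - 2 := by lia
  rw [hS.reducedBetti_eq hcard hK (fun G => (hK G).trans (hchain G)) (sum_isChain hn hK), hdim]

theorem evenBetti_eq (hn : 1 ≤ n) : evenBetti k n = eulerNumber (2 * n - 1) := by
  rw [evenBetti, reducedBetti_eq k hn, if_pos rfl]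

theorem mk_evenBetti_eq_neg_logOf_cos :
    (PowerSeries.mk fun m =>
      if Even m ∧ m ≠ 0 then (evenBetti k (m / 2) : ℚ) / (m ! : ℚ) else 0) =
      -PowerSeries.logOf (PowerSeries.cos ℚ) := by
  rw [← mk_eulerNumber_pred]
  congr 1
  funext m
  refine if_ctx_congr Iff.rfl (fun ⟨heven, hm⟩ => ?_) fun _ => rfl
  obtain ⟨r, rfl⟩ := heven.exists_two_nsmul
  rw [smul_eq_mul, Nat.mul_div_cancel_left r two_pos, evenBetti_eq k (by lia)]

theorem mk_evenBetti_mul_cos :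
    (PowerSeries.mk fun m =>
      if Odd m then (evenBetti k ((m + 1) / 2) : ℚ) / (m ! : ℚ) else 0) *
      PowerSeries.cos ℚ = PowerSeries.sin ℚ := by
  rw [← mk_eulerNumber_mul_cos]
  congr 2
  funext m
  refine if_ctx_congr Iff.rfl (fun ⟨r, hr⟩ => ?_) fun _ => rfl
  have hm : 2 * ((m + 1) / 2) - 1 = m := by lia
  rw [evenBetti_eq k (by lia), hm]

end EvenPartition

theorem mainTheorem2 (k : Type*) [CommRing k] [IsDomain k] :
    (∀ n : ℕ, 1 ≤ n →
      -- the lexicographic order on words is a recursive atom ordering of the poset with a bottom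
      (∃ l : List (EvenPartition n),
        l.Pairwise (fun π ρ => π.word < ρ.word) ∧
        IsRecursiveAtomOrdering (⊥ : WithBot (EvenPartition n)) (l.map (↑))) ∧
      -- the proper part is pure and shellable
      (orderComplex (EvenPartitionProper n)).IsPureOfDim ((n : ℤ) - 2) ∧
      (orderComplex (EvenPartitionProper n)).Shellable ∧
      -- homotopy type
      Nonempty ((orderComplex (EvenPartitionProper n)).realization ≃ₕ
        SphereWedge (eulerNumber (2 * n - 1)) (n - 1)) ∧
      -- reduced Betti numbers
      (∀ i : ℤ, reducedBetti k (EvenPartitionProper n) i =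
        if i = (n : ℤ) - 2 then eulerNumber (2 * n - 1) else 0)) ∧
    -- exponential generating functions of the Betti numbers: `-ln cos u`, with derivative `tan u`
    (PowerSeries.mk fun m => if Even m ∧ m ≠ 0 then (evenBetti k (m / 2) : ℚ) / (m ! : ℚ) else 0) =
      -PowerSeries.logOf (PowerSeries.cos ℚ) ∧
    (PowerSeries.mk fun m => if Odd m then (evenBetti k ((m + 1) / 2) : ℚ) / (m ! : ℚ) else 0) *
      PowerSeries.cos ℚ = PowerSeries.sin ℚ :=
  ⟨fun n hn => ⟨EvenPartition.exists_isRecursiveAtomOrdering n, EvenPartition.isPureOfDim hn,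
      EvenPartition.shellable hn, EvenPartition.nonempty_homotopyEquiv hn,
      EvenPartition.reducedBetti_eq k hn⟩,
    EvenPartition.mk_evenBetti_eq_neg_logOf_cos k, EvenPartition.mk_evenBetti_mul_cos k⟩
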